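/- Let $N\ge 2$, $\nu\ge 1$, let $\Omega\subseteq\mathbb R^N$ be open, let $E,F$ be finite-dimensional complex normed spaces and let $A(x,D)=\sum_{|\alpha|\le\nu}a_\alpha(x)\partial^\alpha$ be a linear differential operator from $E$ to $F$ with smooth coefficients $a_\alpha:\Omega\to\mathrm{Hom}_{\mathbb C}(E,F)$. Let $A^*(x,D)v=\sum_{|\alpha|\le\nu}(-1)^{|\alpha|}\partial^\alpha(a_\alpha^*v)$ be its formal adjoint, so that $\int A\varphi\cdot\bar v=\int\varphi\cdot\overline{A^*v}$ for $\varphi\in C_c^\infty(\Omega;E)$, $v\in C_c^\infty(\Omega;F^*)$; here $E^*,F^*$ are the spaces of conjugate-linear functionals with the dual norm, $a_\alpha^*v=v\circ a_\alpha$, and $\bar v\cdot z=\overline{v(z)}$. For an open set $U\subseteq\Omega$, $k\in\mathbb N$ and $1\le p\le\infty$, let $W^{k,p}(U;E)$ be the space of $g\in L^p(U;E)$ whose weak derivatives of order $k$ belong to $L^p(U;E)$, with the seminorm $\|g\|_{W^{k,p}}=\sum_{|\alpha|=k}\|\partial^\alpha g\|_{L^p(U)}$. For $g\in L^1(U;E)$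 let $$\|D_{\mathcal A}g\|=\sup\Big\{\Big|\int_U g\,\overline{A^*(\cdot,D)v}\Big| : v\in C_c^\infty(U;F^*),\ \|v\|_\infty\le 1\Big\},$$ and let $BV_{\mathcal A,c}(U)$ be the set of $g\in W^{\nu-1,1}(U;E)$ with compact support in $U$ and $\|D_{\mathcal A}g\|<\infty$. Suppose that the open set $U\subseteq\Omega$ has the following two properties. 1. There is $C>0$ with $\|u\|_{W^{\nu-1,N/(N-1)}}\le C\|A(x,D)u\|_{L^1}$ for all $u\in C_c^\infty(U;E)$. 2. There are $0<\beta<1$, a smooth function $\psi:\mathbb R^N\to\mathbb C$ with $\psi=1$ on $U$, and $C>0$ such that $\sum_{|\alpha|=\nu-1}\|\Lambda_{1-\beta}\partial^\alpha\varphi\|_{L^1(\mathbb R^N)}\le C\|A(x,D)\varphi\|_{L^1}$ for all $\varphi\in C_c^\infty(U;E)$, where $\Lambda_\gamma f(x)=\psi(x)\int_{\mathbb R^N}e^{2\pi i x\cdot\xi}(1+4\pi^2|\xi|^2)^{\gamma/2}\hat f(\xi)\,d\xi$ and $\hat f(\xi)=\int_{\mathbb R^N}e^{-2\pi i x\cdot\xi}f(x)\,dx$.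 Let $(g_i)_{i\in\mathbb N}\subseteq BV_{\mathcal A,c}(U)$ be a sequence for which there is a compact set $K\subset U$ with $\operatorname{supp}g_i\subseteq K$ for all $i$, and suppose that $\sup_i\|D_{\mathcal A}g_i\|<\infty$. Then there are $g\in BV_{\mathcal A,c}(U)$ and a subsequence $(g_{i_k})$ with $\|g_{i_k}-g\|_{W^{\nu-1,1}}\to0$ as $k\to\infty$. -/

import Mathlib

open MeasureTheory Filter Topology TopologicalSpace
open scoped ENNReal NNReal ContDiff FourierTransform ComplexConjugate

noncomputable section

namespace DiffOpBV

/-- The multi-indices `α ∈ ℕ^N` of length `|α| = k`. -/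
def multiIndices (N k : ℕ) : Finset (Fin N → ℕ) :=
  Finset.piAntidiag Finset.univ k

/-- The partial derivative `∂ᵢ f` of a function on `ℝ^N`. -/
def partialDeriv {N : ℕ} {G : Type*} [NormedAddCommGroup G] [NormedSpace ℝ G]
    (i : Fin N) (f : EuclideanSpace ℝ (Fin N) → G) : EuclideanSpace ℝ (Fin N) → G :=
  fun x => fderiv ℝ f x (EuclideanSpace.single i 1)

/-- The classical derivative `∂^α f = ∂₁^{α₁} ⋯ ∂_N^{α_N} f` of a smooth function. -/
def multiDeriv {N : ℕ} {G : Type*} [NormedAddCommGroup G] [NormedSpace ℝ G]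
    (α : Fin N → ℕ) (f : EuclideanSpace ℝ (Fin N) → G) : EuclideanSpace ℝ (Fin N) → G :=
  (List.finRange N).foldr (fun i h => (partialDeriv i)^[α i] h) f

/-- A linear differential operator `A(x,D) = ∑_{|α| ≤ ν} a_α(x) ∂^α` of order (at most) `ν` from
`E` to `F`, with smooth coefficients in the open set `Ω`. Only the values of `a_α`, `|α| ≤ ν`,
on `Ω` matter. -/
structure DiffOp {N : ℕ} (Ω : Opens (EuclideanSpace ℝ (Fin N))) (ν : ℕ)
    (E F : Type*) [NormedAddCommGroup E] [NormedSpace ℂ E]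
    [NormedAddCommGroup F] [NormedSpace ℂ F] where
  /-- the coefficients `a_α` -/
  coeff : (Fin N → ℕ) → EuclideanSpace ℝ (Fin N) → (E →L[ℂ] F)
  smooth : ∀ α, ∑ i, α i ≤ ν → ContDiffOn ℝ ∞ (coeff α) Ω

/-- The conjugate dual of `G`: conjugate-linear functionals with the dual norm. If `v` has values
here, then `z ↦ conj (v z)`, that is `v̄`, is a linear functional of the same norm, so the pairing
`v̄ · z` is `conj (v z)`. -/
abbrev ConjDual (G : Type*) [NormedAddCommGroup G] [NormedSpace ℂ G] : Type _ :=
  G →SL[starRingEnd ℂ] ℂ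

section

variable {N ν : ℕ} {Ω : Opens (EuclideanSpace ℝ (Fin N))}
  {E F : Type*} [NormedAddCommGroup E] [NormedSpace ℂ E]
  [NormedAddCommGroup F] [NormedSpace ℂ F]

/-- `A(x,D)φ` for a smooth `φ`. -/
def DiffOp.apply (A : DiffOp Ω ν E F) (φ : EuclideanSpace ℝ (Fin N) → E) :
    EuclideanSpace ℝ (Fin N) → F :=
  fun x => ∑ k ∈ Finset.range (ν + 1), ∑ α ∈ multiIndices N k,
    A.coeff α x (multiDeriv α φ x)

/-- The formal adjoint `A^*(x,D)v = ∑_{|α| ≤ ν} (-1)^{|α|} ∂^α (a_α^* v)`, determined by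
`∫ A φ · v̄ = ∫ φ · conj (A^* v)`; here `a_α(x)^*` maps `v ∈ F^*` to `v ∘ a_α(x) ∈ E^*`. -/
def DiffOp.adjoint (A : DiffOp Ω ν E F) (v : EuclideanSpace ℝ (Fin N) → ConjDual F) :
    EuclideanSpace ℝ (Fin N) → ConjDual E :=
  fun x => ∑ k ∈ Finset.range (ν + 1), ∑ α ∈ multiIndices N k,
    (-1 : ℂ) ^ k • multiDeriv α (fun y => (v y).comp (A.coeff α y)) x

/-- The total `𝒜`-variation in `U`,
`‖D_𝒜 g‖ = sup {|∫_U g conj (A^* v)| : v ∈ C_c^∞(U; F^*), ‖v‖_∞ ≤ 1}`. -/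
def DiffOp.variation (A : DiffOp Ω ν E F) (U : Opens (EuclideanSpace ℝ (Fin N)))
    (g : EuclideanSpace ℝ (Fin N) → E) : ℝ≥0∞ :=
  ⨆ (v : TestFunction U (ConjDual F) ⊤) (_ : ∀ x, ‖v x‖ ≤ 1),
    ‖∫ x in (U : Set (EuclideanSpace ℝ (Fin N))), conj (A.adjoint v x (g x))‖ₑ

/-- `h` is the weak derivative `∂^α g` in `U`. -/
def IsWeakDeriv (U : Opens (EuclideanSpace ℝ (Fin N))) (α : Fin N → ℕ)
    (g h : EuclideanSpace ℝ (Fin N) → E) : Prop :=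
  LocallyIntegrableOn g U ∧ LocallyIntegrableOn h U ∧
    ∀ φ : TestFunction U ℂ ⊤,
      ∫ x in (U : Set (EuclideanSpace ℝ (Fin N))), multiDeriv α φ x • g x =
        (-1 : ℂ) ^ (∑ i, α i) • ∫ x in (U : Set (EuclideanSpace ℝ (Fin N))), φ x • h x

/-- `g ∈ W^{k,p}(U; E)`: both `g` and its weak derivatives of order exactly `k` are in `L^p`. -/
def MemSobolev (k : ℕ) (p : ℝ≥0∞) (U : Opens (EuclideanSpace ℝ (Fin N)))
    (g : EuclideanSpace ℝ (Fin N) → E) : Prop :=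
  MemLp g p (volume.restrict (U : Set (EuclideanSpace ℝ (Fin N)))) ∧
    ∀ α ∈ multiIndices N k, ∃ h : EuclideanSpace ℝ (Fin N) → E,
      IsWeakDeriv U α g h ∧
        MemLp h p (volume.restrict (U : Set (EuclideanSpace ℝ (Fin N))))

/-- The homogeneous seminorm `‖g‖_{W^{k,p}(U)} = ∑_{|α| = k} ‖∂^α g‖_{L^p(U)}`. Weak derivatives
are unique almost everywhere, so the infimum is over one value; it is `∞` if there is no weak
derivative. -/
def sobolevSeminorm (k : ℕ) (p : ℝ≥0∞) (U : Opens (EuclideanSpace ℝ (Fin N)))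
    (g : EuclideanSpace ℝ (Fin N) → E) : ℝ≥0∞ :=
  ∑ α ∈ multiIndices N k,
    ⨅ (h : EuclideanSpace ℝ (Fin N) → E) (_ : IsWeakDeriv U α g h),
      eLpNorm h p (volume.restrict (U : Set (EuclideanSpace ℝ (Fin N))))

/-- `supp g ⊆ K` for the class of `g` in `L¹_loc(U)` and a closed set `K`: `g` vanishes almost
everywhere in `U \ K`. -/
def SuppIn (U : Opens (EuclideanSpace ℝ (Fin N))) (K : Set (EuclideanSpace ℝ (Fin N)))
    (g : EuclideanSpace ℝ (Fin N) → E) : Prop :=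
  ∀ᵐ x ∂(volume.restrict (U : Set (EuclideanSpace ℝ (Fin N)))), x ∉ K → g x = 0

/-- `g ∈ BV_{𝒜,c}(U)`: `g ∈ W^{ν-1,1}(U; E)` has compact support in `U` and finite
`𝒜`-variation. -/
structure DiffOp.MemBVc (A : DiffOp Ω ν E F) (U : Opens (EuclideanSpace ℝ (Fin N)))
    (g : EuclideanSpace ℝ (Fin N) → E) : Prop where
  memSobolev : MemSobolev (ν - 1) 1 U g
  compactSupp : ∃ K : Set (EuclideanSpace ℝ (Fin N)), IsCompact K ∧ K ⊆ U ∧ SuppIn U K g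
  variation_lt_top : A.variation U g < ⊤

/-- `U` supports the Sobolev-Gagliardo-Nirenberg inequality
`‖u‖_{W^{ν-1,N/(N-1)}} ≤ C ‖A(x,D)u‖_{L¹}` for all `u ∈ C_c^∞(U; E)`. -/
def DiffOp.SupportsSGN (A : DiffOp Ω ν E F) (U : Opens (EuclideanSpace ℝ (Fin N))) : Prop :=
  ∃ C : ℝ≥0, ∀ u : TestFunction U E ⊤,
    ∑ α ∈ multiIndices N (ν - 1),
        eLpNorm (multiDeriv α u) (ENNReal.ofReal ((N : ℝ) / ((N : ℝ) - 1))) volume ≤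
      C * eLpNorm (A.apply u) 1 volume

/-- The operator `Λ_γ` with symbol `ψ(x) (1 + 4π²|ξ|²)^{γ/2}`, of order `γ`:
`Λ_γ f(x) = ψ(x) ∫ e^{2πi x·ξ} (1 + 4π²|ξ|²)^{γ/2} f̂(ξ) dξ`. -/
def besselOp (ψ : EuclideanSpace ℝ (Fin N) → ℂ) (γ : ℝ)
    (f : EuclideanSpace ℝ (Fin N) → E) : EuclideanSpace ℝ (Fin N) → E :=
  fun x => ψ x • 𝓕⁻ (fun ξ : EuclideanSpace ℝ (Fin N) =>
    (1 + 4 * Real.pi ^ 2 * ‖ξ‖ ^ 2) ^ (γ / 2) • 𝓕 f ξ) x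

/-- `U` supports the fractional estimate
`∑_{|α| = ν-1} ‖∂^α φ‖_{1-β,1} ≤ C ‖A(x,D)φ‖_{L¹}` for all `φ ∈ C_c^∞(U; E)`, where
`‖f‖_{γ,1} = ‖Λ_γ f‖_{L¹(ℝ^N)}` is formed with some smooth `ψ` that is `1` on `U`.
Compact support of `ψ` is not asked for, so that `U` may be unbounded. -/
def DiffOp.SupportsFractional (A : DiffOp Ω ν E F) (U : Opens (EuclideanSpace ℝ (Fin N)))
    (β : ℝ) : Prop :=
  ∃ ψ : EuclideanSpace ℝ (Fin N) → ℂ, ContDiff ℝ ∞ ψ ∧ (∀ x ∈ U, ψ x = 1) ∧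
    ∃ C : ℝ≥0, ∀ φ : TestFunction U E ⊤,
      ∑ α ∈ multiIndices N (ν - 1), eLpNorm (besselOp ψ (1 - β) (multiDeriv α φ)) 1 volume ≤
        C * eLpNorm (A.apply φ) 1 volume

end

end DiffOpBV

end

noncomputable section

namespace DiffOpBV

local notation "𝔼" N => EuclideanSpace ℝ (Fin N)

section MultiDeriv

variable {N : ℕ} {G : Type*} [NormedAddCommGroup G] [NormedSpace ℝ G]

/-! ### Iterated partial derivatives of smooth functions -/

/-! Replace the `g i` by smooth functions with the same limits, to which both hypotheses on `U`
apply, and prove a Rellich theorem for those.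

Approximation (`DiffOp.exists_smooth_approx`). Let u = ρ_ε * g. Mollification commutes with
derivatives, so A u differs from a mollification of A g only by commutators with the coefficients.
On derivatives of order below ν these are O(ε) in L¹. On a derivative of order ν, Friedrichs' lemma
bounds them, uniformly in ε, by the L¹ norm of a derivative of order ν - 1, and approximation by
smooth functions improves boundedness to convergence to zero. Testing with v and moving the
mollifier onto v, which preserves |v| ≤ 1, bounds the pairing of A u with v by the variation of g
plus one; duality then bounds A u in L¹. A constant is lost there, but only boundedness matters.

Compactness (`exists_finite_net_of_besselPow_bound`). Let f = ∂^α u with |α| = ν - 1 and s = (1 -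
β)/2. The Sobolev inequality and Hölder bound f in L¹; the fractional estimate bounds F = (1 - Δ)^s
f in L¹(U). Outside U, at positive distance from the support of f, F is controlled by the L¹ norm of
f, because the kernel of (1 - Δ)^s is integrable away from the origin
(`lintegral_compl_enorm_besselPow_le`). So F is bounded in L¹(ℝ^N). Now f = Γ(s)⁻¹ ∫ t^(s-1)
e^{-t(1-Δ)} F dt: the part t ≤ δ is O(δ^s) in L¹, and the part t > δ is bounded and Lipschitz with
constants depending on δ (`exists_lipschitz_approx`). Arzelà–Ascoli then gives finite L¹-nets.
Poincaré's inequality carries them from ∂^α u to u.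

Conclusion. L¹-limits of derivatives are weak derivatives, and the variation is a supremum of
L¹-continuous functionals, hence lower semicontinuous; so the limit lies in the same space. -/

theorem contDiff_partialDeriv {f : (𝔼 N) → G} (hf : ContDiff ℝ ∞ f) (i : Fin N) :
    ContDiff ℝ ∞ (partialDeriv i f) :=
  (hf.fderiv_right (m := ∞) (by simp)).clm_apply contDiff_const

theorem tsupport_partialDeriv_subset (f : (𝔼 N) → G) (i : Fin N) :
    tsupport (partialDeriv i f) ⊆ tsupport f :=
  tsupport_fderiv_apply_subset ℝ _

theorem partialDeriv_comm {f : (𝔼 N) → G} (hf : ContDiff ℝ ∞ f) (i j : Fin N) :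
    partialDeriv i (partialDeriv j f) = partialDeriv j (partialDeriv i f) := by
  have key : ∀ i j : Fin N, ∀ x, partialDeriv i (partialDeriv j f) x =
      fderiv ℝ (fderiv ℝ f) x (EuclideanSpace.single i 1) (EuclideanSpace.single j 1) := by
    intro i j x
    have h : DifferentiableAt ℝ (fderiv ℝ f) x :=
      ((hf.fderiv_right (m := ∞) (by simp)).differentiable (by simp)) x
    unfold partialDeriv
    rw [fderiv_clm_apply h (differentiableAt_const _)]
    simp
  ext1 x
  rw [key, key]
  exact (hf.contDiffAt.isSymmSndFDerivAt (by
    rw [minSmoothness_of_isRCLikeNormedField];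
    exact WithTop.coe_le_coe.2 (le_top : (2 : ℕ∞) ≤ ⊤))).eq _ _

theorem partialDeriv_congr {f g : (𝔼 N) → G} {x : 𝔼 N} (h : f =ᶠ[𝓝 x] g) (i : Fin N) :
    partialDeriv i f =ᶠ[𝓝 x] partialDeriv i g :=
  (h.fderiv (𝕜 := ℝ)).mono fun y hy => by simp only [partialDeriv, hy]

/-- The iterated partial derivative along a list of coordinate directions. -/
def listDeriv (L : List (Fin N)) (f : (𝔼 N) → G) : (𝔼 N) → G :=
  L.foldr partialDeriv f

@[simp] theorem listDeriv_nil (f : (𝔼 N) → G) : listDeriv [] f = f := rfl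

@[simp] theorem listDeriv_cons (i : Fin N) (L : List (Fin N)) (f : (𝔼 N) → G) :
    listDeriv (i :: L) f = partialDeriv i (listDeriv L f) := rfl

theorem listDeriv_append (L L' : List (Fin N)) (f : (𝔼 N) → G) :
    listDeriv (L ++ L') f = listDeriv L (listDeriv L' f) := by
  simp [listDeriv]

theorem contDiff_listDeriv {f : (𝔼 N) → G} (hf : ContDiff ℝ ∞ f) (L : List (Fin N)) :
    ContDiff ℝ ∞ (listDeriv L f) := by
  induction L with
  | nil => exact hf
  | cons i L ih => exact contDiff_partialDeriv ih i

theorem tsupport_listDeriv_subset (f : (𝔼 N) → G) (L : List (Fin N)) :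
    tsupport (listDeriv L f) ⊆ tsupport f := by
  induction L with
  | nil => exact subset_rfl
  | cons i L ih => exact (tsupport_partialDeriv_subset _ i).trans ih

theorem listDeriv_congr {f g : (𝔼 N) → G} {x : 𝔼 N} (h : f =ᶠ[𝓝 x] g) (L : List (Fin N)) :
    listDeriv L f =ᶠ[𝓝 x] listDeriv L g := by
  induction L with
  | nil => exact h
  | cons i L ih => exact partialDeriv_congr ih i

/-- Symmetry of second derivatives gives adjacent swaps, and these generate all permutations. Lists
make it possible to split one derivative off a multi-index or to pad it with further ones. -/
theorem listDeriv_perm {f : (𝔼 N) → G} (hf : ContDiff ℝ ∞ f) {L L' : List (Fin N)}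
    (h : L.Perm L') : listDeriv L f = listDeriv L' f := by
  induction h with
  | nil => rfl
  | cons i _ ih => simp [ih]
  | swap i j L => exact partialDeriv_comm (contDiff_listDeriv hf L) j i
  | trans _ _ ih₁ ih₂ => exact ih₁.trans ih₂

/-- The list of directions in the multi-index `α`. -/
def multiList (α : Fin N → ℕ) : List (Fin N) :=
  (List.finRange N).flatMap fun i => List.replicate (α i) i

theorem multiDeriv_eq_listDeriv (α : Fin N → ℕ) (f : (𝔼 N) → G) :
    multiDeriv α f = listDeriv (multiList α) f := by
  unfold multiDeriv multiList
  induction List.finRange N with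
  | nil => rfl
  | cons i l ih =>
    rw [List.foldr_cons, List.flatMap_cons, listDeriv_append, ← ih]
    generalize List.foldr _ f l = h
    induction α i with
    | zero => rfl
    | succ n ihn => rw [Function.iterate_succ_apply', ihn, List.replicate_succ, listDeriv_cons]

theorem count_multiList (α : Fin N → ℕ) (i : Fin N) : (multiList α).count i = α i := by
  unfold multiList
  rw [List.count_flatMap]
  have : (List.count i ∘ fun i => List.replicate (α i) i) = fun j => if j = i then α i else 0 := by
    ext j
    by_cases h : j = i
    · subst h; simp
    · simp [h, List.count_replicate]
  rw [this, ← Fin.sum_univ_def]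
  simp

theorem length_multiList (α : Fin N → ℕ) : (multiList α).length = ∑ i, α i := by
  unfold multiList
  rw [List.length_flatMap, ← Fin.sum_univ_def]
  simp

theorem listDeriv_eq_multiDeriv {f : (𝔼 N) → G} (hf : ContDiff ℝ ∞ f) (L : List (Fin N)) :
    listDeriv L f = multiDeriv (fun i => L.count i) f := by
  rw [multiDeriv_eq_listDeriv]
  exact listDeriv_perm hf (List.perm_iff_count.2 fun i => (count_multiList (fun i => L.count i) i).symm)

theorem mem_multiIndices {k : ℕ} {α : Fin N → ℕ} : α ∈ multiIndices N k ↔ ∑ i, α i = k := by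
  simp [multiIndices]

theorem count_mem_multiIndices (L : List (Fin N)) :
    (fun i => L.count i) ∈ multiIndices N L.length := by
  rw [mem_multiIndices]
  simpa using Multiset.sum_count_eq_card (s := Finset.univ) (m := (L : Multiset (Fin N)))
    (by simp)

/-- Partial derivatives commute with continuous linear maps. -/
theorem listDeriv_clm_comp {G' : Type*} [NormedAddCommGroup G'] [NormedSpace ℝ G']
    (T : G →L[ℝ] G') {f : (𝔼 N) → G} (hf : ContDiff ℝ ∞ f) (L : List (Fin N)) :
    listDeriv L (fun x => T (f x)) = fun x => T (listDeriv L f x) := by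
  induction L with
  | nil => rfl
  | cons i L ih =>
    rw [listDeriv_cons, ih]
    ext1 x
    have h := ((contDiff_listDeriv hf L).differentiable (by simp)) x
    have := T.hasFDerivAt.comp x h.hasFDerivAt
    simp only [partialDeriv, listDeriv_cons]
    rw [show (fun x => T (listDeriv L f x)) = T ∘ listDeriv L f from rfl, this.fderiv]
    rfl

theorem listDeriv_sub {f g : (𝔼 N) → G} (hf : ContDiff ℝ ∞ f) (hg : ContDiff ℝ ∞ g)
    (L : List (Fin N)) : listDeriv L (f - g) = listDeriv L f - listDeriv L g := by
  induction L with
  | nil => rfl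
  | cons i L ih =>
    rw [listDeriv_cons, ih]
    ext1 x
    simp only [partialDeriv, listDeriv_cons, Pi.sub_apply]
    rw [fderiv_sub (((contDiff_listDeriv hf L).differentiable (by simp)) x)
      (((contDiff_listDeriv hg L).differentiable (by simp)) x)]
    rfl

/-- Reflection changes the sign of partial derivatives of odd order. -/
theorem listDeriv_comp_sub_left {f : (𝔼 N) → G} (hf : ContDiff ℝ ∞ f) (x : 𝔼 N)
    (L : List (Fin N)) :
    listDeriv L (fun y => f (x - y)) = fun y => (-1 : ℝ) ^ L.length • listDeriv L f (x - y) := by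
  induction L with
  | nil => simp
  | cons i L ih =>
    rw [listDeriv_cons, ih]
    ext1 y
    have h := ((contDiff_listDeriv hf L).differentiable (by simp)) (x - y)
    have h2 : HasFDerivAt (fun y => x - y) (-ContinuousLinearMap.id ℝ (𝔼 N)) y := by
      simpa using (hasFDerivAt_id y).const_sub x
    have h3 := (h.hasFDerivAt.comp y h2).const_smul ((-1 : ℝ) ^ L.length)
    simp only [partialDeriv, listDeriv_cons]
    have h4 := h3.fderiv
    simp only [Function.comp_def, Pi.smul_def] at h4
    rw [h4]
    simp [pow_succ]

/-! ### Integration by parts for bilinear pairings -/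

section IntegrationByParts

variable {G₁ G₂ W : Type*} [NormedAddCommGroup G₁] [NormedSpace ℝ G₁]
  [NormedAddCommGroup G₂] [NormedSpace ℝ G₂] [NormedAddCommGroup W] [NormedSpace ℝ W]

/-- A general bilinear map is allowed because the identity is applied to scalar multiplication, to
evaluation of operators and to the duality pairing. -/
theorem integral_bilin_partialDeriv (B : G₁ →L[ℝ] G₂ →L[ℝ] W) {f : (𝔼 N) → G₁} {g : (𝔼 N) → G₂}
    (hf : ContDiff ℝ ∞ f) (hg : ContDiff ℝ ∞ g) (hgc : HasCompactSupport g) (i : Fin N) :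
    ∫ x, B (f x) (partialDeriv i g x) = - ∫ x, B (partialDeriv i f x) (g x) := by
  have hInt : ∀ {f : (𝔼 N) → G₁} {g : (𝔼 N) → G₂}, ContDiff ℝ ∞ f → ContDiff ℝ ∞ g →
      HasCompactSupport g → Integrable (fun x => B (f x) (g x)) := by
    intro f g hf hg hgc
    refine Continuous.integrable_of_hasCompactSupport ?_ ?_
    · exact (B.continuous.comp hf.continuous).clm_apply hg.continuous
    · exact hgc.mono fun x hx => by
        contrapose! hx
        simp only [Function.mem_support, not_not] at hx
        simp [hx]
  refine integral_bilinear_fderiv_right_eq_neg_left_of_integrable ?_ ?_ ?_ ?_ ?_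
  · exact hInt (contDiff_partialDeriv hf i) hg hgc
  · exact hInt hf (contDiff_partialDeriv hg i) (hgc.mono' <|
      (subset_tsupport _).trans (tsupport_partialDeriv_subset g i))
  · exact hInt hf hg hgc
  · exact fun x _ => (hf.differentiable (by simp)) x
  · exact fun x _ => (hg.differentiable (by simp)) x

theorem HasCompactSupport.listDeriv {f : (𝔼 N) → G} (hf : HasCompactSupport f)
    (L : List (Fin N)) : HasCompactSupport (listDeriv L f) :=
  hf.mono' ((subset_tsupport _).trans (tsupport_listDeriv_subset f L))

theorem integral_bilin_listDeriv (B : G₁ →L[ℝ] G₂ →L[ℝ] W) {f : (𝔼 N) → G₁} {g : (𝔼 N) → G₂}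
    (hf : ContDiff ℝ ∞ f) (hg : ContDiff ℝ ∞ g) (hgc : HasCompactSupport g) (L : List (Fin N)) :
    ∫ x, B (f x) (listDeriv L g x) = (-1 : ℝ) ^ L.length • ∫ x, B (listDeriv L f x) (g x) := by
  induction L generalizing f with
  | nil => simp
  | cons i L ih =>
    rw [listDeriv_cons, integral_bilin_partialDeriv B hf (contDiff_listDeriv hg L)
      (HasCompactSupport.listDeriv hgc L), ih (contDiff_partialDeriv hf i)]
    -- `∂ᵢ` reaches `f` as the innermost derivative, whereas the claim has it outermost.
    have : listDeriv (i :: L) f = listDeriv L (partialDeriv i f) := by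
      rw [listDeriv_perm hf (List.perm_append_singleton i L).symm, listDeriv_append]
      rfl
    rw [this]
    simp [pow_succ]

end IntegrationByParts

end MultiDeriv

section Mollification

variable {N : ℕ} {G G' : Type*} [NormedAddCommGroup G] [NormedSpace ℝ G]
  [NormedAddCommGroup G'] [NormedSpace ℝ G']

/-! ### Mollification -/

/-- The convolution of `f` with the scalar kernel `ρ`. -/
def mollify (ρ : (𝔼 N) → ℝ) (f : (𝔼 N) → G) : (𝔼 N) → G :=
  fun x => ∫ t, ρ t • f (x - t)

theorem mollify_eq_convolution (ρ : (𝔼 N) → ℝ) (f : (𝔼 N) → G) :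
    mollify ρ f = convolution ρ f (ContinuousLinearMap.lsmul ℝ ℝ) volume := rfl

theorem mollify_eq_swap (ρ : (𝔼 N) → ℝ) (f : (𝔼 N) → G) (x : 𝔼 N) :
    mollify ρ f x = ∫ t, ρ (x - t) • f t := by
  rw [mollify_eq_convolution, convolution_eq_swap]
  rfl

/-- `ρ` is an even mollifier at scale `ε` whose gradient has `L¹` norm at most `C / ε`. -/
structure IsMollifier (ρ : (𝔼 N) → ℝ) (ε C : ℝ) : Prop where
  smooth : ContDiff ℝ ∞ ρ
  nonneg : ∀ x, 0 ≤ ρ x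
  supp : tsupport ρ ⊆ Metric.closedBall 0 ε
  even : ∀ x, ρ (-x) = ρ x
  integral_eq : ∫ x, ρ x = 1
  deriv_le : ∀ j, ∫⁻ x, ‖partialDeriv j ρ x‖ₑ ≤ ENNReal.ofReal (C / ε)

theorem IsMollifier.hasCompactSupport {ρ : (𝔼 N) → ℝ} {ε C : ℝ} (h : IsMollifier ρ ε C) :
    HasCompactSupport ρ :=
  (isCompact_closedBall 0 ε).of_isClosed_subset (isClosed_tsupport _) h.supp

theorem IsMollifier.integrable {ρ : (𝔼 N) → ℝ} {ε C : ℝ} (h : IsMollifier ρ ε C) :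
    Integrable ρ :=
  h.smooth.continuous.integrable_of_hasCompactSupport h.hasCompactSupport

theorem IsMollifier.lintegral_eq {ρ : (𝔼 N) → ℝ} {ε C : ℝ} (h : IsMollifier ρ ε C) :
    ∫⁻ x, ‖ρ x‖ₑ = 1 := by
  have := ofReal_integral_eq_lintegral_ofReal h.integrable (.of_forall h.nonneg)
  rw [h.integral_eq, ENNReal.ofReal_one] at this
  rw [this]
  exact lintegral_congr fun x => Real.enorm_of_nonneg (h.nonneg x)

theorem IsMollifier.norm_le {ρ : (𝔼 N) → ℝ} {ε C : ℝ} (h : IsMollifier ρ ε C) {x : 𝔼 N}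
    (hx : x ∈ tsupport ρ) : ‖x‖ ≤ ε := by
  simpa using h.supp hx

/-- Rescale one even bump to ε^(-N) ρ(x/ε). Each derivative gains a factor 1/ε in L¹, so `C` can be
the sum over all directions of the L¹ norms at scale one, independent of ε. -/
theorem exists_isMollifier (N : ℕ) : ∃ C : ℝ, 0 ≤ C ∧ ∀ ε : ℝ, 0 < ε →
    ∃ ρ : (𝔼 N) → ℝ, IsMollifier ρ ε C := by
  let b : ContDiffBump (0 : 𝔼 N) := ⟨1 / 2, 1, by norm_num, by norm_num⟩
  let ρ : (𝔼 N) → ℝ := b.normed volume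
  have hρ : ContDiff ℝ ∞ ρ := b.contDiff_normed
  have hρc : HasCompactSupport ρ := b.hasCompactSupport_normed
  have hInt : ∀ j, Integrable (partialDeriv j ρ) := fun j =>
    (contDiff_partialDeriv hρ j).continuous.integrable_of_hasCompactSupport
      (hρc.mono' ((subset_tsupport _).trans (tsupport_partialDeriv_subset ρ j)))
  let C : ℝ := ∑ j, ∫ x, ‖partialDeriv j ρ x‖
  have hC : ∀ j, ∫ x, ‖partialDeriv j ρ x‖ ≤ C := fun j =>
    Finset.single_le_sum (f := fun j => ∫ x, ‖partialDeriv j ρ x‖)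
      (fun i _ => integral_nonneg fun x => norm_nonneg _) (Finset.mem_univ j)
  refine ⟨C, Finset.sum_nonneg fun i _ => integral_nonneg fun x => norm_nonneg _, fun ε hε => ?_⟩
  have hpow : 0 < ε ^ N := pow_pos hε N
  refine ⟨fun x => (ε ^ N)⁻¹ * ρ (ε⁻¹ • x), ?_, ?_, ?_, ?_, ?_, ?_⟩
  · exact contDiff_const.mul (hρ.comp (contDiff_const_smul _))
  · exact fun x => mul_nonneg (inv_nonneg.2 hpow.le) (b.nonneg_normed _)
  · refine closure_minimal (fun x hx => ?_) Metric.isClosed_closedBall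
    have h1 : ρ (ε⁻¹ • x) ≠ 0 := right_ne_zero_of_mul hx
    have h2 : ε⁻¹ • x ∈ Metric.ball (0 : 𝔼 N) 1 := by
      rw [← b.support_normed_eq (μ := volume)]; exact h1
    rw [mem_ball_zero_iff, norm_smul, norm_inv, Real.norm_of_nonneg hε.le, inv_mul_lt_iff₀ hε] at h2
    simpa using h2.le
  · intro x
    simp only [smul_neg]
    rw [show ρ (-(ε⁻¹ • x)) = ρ (ε⁻¹ • x) from b.normed_neg _]
  · rw [integral_const_mul, Measure.integral_comp_inv_smul_of_nonneg _ _ hε.le]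
    simp only [finrank_euclideanSpace, Fintype.card_fin, smul_eq_mul]
    rw [show ∫ x, ρ x = 1 from b.integral_normed, mul_one, inv_mul_cancel₀ hpow.ne']
  · intro j
    have hd : ∀ x, partialDeriv j (fun x => (ε ^ N)⁻¹ * ρ (ε⁻¹ • x)) x =
        ((ε ^ N)⁻¹ * ε⁻¹) * partialDeriv j ρ (ε⁻¹ • x) := by
      intro x
      have h1 : HasFDerivAt (fun x : 𝔼 N => ε⁻¹ • x) (ε⁻¹ • ContinuousLinearMap.id ℝ (𝔼 N)) x :=
        (hasFDerivAt_id x).const_smul ε⁻¹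
      have h2 := (((hρ.differentiable (by simp)) (ε⁻¹ • x)).hasFDerivAt.comp x h1).const_mul
        ((ε ^ N)⁻¹)
      have h3 := h2.fderiv
      simp only [Function.comp_def] at h3
      simp only [partialDeriv]
      rw [h3]
      simp
      ring
    have hint2 : Integrable fun x => partialDeriv j ρ (ε⁻¹ • x) :=
      (hInt j).comp_smul (inv_ne_zero hε.ne')
    simp only [hd]
    rw [← ofReal_integral_norm_eq_lintegral_enorm (hint2.const_mul _)]
    refine ENNReal.ofReal_le_ofReal ?_
    simp only [norm_mul]
    rw [integral_const_mul,
      Measure.integral_comp_inv_smul_of_nonneg volume (fun x => ‖partialDeriv j ρ x‖) hε.le]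
    simp only [finrank_euclideanSpace, Fintype.card_fin, smul_eq_mul, norm_inv, norm_pow,
      Real.norm_of_nonneg hε.le]
    have : (ε ^ N)⁻¹ * ε⁻¹ * (ε ^ N * ∫ x, ‖partialDeriv j ρ x‖) =
        (∫ x, ‖partialDeriv j ρ x‖) / ε := by
      field_simp
    rw [this]
    exact div_le_div_of_nonneg_right (hC j) hε.le

/-- Tonelli's theorem for convolutions. -/
theorem lintegral_lintegral_mul_enorm_sub {H : Type*} [NormedAddCommGroup H]
    {k : (𝔼 N) → ℝ≥0∞} (hk : AEMeasurable k) {f : (𝔼 N) → H} (hf : AEStronglyMeasurable f) :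
    ∫⁻ x, ∫⁻ t, k t * ‖f (x - t)‖ₑ = (∫⁻ t, k t) * ∫⁻ x, ‖f x‖ₑ := by
  have hm : AEMeasurable (fun p : (𝔼 N) × (𝔼 N) => k p.2 * ‖f (p.1 - p.2)‖ₑ)
      (volume.prod volume) := by
    refine (hk.comp_snd).mul ?_
    exact (hf.comp_quasiMeasurePreserving
      (quasiMeasurePreserving_sub_of_right_invariant volume volume)).enorm
  rw [lintegral_lintegral_swap hm]
  have : ∀ t, ∫⁻ x, k t * ‖f (x - t)‖ₑ = k t * ∫⁻ x, ‖f x‖ₑ := by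
    intro t
    rw [lintegral_const_mul'']
    · rw [lintegral_sub_right_eq_self (fun x => ‖f x‖ₑ)]
    · exact (hf.comp_quasiMeasurePreserving
        (measurePreserving_sub_right volume t).quasiMeasurePreserving).enorm
  simp only [this]
  rw [lintegral_mul_const'' _ hk]

/-- Young's inequality for any integral operator dominated by a convolution. Mollification and both
commutator bounds thereby reduce to a pointwise estimate of the integrand. -/
theorem lintegral_enorm_integral_le {H : Type*} [NormedAddCommGroup H]
    {k : (𝔼 N) → ℝ≥0∞} (hk : AEMeasurable k) {f : (𝔼 N) → H}
    (hf : AEStronglyMeasurable f) {T : (𝔼 N) → (𝔼 N) → G'}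
    (hT : ∀ x t, ‖T x t‖ₑ ≤ k t * ‖f (x - t)‖ₑ) :
    ∫⁻ x, ‖∫ t, T x t‖ₑ ≤ (∫⁻ t, k t) * ∫⁻ x, ‖f x‖ₑ := by
  rw [← lintegral_lintegral_mul_enorm_sub hk hf]
  exact lintegral_mono fun x => (enorm_integral_le_lintegral_enorm _).trans
    (lintegral_mono fun t => hT x t)

variable {ρ : (𝔼 N) → ℝ} {ε C : ℝ}

theorem lintegral_enorm_mollify_le (hρ : IsMollifier ρ ε C) {f : (𝔼 N) → G}
    (hf : AEStronglyMeasurable f) : ∫⁻ x, ‖mollify ρ f x‖ₑ ≤ ∫⁻ x, ‖f x‖ₑ := by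
  have := lintegral_enorm_integral_le (k := fun t => ‖ρ t‖ₑ)
    hρ.smooth.continuous.enorm.aemeasurable hf
    (T := fun x t => ρ t • f (x - t)) (fun x t => by rw [enorm_smul])
  rwa [hρ.lintegral_eq, one_mul] at this

theorem integrable_mollify_integrand (hρ : ContDiff ℝ ∞ ρ) (hρc : HasCompactSupport ρ)
    {f : (𝔼 N) → G} (hf : LocallyIntegrable f) (x : 𝔼 N) :
    Integrable fun t => ρ t • f (x - t) :=
  hρc.convolutionExists_left (ContinuousLinearMap.lsmul ℝ ℝ) hρ.continuous hf x

theorem contDiff_mollify (hρ : ContDiff ℝ ∞ ρ) (hρc : HasCompactSupport ρ) {f : (𝔼 N) → G}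
    (hf : LocallyIntegrable f) : ContDiff ℝ ∞ (mollify ρ f) :=
  hρc.contDiff_convolution_left (n := ⊤) (ContinuousLinearMap.lsmul ℝ ℝ) hρ hf

theorem mollify_sub (hρ : ContDiff ℝ ∞ ρ) (hρc : HasCompactSupport ρ) {f g : (𝔼 N) → G}
    (hf : LocallyIntegrable f) (hg : LocallyIntegrable g) :
    mollify ρ (f - g) = mollify ρ f - mollify ρ g := by
  ext1 x
  simp only [mollify, Pi.sub_apply, smul_sub]
  exact integral_sub (integrable_mollify_integrand hρ hρc hf x)
    (integrable_mollify_integrand hρ hρc hg x)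

theorem integrable_mollify (hρ : IsMollifier ρ ε C) {f : (𝔼 N) → G} (hf : Integrable f) :
    Integrable (mollify ρ f) :=
  hρ.integrable.integrable_convolution (ContinuousLinearMap.lsmul ℝ ℝ) hf

theorem partialDeriv_mollify_left [CompleteSpace G] (hρ : ContDiff ℝ ∞ ρ)
    (hρc : HasCompactSupport ρ)
    {f : (𝔼 N) → G} (hf : LocallyIntegrable f) (j : Fin N) :
    partialDeriv j (mollify ρ f) = mollify (partialDeriv j ρ) f := by
  ext1 x
  have h := hρc.hasFDerivAt_convolution_left (ContinuousLinearMap.lsmul ℝ ℝ)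
    (hρ.of_le (by simp)) hf x
  simp only [partialDeriv, mollify_eq_convolution]
  rw [h.fderiv]
  simp only [convolution]
  rw [ContinuousLinearMap.integral_apply]
  · rfl
  · exact (hρc.fderiv ℝ).convolutionExists_left _ (hρ.continuous_fderiv (by simp)) hf x

theorem partialDeriv_mollify_right [CompleteSpace G] (hρ : Continuous ρ)
    {f : (𝔼 N) → G} (hf : ContDiff ℝ ∞ f) (hfc : HasCompactSupport f) (j : Fin N) :
    partialDeriv j (mollify ρ f) = mollify ρ (partialDeriv j f) := by
  ext1 x
  have h := hfc.hasFDerivAt_convolution_right (ContinuousLinearMap.lsmul ℝ ℝ)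
    (hρ.locallyIntegrable (μ := volume)) (hf.of_le (by simp)) x
  simp only [partialDeriv, mollify_eq_convolution]
  rw [h.fderiv]
  simp only [convolution]
  rw [ContinuousLinearMap.integral_apply]
  · rfl
  · exact (hfc.fderiv ℝ).convolutionExists_right _ (hρ.locallyIntegrable)
      (hf.continuous_fderiv (by simp)) x

theorem listDeriv_mollify_right [CompleteSpace G] (hρ : Continuous ρ)
    {f : (𝔼 N) → G} (hf : ContDiff ℝ ∞ f) (hfc : HasCompactSupport f) (L : List (Fin N)) :
    listDeriv L (mollify ρ f) = mollify ρ (listDeriv L f) := by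
  induction L with
  | nil => rfl
  | cons i L ih =>
    rw [listDeriv_cons, ih, partialDeriv_mollify_right hρ (contDiff_listDeriv hf L)
      (HasCompactSupport.listDeriv hfc L)]
    rfl

theorem listDeriv_mollify_left [CompleteSpace G] (hρ : ContDiff ℝ ∞ ρ)
    (hρc : HasCompactSupport ρ) {f : (𝔼 N) → G} (hf : LocallyIntegrable f) (L : List (Fin N)) :
    listDeriv L (mollify ρ f) = mollify (listDeriv L ρ) f := by
  induction L with
  | nil => rfl
  | cons i L ih =>
    rw [listDeriv_cons, ih, partialDeriv_mollify_left (contDiff_listDeriv hρ L)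
      (HasCompactSupport.listDeriv hρc L) hf]
    rfl

theorem tsupport_mollify_subset (hρ : IsMollifier ρ ε C) {f : (𝔼 N) → G} {K : Set (𝔼 N)}
    (hf : ∀ x ∉ K, f x = 0) : tsupport (mollify ρ f) ⊆ Metric.cthickening ε K := by
  refine closure_minimal (fun x hx => ?_) Metric.isClosed_cthickening
  by_contra hxK
  refine hx (integral_eq_zero_of_ae (.of_forall fun t => ?_))
  by_cases ht : t ∈ tsupport ρ
  · simp only [Pi.zero_apply]
    rw [hf, smul_zero]
    intro hK
    refine hxK (Metric.mem_cthickening_of_dist_le x (x - t) ε K hK ?_)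
    simpa [dist_eq_norm] using hρ.norm_le ht
  · simp only [Pi.zero_apply]
    rw [image_eq_zero_of_notMem_tsupport ht, zero_smul]

theorem norm_mollify_le (hρ : IsMollifier ρ ε C) {f : (𝔼 N) → G} {M : ℝ}
    (hf : ∀ x, ‖f x‖ ≤ M) (x : 𝔼 N) : ‖mollify ρ f x‖ ≤ M := by
  have h : ‖mollify ρ f x‖ ≤ ∫ t, ρ t * M := by
    refine norm_integral_le_of_norm_le (hρ.integrable.mul_const M) (.of_forall fun t => ?_)
    rw [norm_smul, Real.norm_of_nonneg (hρ.nonneg t)]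
    exact mul_le_mul_of_nonneg_left (hf _) (hρ.nonneg t)
  rwa [integral_mul_const, hρ.integral_eq, one_mul] at h

/-- Mollifications converge in `L¹`. -/
theorem lintegral_mollify_sub_le [CompleteSpace G] {f : (𝔼 N) → G} (hf : Integrable f)
    {η : ℝ≥0∞} (hη : η ≠ 0) : ∃ ε₀ : ℝ, 0 < ε₀ ∧ ∀ (ρ : (𝔼 N) → ℝ) (ε C : ℝ), ε ≤ ε₀ →
      IsMollifier ρ ε C → ∫⁻ x, ‖mollify ρ f x - f x‖ₑ ≤ η := by
  have hη3 : η / 3 ≠ 0 := by simp [hη]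
  obtain ⟨φ, hφc, hφ, hφcont, hφint⟩ := hf.exists_hasCompactSupport_lintegral_sub_le hη3
  let K := tsupport φ
  let K' := Metric.cthickening 1 K
  have hK' : IsCompact K' := IsCompact.cthickening hφc
  have hKK' : K ⊆ K' := Metric.self_subset_cthickening _
  have hvol : volume K' ≠ ⊤ := hK'.measure_lt_top.ne
  -- `r` is a uniform error that costs at most η/3 in L¹ on `K'`; the unit enlargement `K'` contains
  -- the supports of all mollifications of `φ` at scales up to 1.
  obtain ⟨r, hr, hr2⟩ : ∃ r : ℝ, 0 < r ∧ ENNReal.ofReal r * volume K' ≤ η / 3 := by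
    obtain ⟨r, hr, hr2⟩ := ENNReal.exists_nnreal_pos_mul_lt hvol hη3
    exact ⟨r, hr, by simpa using hr2.le⟩
  have huc := hφc.uniformContinuous_of_continuous hφcont
  obtain ⟨δ, hδ, hδ2⟩ := Metric.uniformContinuous_iff.1 huc r hr
  refine ⟨min 1 (δ / 2), by positivity, fun ρ ε C hε hρ => ?_⟩
  have hε1 : ε ≤ 1 := hε.trans (min_le_left _ _)
  have hεδ : ε < δ := (hε.trans (min_le_right _ _)).trans_lt (half_lt_self hδ)
  have h1 : ∫⁻ x, ‖mollify ρ (f - φ) x‖ₑ ≤ η / 3 :=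
    (lintegral_enorm_mollify_le hρ (hf.sub hφint).aestronglyMeasurable).trans hφ
  have h3 : ∫⁻ x, ‖mollify ρ φ x - φ x‖ₑ ≤ η / 3 := by
    refine le_trans ?_ hr2
    rw [← setLIntegral_const, ← lintegral_indicator hK'.measurableSet]
    refine lintegral_mono fun x => ?_
    by_cases hx : x ∈ K'
    · rw [Set.indicator_of_mem hx]
      have : ‖mollify ρ φ x - φ x‖ ≤ r := by
        rw [← dist_eq_norm, mollify_eq_convolution]
        refine dist_convolution_le (R := δ) hr.le ?_ hρ.nonneg hρ.integral_eq
          hφcont.aestronglyMeasurable ?_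
        · intro t ht
          simpa using (hρ.norm_le (subset_tsupport _ ht)).trans_lt hεδ
        · intro y hy
          exact (hδ2 hy).le
      rw [← ofReal_norm]
      exact ENNReal.ofReal_le_ofReal this
    · have h0 : φ x = 0 := image_eq_zero_of_notMem_tsupport fun h => hx (hKK' h)
      have h0' : mollify ρ φ x = 0 := by
        refine image_eq_zero_of_notMem_tsupport fun h => hx ?_
        exact Metric.cthickening_mono hε1 _
          (tsupport_mollify_subset hρ (fun y hy => image_eq_zero_of_notMem_tsupport hy) h)
      simp [h0, h0']
  have hsub := mollify_sub hρ.smooth hρ.hasCompactSupport hf.locallyIntegrable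
    hφint.locallyIntegrable
  calc ∫⁻ x, ‖mollify ρ f x - f x‖ₑ
      ≤ ∫⁻ x, (‖mollify ρ (f - φ) x‖ₑ + ‖mollify ρ φ x - φ x‖ₑ + ‖f x - φ x‖ₑ) := by
        refine lintegral_mono fun x => ?_
        have : mollify ρ f x - f x =
            mollify ρ (f - φ) x + (mollify ρ φ x - φ x) + -(f x - φ x) := by
          rw [hsub]; simp
        rw [this]
        refine (enorm_add_le _ _).trans ?_
        rw [enorm_neg]
        gcongr
        exact enorm_add_le _ _
    _ = (∫⁻ x, ‖mollify ρ (f - φ) x‖ₑ) + (∫⁻ x, ‖mollify ρ φ x - φ x‖ₑ) +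
        ∫⁻ x, ‖f x - φ x‖ₑ := by
        have hm : AEMeasurable (fun x => ‖f x - φ x‖ₑ) :=
          (hf.sub hφint).aestronglyMeasurable.enorm
        rw [lintegral_add_right' _ hm, lintegral_add_left']
        exact (integrable_mollify hρ (hf.sub hφint)).aestronglyMeasurable.enorm
    _ ≤ η / 3 + η / 3 + η / 3 := add_le_add (add_le_add h1 h3) hφ
    _ = η := ENNReal.add_thirds η

end Mollification

section Commutator

variable {N : ℕ} {G G' : Type*} [NormedAddCommGroup G] [NormedSpace ℝ G]
  [NormedAddCommGroup G'] [NormedSpace ℝ G'] [CompleteSpace G] [CompleteSpace G']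
  {ρ : (𝔼 N) → ℝ} {ε C : ℝ}

/-! ### Commutators of mollification and multiplication -/

/-- The commutator of multiplication by `a` and mollification by `ρ`. -/
def mollifyComm (ρ : (𝔼 N) → ℝ) (a : (𝔼 N) → G →L[ℝ] G') (f : (𝔼 N) → G) : (𝔼 N) → G' :=
  fun x => a x (mollify ρ f x) - mollify ρ (fun y => a y (f y)) x

/-- Only increments of `a` over the support of `ρ` enter, and these are small when `a` is Lipschitz.
-/
theorem mollifyComm_eq (hρ : IsMollifier ρ ε C) {a : (𝔼 N) → G →L[ℝ] G'} (ha : Continuous a)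
    {f : (𝔼 N) → G} (hf : Continuous f) (x : 𝔼 N) :
    mollifyComm ρ a f x = ∫ t, (ρ t • (a x - a (x - t))) (f (x - t)) := by
  have h1 := integrable_mollify_integrand hρ.smooth hρ.hasCompactSupport hf.locallyIntegrable x
  have h2 := integrable_mollify_integrand hρ.smooth hρ.hasCompactSupport
    (ha.clm_apply hf).locallyIntegrable x
  unfold mollifyComm mollify
  rw [← ContinuousLinearMap.integral_comp_comm _ h1, ← integral_sub ((a x).integrable_comp h1) h2]
  congr 1
  ext1 t
  simp [smul_sub]

/-- The commutator with a Lipschitz function is of size `ε`. -/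
theorem lintegral_mollifyComm_le (hρ : IsMollifier ρ ε C) {a : (𝔼 N) → G →L[ℝ] G'} {L : ℝ≥0}
    (ha : LipschitzWith L a) {f : (𝔼 N) → G} (hf : Continuous f) :
    ∫⁻ x, ‖mollifyComm ρ a f x‖ₑ ≤ L * ENNReal.ofReal ε * ∫⁻ x, ‖f x‖ₑ := by
  simp only [mollifyComm_eq hρ ha.continuous hf]
  refine (lintegral_enorm_integral_le (k := fun t => L * ENNReal.ofReal ε * ‖ρ t‖ₑ)
    (hρ.smooth.continuous.enorm.aemeasurable.const_mul _)
    hf.aestronglyMeasurable fun x t => ?_).trans ?_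
  · refine (ContinuousLinearMap.le_opENorm _ _).trans ?_
    gcongr
    rw [enorm_smul, mul_comm]
    by_cases ht : t ∈ tsupport ρ
    · gcongr
      rw [← edist_eq_enorm_sub]
      refine (ha x (x - t)).trans ?_
      gcongr
      rw [edist_eq_enorm_sub, sub_sub_cancel, ← ofReal_norm]
      exact ENNReal.ofReal_le_ofReal (hρ.norm_le ht)
    · simp [image_eq_zero_of_notMem_tsupport ht]
  · rw [lintegral_const_mul'' _ hρ.smooth.continuous.enorm.aemeasurable, hρ.lintegral_eq, mul_one]

/-- Friedrichs' lemma: the commutator of mollification and a first order operator is bounded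
in `L¹`, uniformly in the scale. -/
theorem lintegral_mollifyComm_partialDeriv_le (hε : 0 < ε) (hρ : IsMollifier ρ ε C)
    {a : (𝔼 N) → G →L[ℝ] G'} {L : ℝ≥0} (ha : LipschitzWith L a) (has : ContDiff ℝ ∞ a)
    {f : (𝔼 N) → G} (hf : ContDiff ℝ ∞ f) (j : Fin N) :
    ∫⁻ x, ‖mollifyComm ρ a (partialDeriv j f) x‖ₑ ≤
      L * (ENNReal.ofReal C + 1) * ∫⁻ x, ‖f x‖ₑ := by
  have key : ∀ x, mollifyComm ρ a (partialDeriv j f) x = ∫ t,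
      (partialDeriv j ρ t • (a x - a (x - t)) + ρ t • partialDeriv j a (x - t)) (f (x - t)) := by
    intro x
    rw [mollifyComm_eq hρ ha.continuous (contDiff_partialDeriv hf j).continuous]
    have hg : ContDiff ℝ ∞ fun t => f (x - t) := hf.comp (contDiff_const.sub contDiff_id)
    have hax : ContDiff ℝ ∞ fun t => a x - a (x - t) :=
      contDiff_const.sub (has.comp (contDiff_const.sub contDiff_id))
    have hc : ContDiff ℝ ∞ fun t => ρ t • (a x - a (x - t)) := hρ.smooth.smul hax
    have hcc : HasCompactSupport fun t => ρ t • (a x - a (x - t)) :=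
      hρ.hasCompactSupport.smul_right
    -- Integration by parts in `t` takes the derivative off `f`. Where it falls on `ρ` it costs C/ε,
    -- but it multiplies an increment of `a` of size at most L ε; where it falls on `a` it costs L.
    -- Hence the constant L (C + 1).
    have h1 := integral_bilin_partialDeriv (ContinuousLinearMap.id ℝ (G →L[ℝ] G')).flip
      hg hc hcc j
    have hgd : ∀ t, partialDeriv j (fun t => f (x - t)) t = - partialDeriv j f (x - t) := by
      intro t
      simpa using congrFun (listDeriv_comp_sub_left hf x [j]) t
    have had : ∀ t, partialDeriv j (fun t => a (x - t)) t = - partialDeriv j a (x - t) := by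
      intro t
      simpa using congrFun (listDeriv_comp_sub_left has x [j]) t
    have hcd : ∀ t, partialDeriv j (fun t => ρ t • (a x - a (x - t))) t =
        partialDeriv j ρ t • (a x - a (x - t)) + ρ t • partialDeriv j a (x - t) := by
      intro t
      have e1 := (hρ.smooth.differentiable (by simp)) t
      have e2 := (hax.differentiable (by simp)) t
      have e3 : fderiv ℝ (fun t => a x - a (x - t)) t (EuclideanSpace.single j 1) =
          partialDeriv j a (x - t) := by
        rw [fderiv_const_sub]
        have := had t
        simp only [partialDeriv] at this ⊢
        simp [this]
      simp only [partialDeriv] at e3 ⊢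
      rw [fderiv_fun_smul e1 e2]
      simp [e3, add_comm]
    simp only [hgd, hcd, ContinuousLinearMap.flip_apply, ContinuousLinearMap.id_apply, map_neg,
      neg_apply, integral_neg, neg_neg] at h1
    exact h1.symm
  simp only [key]
  have hadd : ∀ p q : G →L[ℝ] G', ‖p + q‖ₑ ≤ ‖p‖ₑ + ‖q‖ₑ := fun p q => enorm_add_le p q
  have hm : Measurable fun t => ‖partialDeriv j ρ t‖ₑ :=
    (contDiff_partialDeriv hρ.smooth j).continuous.enorm.measurable
  have hm2 : Measurable fun t => ENNReal.ofReal ε * ‖partialDeriv j ρ t‖ₑ + ‖ρ t‖ₑ :=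
    (hm.const_mul _).add hρ.smooth.continuous.enorm.measurable
  refine (lintegral_enorm_integral_le
    (k := fun t => L * (ENNReal.ofReal ε * ‖partialDeriv j ρ t‖ₑ + ‖ρ t‖ₑ))
    (hm2.const_mul _).aemeasurable
    hf.continuous.aestronglyMeasurable fun x t => ?_).trans ?_
  · refine (ContinuousLinearMap.le_opENorm _ _).trans ?_
    gcongr
    refine (hadd _ _).trans ?_
    rw [enorm_smul, enorm_smul, mul_add]
    refine add_le_add ?_ ?_
    · by_cases ht : t ∈ tsupport ρ
      · rw [mul_comm, ← mul_assoc]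
        gcongr
        rw [← edist_eq_enorm_sub]
        refine (ha x (x - t)).trans ?_
        gcongr
        rw [edist_eq_enorm_sub, sub_sub_cancel, ← ofReal_norm]
        exact ENNReal.ofReal_le_ofReal (hρ.norm_le ht)
      · have : partialDeriv j ρ t = 0 := image_eq_zero_of_notMem_tsupport
          fun h => ht (tsupport_partialDeriv_subset ρ j h)
        simp [this]
    · rw [mul_comm]
      gcongr
      refine (ContinuousLinearMap.le_opENorm _ _).trans ?_
      have h1 : ‖fderiv ℝ a (x - t)‖ ≤ L := norm_fderiv_le_of_lipschitz ℝ ha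
      have h2 : ‖(EuclideanSpace.single j (1 : ℝ) : 𝔼 N)‖ₑ = 1 := by
        rw [← ofReal_norm]; simp
      rw [h2, mul_one, ← ofReal_norm]
      exact (ENNReal.ofReal_le_ofReal h1).trans (by simp)
  · rw [lintegral_const_mul _ hm2,
      lintegral_add_left (hm.const_mul _), lintegral_const_mul _ hm, hρ.lintegral_eq]
    gcongr
    calc ENNReal.ofReal ε * ∫⁻ t, ‖partialDeriv j ρ t‖ₑ
        ≤ ENNReal.ofReal ε * ENNReal.ofReal (C / ε) := by gcongr; exact hρ.deriv_le j
      _ = ENNReal.ofReal C := by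
        rw [← ENNReal.ofReal_mul hε.le, mul_div_cancel₀ _ hε.ne']

/-- Mollification by an even kernel is symmetric. -/
theorem integral_bilin_mollify {G₁ G₂ W : Type*} [NormedAddCommGroup G₁] [NormedSpace ℝ G₁]
    [NormedAddCommGroup G₂] [NormedSpace ℝ G₂] [NormedAddCommGroup W] [NormedSpace ℝ W]
    [CompleteSpace G₁] [CompleteSpace G₂] [CompleteSpace W]
    (B : G₁ →L[ℝ] G₂ →L[ℝ] W) (hρ : IsMollifier ρ ε C) {v : (𝔼 N) → G₁} {f : (𝔼 N) → G₂}
    (hv : Continuous v) (hvc : HasCompactSupport v) (hf : Integrable f) :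
    ∫ x, B (v x) (mollify ρ f x) = ∫ x, B (mollify ρ v x) (f x) := by
  have hvi : Integrable v := hv.integrable_of_hasCompactSupport hvc
  obtain ⟨M, hM⟩ := hv.bounded_above_of_compact_support hvc
  have hl : ∀ x, B (v x) (mollify ρ f x) = ∫ y, ρ (x - y) • B (v x) (f y) := by
    intro x
    have hi : Integrable fun t => ρ (x - t) • f t := by
      have := (integrable_mollify_integrand hρ.smooth hρ.hasCompactSupport hf.locallyIntegrable
        x).comp_sub_left x
      simpa using this
    rw [mollify_eq_swap, ← ContinuousLinearMap.integral_comp_comm _ hi]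
    simp
  have hr : ∀ y, B (mollify ρ v y) (f y) = ∫ x, ρ (x - y) • B (v x) (f y) := by
    intro y
    have hi : Integrable fun t => ρ (y - t) • v t := by
      have := (integrable_mollify_integrand hρ.smooth hρ.hasCompactSupport hv.locallyIntegrable
        y).comp_sub_left y
      simpa using this
    rw [mollify_eq_swap, ← ContinuousLinearMap.flip_apply,
      ← ContinuousLinearMap.integral_comp_comm _ hi]
    congr 1
    ext1 x
    rw [← hρ.even]
    simp
  simp only [hl, hr]
  refine integral_integral_swap ?_
  obtain ⟨R, hR⟩ := hρ.smooth.continuous.bounded_above_of_compact_support hρ.hasCompactSupport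
  have h1 : Integrable (fun p : (𝔼 N) × (𝔼 N) => ‖v p.1‖ * ‖f p.2‖) (volume.prod volume) :=
    hvi.norm.mul_prod hf.norm
  refine (h1.const_mul (R * ‖B‖)).mono' ?_ (.of_forall fun p => ?_)
  · have e1 : AEStronglyMeasurable (fun p : (𝔼 N) × (𝔼 N) => B (v p.1)) (volume.prod volume) :=
      (B.continuous.comp (hv.comp continuous_fst)).aestronglyMeasurable
    have e2 : AEStronglyMeasurable (fun p : (𝔼 N) × (𝔼 N) => f p.2) (volume.prod volume) :=
      hf.aestronglyMeasurable.comp_snd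
    have e3 : AEStronglyMeasurable (fun p : (𝔼 N) × (𝔼 N) => ρ (p.1 - p.2))
        (volume.prod volume) :=
      (hρ.smooth.continuous.comp (continuous_fst.sub continuous_snd)).aestronglyMeasurable
    exact e3.smul (isBoundedBilinearMap_apply.continuous.comp_aestronglyMeasurable
      (e1.prodMk e2))
  · simp only [Function.uncurry, norm_smul]
    calc ‖ρ (p.1 - p.2)‖ * ‖B (v p.1) (f p.2)‖ ≤ R * (‖B‖ * ‖v p.1‖ * ‖f p.2‖) := by
          gcongr
          · exact (norm_nonneg _).trans (hR 0)
          · exact hR _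
          · exact B.le_opNorm₂ _ _
      _ = R * ‖B‖ * (‖v p.1‖ * ‖f p.2‖) := by ring

end Commutator

/-! ### Poincaré's inequality -/

section Poincare

variable {N : ℕ} {G : Type*} [NormedAddCommGroup G] [NormedSpace ℝ G] [CompleteSpace G]

/-- Poincaré's inequality in `L¹` for functions supported in a ball. -/
theorem lintegral_enorm_le_partialDeriv {R : ℝ} (hR : 0 ≤ R) {f : (𝔼 N) → G}
    (hf : ContDiff ℝ ∞ f) (hs : tsupport f ⊆ Metric.closedBall 0 R) (j : Fin N) :
    ∫⁻ x, ‖f x‖ₑ ≤ ENNReal.ofReal (2 * R + 1) * ∫⁻ x, ‖partialDeriv j f x‖ₑ := by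
  let e : 𝔼 N := EuclideanSpace.single j 1
  have he : ‖e‖ = 1 := by simp [e]
  have hpt : ∀ x, ‖f x‖ₑ ≤ ∫⁻ t in Set.Icc 0 (2 * R + 1), ‖partialDeriv j f (x + t • e)‖ₑ := by
    intro x
    by_cases hx : x ∈ Metric.closedBall (0 : 𝔼 N) R
    swap
    · rw [image_eq_zero_of_notMem_tsupport fun h => hx (hs h)]; simp
    -- The shift 2R + 1 exceeds the diameter of the ball, so the end of the segment leaves the
    -- support and f(x) is minus the integral of the derivative along it.
    have hend : f (x + (2 * R + 1) • e) = 0 := by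
      refine image_eq_zero_of_notMem_tsupport fun h => ?_
      have h1 := hs h
      rw [mem_closedBall_zero_iff] at h1 hx
      have h2 : ‖(2 * R + 1) • e‖ = 2 * R + 1 := by
        rw [norm_smul, he, mul_one, Real.norm_of_nonneg (by linarith)]
      have h3 := norm_sub_le (x + (2 * R + 1) • e) x
      rw [add_sub_cancel_left, h2] at h3
      linarith
    have hd : ∀ t : ℝ, HasDerivAt (fun t : ℝ => f (x + t • e)) (partialDeriv j f (x + t • e)) t := by
      intro t
      have h1 : HasDerivAt (fun t : ℝ => x + t • e) e t := by
        simpa using ((hasDerivAt_id t).smul_const e).const_add x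
      exact ((hf.differentiable (by simp)) (x + t • e)).hasFDerivAt.comp_hasDerivAt t h1
    have hcont : Continuous fun t : ℝ => partialDeriv j f (x + t • e) :=
      (contDiff_partialDeriv hf j).continuous.comp (by fun_prop)
    have hftc := intervalIntegral.integral_eq_sub_of_hasDerivAt (a := 0) (b := 2 * R + 1)
      (fun t _ => hd t) (hcont.intervalIntegrable _ _)
    rw [hend] at hftc
    simp only [zero_smul, add_zero, zero_sub] at hftc
    rw [← enorm_neg, ← hftc, intervalIntegral.integral_of_le (by linarith)]
    exact (enorm_integral_le_lintegral_enorm _).trans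
      (lintegral_mono_set Set.Ioc_subset_Icc_self)
  have hm : Measurable fun p : (𝔼 N) × ℝ => ‖partialDeriv j f (p.1 + p.2 • e)‖ₑ :=
    ((contDiff_partialDeriv hf j).continuous.comp (by fun_prop)).enorm.measurable
  calc ∫⁻ x, ‖f x‖ₑ
      ≤ ∫⁻ x, ∫⁻ t in Set.Icc 0 (2 * R + 1), ‖partialDeriv j f (x + t • e)‖ₑ := lintegral_mono hpt
    _ = ∫⁻ t in Set.Icc 0 (2 * R + 1), ∫⁻ x, ‖partialDeriv j f (x + t • e)‖ₑ :=
        lintegral_lintegral_swap hm.aemeasurable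
    _ = ∫⁻ t in Set.Icc 0 (2 * R + 1), ∫⁻ x, ‖partialDeriv j f x‖ₑ := by
        congr 1
        ext1 t
        exact lintegral_add_right_eq_self (fun x => ‖partialDeriv j f x‖ₑ) _
    _ = _ := by rw [setLIntegral_const, Real.volume_Icc, sub_zero, mul_comm]

/-- Raises a low-order derivative to order ν - 1, the only order on which the seminorms and the
hypotheses give information. Repeating a single direction is enough. -/
theorem lintegral_enorm_listDeriv_le {R : ℝ} (hR : 0 ≤ R) {f : (𝔼 N) → G}
    (hf : ContDiff ℝ ∞ f) (hs : tsupport f ⊆ Metric.closedBall 0 R) (j : Fin N)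
    (L : List (Fin N)) (n : ℕ) :
    ∫⁻ x, ‖listDeriv L f x‖ₑ ≤
      ENNReal.ofReal (2 * R + 1) ^ n * ∫⁻ x, ‖listDeriv (List.replicate n j ++ L) f x‖ₑ := by
  induction n with
  | zero => simp
  | succ n ih =>
    refine ih.trans ?_
    rw [pow_succ, mul_assoc]
    gcongr
    exact lintegral_enorm_le_partialDeriv hR (contDiff_listDeriv hf _)
      ((tsupport_listDeriv_subset f _).trans hs) j

end Poincare

section Adjoint

variable {N ν : ℕ} {Ω : Opens (𝔼 N)}
  {E F : Type*} [NormedAddCommGroup E] [NormedSpace ℂ E]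
  [NormedAddCommGroup F] [NormedSpace ℂ F]

/-! ### The formal adjoint -/

/-- The real bilinear pairing `(y, z) ↦ conj (y z)`. -/
def conjPairing (E : Type*) [NormedAddCommGroup E] [NormedSpace ℂ E] :
    ConjDual E →L[ℝ] E →L[ℝ] ℂ :=
  LinearMap.mkContinuous₂
    (LinearMap.mk₂ ℝ (fun (y : ConjDual E) (z : E) => conj (y z))
      (fun y y' z => by simp)
      (fun c y z => by
        rw [← Complex.coe_smul, smul_apply]; simp)
      (fun y z z' => by simp)
      (fun c y z => by
        rw [← Complex.coe_smul, map_smulₛₗ]; simp)) 1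
    (fun y z => by simpa using y.le_opNorm z)

@[simp] theorem conjPairing_apply (y : ConjDual E) (z : E) :
    conjPairing E y z = conj (y z) := rfl

theorem norm_conjPairing_le (y : ConjDual E) (z : E) : ‖conjPairing E y z‖ ≤ ‖y‖ * ‖z‖ := by
  simpa using y.le_opNorm z

/-- Composition as a real bilinear map. -/
def conjDualComp (E F : Type*) [NormedAddCommGroup E] [NormedSpace ℂ E]
    [NormedAddCommGroup F] [NormedSpace ℂ F] :
    ConjDual F →L[ℝ] (E →L[ℂ] F) →L[ℝ] ConjDual E :=
  LinearMap.mkContinuous₂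
    (LinearMap.mk₂ ℝ (fun (v : ConjDual F) (a : E →L[ℂ] F) => v.comp a)
      (fun y y' z => by ext; simp)
      (fun c y z => by ext; simp)
      (fun y z z' => by ext; simp)
      (fun c y z => by
        ext w
        change y (c • z w) = c • y (z w)
        rw [← Complex.coe_smul, map_smulₛₗ]
        simp)) 1
    (fun v a => by simpa using ContinuousLinearMap.opNorm_comp_le v a)

theorem contDiff_conjDualComp {v : (𝔼 N) → ConjDual F} {a : (𝔼 N) → E →L[ℂ] F}
    (hv : ContDiff ℝ ∞ v) (ha : ContDiff ℝ ∞ a) : ContDiff ℝ ∞ fun y => (v y).comp (a y) :=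
  (conjDualComp E F).isBoundedBilinearMap.contDiff.comp₂ hv ha

/-- The sign becomes a real scalar, as integration by parts is stated for real bilinear maps. -/
theorem DiffOp.adjoint_eq (A : DiffOp Ω ν E F) (v : (𝔼 N) → ConjDual F) (x : 𝔼 N) :
    A.adjoint v x = ∑ k ∈ Finset.range (ν + 1), ∑ α ∈ multiIndices N k,
      (-1 : ℝ) ^ k • multiDeriv α (fun y => (v y).comp (A.coeff α y)) x := by
  unfold DiffOp.adjoint
  refine Finset.sum_congr rfl fun k _ => Finset.sum_congr rfl fun α _ => ?_
  ext z
  simp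

theorem sum_le_of_mem {α : Fin N → ℕ} {k : ℕ} (hk : k ∈ Finset.range (ν + 1))
    (hα : α ∈ multiIndices N k) : ∑ i, α i ≤ ν := by
  rw [mem_multiIndices.1 hα]
  exact Finset.mem_range_succ_iff.1 hk

theorem contDiff_multiDeriv {G : Type*} [NormedAddCommGroup G] [NormedSpace ℝ G]
    {f : (𝔼 N) → G} (hf : ContDiff ℝ ∞ f) (α : Fin N → ℕ) : ContDiff ℝ ∞ (multiDeriv α f) := by
  rw [multiDeriv_eq_listDeriv]
  exact contDiff_listDeriv hf _

theorem tsupport_multiDeriv_subset {G : Type*} [NormedAddCommGroup G] [NormedSpace ℝ G]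
    (f : (𝔼 N) → G) (α : Fin N → ℕ) : tsupport (multiDeriv α f) ⊆ tsupport f := by
  rw [multiDeriv_eq_listDeriv]
  exact tsupport_listDeriv_subset f _

theorem integral_bilin_multiDeriv {G₁ G₂ W : Type*} [NormedAddCommGroup G₁] [NormedSpace ℝ G₁]
    [NormedAddCommGroup G₂] [NormedSpace ℝ G₂] [NormedAddCommGroup W] [NormedSpace ℝ W]
    (B : G₁ →L[ℝ] G₂ →L[ℝ] W) {f : (𝔼 N) → G₁} {g : (𝔼 N) → G₂}
    (hf : ContDiff ℝ ∞ f) (hg : ContDiff ℝ ∞ g) (hgc : HasCompactSupport g) (α : Fin N → ℕ) :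
    ∫ x, B (f x) (multiDeriv α g x) =
      (-1 : ℝ) ^ (∑ i, α i) • ∫ x, B (multiDeriv α f x) (g x) := by
  simp only [multiDeriv_eq_listDeriv]
  rw [integral_bilin_listDeriv B hf hg hgc, length_multiList]

/-- The adjoint is smooth where the coefficients are smooth or the test function vanishes. -/
theorem DiffOp.contDiff_adjoint (A : DiffOp Ω ν E F) {v : (𝔼 N) → ConjDual F}
    (hv : ∀ α, ∑ i, α i ≤ ν → ContDiff ℝ ∞ fun y => (v y).comp (A.coeff α y)) :
    ContDiff ℝ ∞ (A.adjoint v) := by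
  rw [show A.adjoint v = _ from funext (A.adjoint_eq v)]
  exact ContDiff.sum fun k hk => ContDiff.sum fun α hα =>
    (contDiff_multiDeriv (hv α (sum_le_of_mem hk hα)) α).const_smul _

theorem DiffOp.tsupport_adjoint_subset (A : DiffOp Ω ν E F) (v : (𝔼 N) → ConjDual F) :
    tsupport (A.adjoint v) ⊆ tsupport v := by
  refine closure_minimal (fun x hx => ?_) (isClosed_tsupport v)
  by_contra h
  refine hx ?_
  rw [A.adjoint_eq]
  refine Finset.sum_eq_zero fun k _ => Finset.sum_eq_zero fun α _ => ?_
  have h0 : multiDeriv α (fun y => (v y).comp (A.coeff α y)) x = 0 := by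
    refine image_eq_zero_of_notMem_tsupport fun h' => h ?_
    refine (tsupport_multiDeriv_subset _ α).trans ?_ h'
    exact closure_mono fun y hy hvy => hy (by simp [hvy])
  rw [h0]
  ext z
  simp

theorem DiffOp.contDiff_apply (A : DiffOp Ω ν E F)
    (hA : ∀ α, ∑ i, α i ≤ ν → ContDiff ℝ ∞ (A.coeff α)) {w : (𝔼 N) → E}
    (hw : ContDiff ℝ ∞ w) : ContDiff ℝ ∞ (A.apply w) := by
  exact ContDiff.sum fun k hk => ContDiff.sum fun α hα =>
    ((ContinuousLinearMap.restrictScalarsL ℂ E F ℝ ℝ).contDiff.comp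
      (hA α (sum_le_of_mem hk hα))).clm_apply (contDiff_multiDeriv hw α)

theorem DiffOp.tsupport_apply_subset (A : DiffOp Ω ν E F) (w : (𝔼 N) → E) :
    tsupport (A.apply w) ⊆ tsupport w := by
  refine closure_minimal (fun x hx => ?_) (isClosed_tsupport w)
  by_contra h
  refine hx (Finset.sum_eq_zero fun k _ => Finset.sum_eq_zero fun α _ => ?_)
  rw [image_eq_zero_of_notMem_tsupport fun h' => h (tsupport_multiDeriv_subset w α h'), map_zero]

theorem integrable_bilin {G₁ G₂ W : Type*} [NormedAddCommGroup G₁] [NormedSpace ℝ G₁]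
    [NormedAddCommGroup G₂] [NormedSpace ℝ G₂] [NormedAddCommGroup W] [NormedSpace ℝ W]
    (B : G₁ →L[ℝ] G₂ →L[ℝ] W) {v : (𝔼 N) → G₁} {f : (𝔼 N) → G₂}
    (hv : Continuous v) (hvc : HasCompactSupport v) {μ : Measure (𝔼 N)} (hf : Integrable f μ) :
    Integrable (fun x => B (v x) (f x)) μ := by
  obtain ⟨M, hM⟩ := hv.bounded_above_of_compact_support hvc
  refine (hf.norm.const_mul (‖B‖ * M)).mono' ?_ (.of_forall fun x => ?_)
  · exact isBoundedBilinearMap_apply.continuous.comp_aestronglyMeasurable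
      ((B.continuous.comp hv).aestronglyMeasurable.prodMk hf.aestronglyMeasurable)
  · exact (B.le_opNorm₂ _ _).trans (by gcongr; exact hM x)

theorem tendsto_integral_bilin {G₁ G₂ W : Type*} [NormedAddCommGroup G₁] [NormedSpace ℝ G₁]
    [NormedAddCommGroup G₂] [NormedSpace ℝ G₂] [NormedAddCommGroup W] [NormedSpace ℝ W]
    (B : G₁ →L[ℝ] G₂ →L[ℝ] W) {v : (𝔼 N) → G₁} (hv : Continuous v) (hvc : HasCompactSupport v)
    {μ : Measure (𝔼 N)} {f : ℕ → (𝔼 N) → G₂} {g : (𝔼 N) → G₂} (hf : ∀ m, Integrable (f m) μ)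
    (hg : Integrable g μ) (h : Tendsto (fun m => ∫⁻ x, ‖f m x - g x‖ₑ ∂μ) atTop (𝓝 0)) :
    Tendsto (fun m => ∫ x, B (v x) (f m x) ∂μ) atTop (𝓝 (∫ x, B (v x) (g x) ∂μ)) := by
  obtain ⟨M, hM⟩ := hv.bounded_above_of_compact_support hvc
  refine tendsto_integral_of_L1 _ (integrable_bilin B hv hvc hg).aestronglyMeasurable
    (.of_forall fun m => integrable_bilin B hv hvc (hf m)) ?_
  have h2 : Tendsto (fun m => ENNReal.ofReal (‖B‖ * M) * ∫⁻ x, ‖f m x - g x‖ₑ ∂μ) atTop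
      (𝓝 (ENNReal.ofReal (‖B‖ * M) * 0)) :=
    ENNReal.Tendsto.const_mul h (Or.inr ENNReal.ofReal_ne_top)
  rw [mul_zero] at h2
  refine tendsto_of_tendsto_of_tendsto_of_le_of_le tendsto_const_nhds h2 (fun _ => zero_le)
    fun m => ?_
  have hm : AEMeasurable (fun x => ‖f m x - g x‖ₑ) μ :=
    ((hf m).sub hg).aestronglyMeasurable.enorm
  simp only []
  rw [← lintegral_const_mul'' _ hm]
  refine lintegral_mono fun x => ?_
  rw [← map_sub, ← ofReal_norm, ← ofReal_norm, ← ENNReal.ofReal_mul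
    (mul_nonneg (norm_nonneg B) ((norm_nonneg _).trans (hM 0)))]
  refine ENNReal.ofReal_le_ofReal ((B.le_opNorm₂ _ _).trans ?_)
  gcongr
  exact hM x

/-- Each term is an |α|-fold integration by parts, and its sign is the one built into the adjoint.
Coefficients smooth on the whole space are obtained later by multiplying `A` with a cutoff. -/
theorem DiffOp.integral_conjPairing_apply (A : DiffOp Ω ν E F)
    (hA : ∀ α, ∑ i, α i ≤ ν → ContDiff ℝ ∞ (A.coeff α)) {v : (𝔼 N) → ConjDual F}
    (hv : ContDiff ℝ ∞ v) (hvc : HasCompactSupport v) {w : (𝔼 N) → E}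
    (hw : ContDiff ℝ ∞ w) (hwc : HasCompactSupport w) :
    ∫ x, conjPairing F (v x) (A.apply w x) = ∫ x, conjPairing E (A.adjoint v x) (w x) := by
  have hva : ∀ α, ∑ i, α i ≤ ν → ContDiff ℝ ∞ fun y => (v y).comp (A.coeff α y) :=
    fun α hα => contDiff_conjDualComp hv (hA α hα)
  have hvac : ∀ α, HasCompactSupport fun y => (v y).comp (A.coeff α y) :=
    fun α => hvc.mono fun y hy hvy => hy (by simp [hvy])
  have hcs : ∀ {G : Type _} [NormedAddCommGroup G] [NormedSpace ℝ G] {f : (𝔼 N) → G} (α),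
      HasCompactSupport f → HasCompactSupport (multiDeriv α f) := fun α hf =>
    hf.mono' ((subset_tsupport _).trans (tsupport_multiDeriv_subset _ α))
  have hl : ∀ x, conjPairing F (v x) (A.apply w x) = ∑ k ∈ Finset.range (ν + 1),
      ∑ α ∈ multiIndices N k, conjPairing E ((v x).comp (A.coeff α x)) (multiDeriv α w x) := by
    intro x
    simp [DiffOp.apply]
  have hr : ∀ x, conjPairing E (A.adjoint v x) (w x) = ∑ k ∈ Finset.range (ν + 1),
      ∑ α ∈ multiIndices N k, (-1 : ℝ) ^ k •
        conjPairing E (multiDeriv α (fun y => (v y).comp (A.coeff α y)) x) (w x) := by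
    intro x
    rw [A.adjoint_eq]
    simp only [map_sum, map_smul, FunLike.coe_sum, Finset.sum_apply, smul_apply]
  have hli : ∀ k ∈ Finset.range (ν + 1), ∀ α ∈ multiIndices N k, Integrable fun x =>
      conjPairing E ((v x).comp (A.coeff α x)) (multiDeriv α w x) := fun k hk α hα =>
    integrable_bilin _ (hva α (sum_le_of_mem hk hα)).continuous (hvac α)
      ((contDiff_multiDeriv hw α).continuous.integrable_of_hasCompactSupport (hcs α hwc))
  have hri : ∀ k ∈ Finset.range (ν + 1), ∀ α ∈ multiIndices N k, Integrable fun x =>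
      (-1 : ℝ) ^ k • conjPairing E (multiDeriv α (fun y => (v y).comp (A.coeff α y)) x) (w x) :=
    fun k hk α hα => (integrable_bilin (conjPairing E)
      (contDiff_multiDeriv (hva α (sum_le_of_mem hk hα)) α).continuous (hcs α (hvac α))
      (hw.continuous.integrable_of_hasCompactSupport hwc)).smul ((-1 : ℝ) ^ k)
  simp only [hl, hr]
  rw [integral_finsetSum _ fun k hk => integrable_finsetSum _ (hli k hk),
    integral_finsetSum _ fun k hk => integrable_finsetSum _ (hri k hk)]
  refine Finset.sum_congr rfl fun k hk => ?_
  rw [integral_finsetSum _ (hli k hk), integral_finsetSum _ (hri k hk)]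
  refine Finset.sum_congr rfl fun α hα => ?_
  rw [integral_smul, integral_bilin_multiDeriv _ (hva α (sum_le_of_mem hk hα)) hw hwc,
    mem_multiIndices.1 hα]

end Adjoint

/-! ### Vanishing of the commutators and mollification of functions of finite variation -/

section Friedrichs

variable {N ν : ℕ} {Ω : Opens (𝔼 N)}

/-- The bound L ε b is uniform in `m`; "eventually in `m`" only matches the form of the top-order
statement below. -/
theorem eventually_lintegral_mollifyComm_le {G G' : Type*} [NormedAddCommGroup G]
    [NormedSpace ℝ G] [NormedAddCommGroup G'] [NormedSpace ℝ G'] [CompleteSpace G]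
    [CompleteSpace G'] {a : (𝔼 N) → G →L[ℝ] G'} {L : ℝ≥0} (ha : LipschitzWith L a)
    {f : ℕ → (𝔼 N) → G} (hf : ∀ m, Continuous (f m)) {b : ℝ≥0∞} (hb : b ≠ ⊤)
    (hfb : ∀ m, ∫⁻ x, ‖f m x‖ₑ ≤ b) (C : ℝ) {η : ℝ≥0∞} (hη : η ≠ 0) :
    ∀ᶠ ε in 𝓝[>] (0 : ℝ), ∀ ρ : (𝔼 N) → ℝ, IsMollifier ρ ε C →
      ∀ᶠ m in atTop, ∫⁻ x, ‖mollifyComm ρ a (f m) x‖ₑ ≤ η := by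
  have hlim : Tendsto (fun ε : ℝ => L * ENNReal.ofReal ε * b) (𝓝[>] 0) (𝓝 0) := by
    have h1 : Tendsto (fun ε : ℝ => ENNReal.ofReal ε) (𝓝[>] 0) (𝓝 0) := by
      have := (ENNReal.continuous_ofReal.tendsto 0).mono_left
        (nhdsWithin_le_nhds (s := Set.Ioi (0 : ℝ)))
      simpa using this
    have h2 := ENNReal.Tendsto.mul_const (ENNReal.Tendsto.const_mul h1
      (Or.inr (ENNReal.coe_ne_top (r := L)))) (Or.inr hb)
    simpa using h2
  filter_upwards [hlim.eventually (ge_mem_nhds (pos_iff_ne_zero.2 hη))] with ε hε ρ hρ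
  refine .of_forall fun m => ?_
  refine (lintegral_mollifyComm_le hρ ha (hf m)).trans (le_trans ?_ hε)
  gcongr
  exact hfb m

/-- Friedrichs' lemma controls the commutator by the L¹ norm uniformly in ε. Fix `n` such that `f m
- f n` is small in L¹ for all m ≥ n: its commutator is then small at every scale, and the commutator
of the fixed smooth function ∂ⱼ(f n) tends to zero with ε. The threshold for ε depends on `n` but
not on `m`. -/
theorem eventually_lintegral_mollifyComm_partialDeriv_le {G G' : Type*} [NormedAddCommGroup G]
    [NormedSpace ℝ G] [NormedAddCommGroup G'] [NormedSpace ℝ G'] [CompleteSpace G]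
    [CompleteSpace G'] {a : (𝔼 N) → G →L[ℝ] G'} {L : ℝ≥0} (ha : LipschitzWith L a)
    (has : ContDiff ℝ ∞ a) {f : ℕ → (𝔼 N) → G} (hf : ∀ m, ContDiff ℝ ∞ (f m))
    (hfc : ∀ m, HasCompactSupport (f m)) {h : (𝔼 N) → G} (hh : Integrable h)
    (hfh : Tendsto (fun m => ∫⁻ x, ‖f m x - h x‖ₑ) atTop (𝓝 0)) (j : Fin N) (C : ℝ)
    {η : ℝ≥0∞} (hη : η ≠ 0) :
    ∀ᶠ ε in 𝓝[>] (0 : ℝ), ∀ ρ : (𝔼 N) → ℝ, IsMollifier ρ ε C →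
      ∀ᶠ m in atTop, ∫⁻ x, ‖mollifyComm ρ a (partialDeriv j (f m)) x‖ₑ ≤ η := by
  set c : ℝ≥0∞ := L * (ENNReal.ofReal C + 1) with hc
  have hc_top : c ≠ ⊤ := by finiteness
  have hη2 : η / 2 ≠ 0 := by simp [hη]
  have hcau : ∃ n, ∀ m ≥ n, c * ∫⁻ x, ‖f m x - f n x‖ₑ ≤ η / 2 := by
    have h1 : Tendsto (fun m => c * ∫⁻ x, ‖f m x - h x‖ₑ) atTop (𝓝 0) := by
      simpa using ENNReal.Tendsto.const_mul hfh (Or.inr hc_top)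
    have hη4 : η / 2 / 2 ≠ 0 := by simp [hη]
    obtain ⟨n, hn⟩ := eventually_atTop.1 (h1.eventually (ge_mem_nhds (pos_iff_ne_zero.2 hη4)))
    refine ⟨n, fun m hm => ?_⟩
    calc c * ∫⁻ x, ‖f m x - f n x‖ₑ
        ≤ c * ((∫⁻ x, ‖f m x - h x‖ₑ) + ∫⁻ x, ‖f n x - h x‖ₑ) := by
          gcongr
          rw [← lintegral_add_left']
          · refine lintegral_mono fun x => ?_
            rw [show f m x - f n x = (f m x - h x) - (f n x - h x) by abel]
            exact enorm_sub_le
          · exact ((hf m).continuous.aestronglyMeasurable.sub hh.aestronglyMeasurable).enorm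
      _ ≤ η / 2 / 2 + η / 2 / 2 := by
          rw [mul_add]
          exact add_le_add (hn m hm) (hn n le_rfl)
      _ = η / 2 := ENNReal.add_halves _
  obtain ⟨n, hn⟩ := hcau
  have hn0 : Continuous (partialDeriv j (f n)) := (contDiff_partialDeriv (hf n) j).continuous
  have hn1 : Integrable (partialDeriv j (f n)) :=
    hn0.integrable_of_hasCompactSupport
      ((hfc n).mono' ((subset_tsupport _).trans (tsupport_partialDeriv_subset (f n) j)))
  have hev := eventually_lintegral_mollifyComm_le ha (f := fun _ => partialDeriv j (f n))
    (fun _ => hn0) hn1.hasFiniteIntegral.ne (fun _ => le_rfl) C hη2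
  filter_upwards [hev, self_mem_nhdsWithin] with ε hε hε0 ρ hρ
  obtain ⟨-, hρn⟩ := (hε ρ hρ).exists
  filter_upwards [eventually_ge_atTop n] with m hm
  have hm0 : Continuous (partialDeriv j (f m)) := (contDiff_partialDeriv (hf m) j).continuous
  have hsub : partialDeriv j (f m - f n) = partialDeriv j (f m) - partialDeriv j (f n) :=
    listDeriv_sub (hf m) (hf n) [j]
  have hsplit : ∀ x, mollifyComm ρ a (partialDeriv j (f m)) x =
      mollifyComm ρ a (partialDeriv j (f n)) x + mollifyComm ρ a (partialDeriv j (f m - f n)) x := by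
    intro x
    have e1 := mollify_sub hρ.smooth hρ.hasCompactSupport (hm0.locallyIntegrable (μ := volume))
      (hn0.locallyIntegrable (μ := volume))
    have e2 := mollify_sub hρ.smooth hρ.hasCompactSupport
      ((ha.continuous.clm_apply hm0).locallyIntegrable (μ := volume))
      ((ha.continuous.clm_apply hn0).locallyIntegrable (μ := volume))
    have e3 : (fun y => a y (partialDeriv j (f m - f n) y)) =
        (fun y => a y (partialDeriv j (f m) y)) - fun y => a y (partialDeriv j (f n) y) := by
      rw [hsub]; ext y; simp
    unfold mollifyComm
    rw [e3, e2, hsub, e1]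
    simp only [Pi.sub_apply, map_sub]
    abel
  calc ∫⁻ x, ‖mollifyComm ρ a (partialDeriv j (f m)) x‖ₑ
      ≤ ∫⁻ x, (‖mollifyComm ρ a (partialDeriv j (f n)) x‖ₑ +
          ‖mollifyComm ρ a (partialDeriv j (f m - f n)) x‖ₑ) :=
        lintegral_mono fun x => by rw [hsplit]; exact enorm_add_le _ _
    _ = (∫⁻ x, ‖mollifyComm ρ a (partialDeriv j (f n)) x‖ₑ) +
          ∫⁻ x, ‖mollifyComm ρ a (partialDeriv j (f m - f n)) x‖ₑ := by
        refine lintegral_add_left' ?_ _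
        have h1 : Continuous (mollify ρ (partialDeriv j (f n))) :=
          (contDiff_mollify hρ.smooth hρ.hasCompactSupport hn0.locallyIntegrable).continuous
        have h2 : Continuous (mollify ρ fun y => a y (partialDeriv j (f n) y)) :=
          (contDiff_mollify hρ.smooth hρ.hasCompactSupport
            (ha.continuous.clm_apply hn0).locallyIntegrable).continuous
        exact ((ha.continuous.clm_apply h1).sub h2).enorm.aemeasurable
    _ ≤ η / 2 + η / 2 := by
        refine add_le_add hρn ?_
        refine (lintegral_mollifyComm_partialDeriv_le hε0 hρ ha has ((hf m).sub (hf n)) j).trans ?_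
        exact hn m hm
    _ = η := ENNReal.add_halves η

variable {E F : Type*} [NormedAddCommGroup E] [NormedSpace ℂ E]
  [NormedAddCommGroup F] [NormedSpace ℂ F] [CompleteSpace E]

/-- The coefficients as real linear maps. -/
def DiffOp.realCoeff (A : DiffOp Ω ν E F) (α : Fin N → ℕ) (x : 𝔼 N) : E →L[ℝ] F :=
  (A.coeff α x).restrictScalars ℝ

/-- Derivatives commute with mollification, so only multiplication by the coefficients contributes.
-/
theorem DiffOp.apply_mollify_sub (A : DiffOp Ω ν E F)
    (hA : ∀ α, ∑ i, α i ≤ ν → ContDiff ℝ ∞ (A.coeff α))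
    {ρ : (𝔼 N) → ℝ} {ε C : ℝ} (hρ : IsMollifier ρ ε C) {w : (𝔼 N) → E} (hw : ContDiff ℝ ∞ w)
    (hwc : HasCompactSupport w) (x : 𝔼 N) :
    A.apply (mollify ρ w) x - mollify ρ (A.apply w) x = ∑ k ∈ Finset.range (ν + 1),
      ∑ α ∈ multiIndices N k, mollifyComm ρ (A.realCoeff α) (multiDeriv α w) x := by
  have h1 : mollify ρ (A.apply w) x = ∑ k ∈ Finset.range (ν + 1),
      ∑ α ∈ multiIndices N k, mollify ρ (fun y => A.coeff α y (multiDeriv α w y)) x := by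
    have hi : ∀ k ∈ Finset.range (ν + 1), ∀ α ∈ multiIndices N k,
        Integrable fun t => ρ t • A.coeff α (x - t) (multiDeriv α w (x - t)) := by
      intro k hk α hα
      have hc : Continuous fun y => A.coeff α y (multiDeriv α w y) :=
        (hA α (sum_le_of_mem hk hα)).continuous.clm_apply (contDiff_multiDeriv hw α).continuous
      exact integrable_mollify_integrand hρ.smooth hρ.hasCompactSupport hc.locallyIntegrable x
    simp only [mollify, DiffOp.apply, Finset.smul_sum]
    rw [integral_finsetSum _ fun k hk => integrable_finsetSum _ (hi k hk)]
    exact Finset.sum_congr rfl fun k hk => integral_finsetSum _ (hi k hk)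
  rw [h1, DiffOp.apply, ← Finset.sum_sub_distrib]
  refine Finset.sum_congr rfl fun k _ => ?_
  rw [← Finset.sum_sub_distrib]
  refine Finset.sum_congr rfl fun α _ => ?_
  rw [multiDeriv_eq_listDeriv, multiDeriv_eq_listDeriv,
    listDeriv_mollify_right hρ.smooth.continuous hw hwc]
  rfl

variable [CompleteSpace F]

/-- Mollifications of a function of finite `𝒜`-variation: the variation does not increase by more
than a given amount. -/
theorem DiffOp.eventually_norm_integral_apply_mollify_le (hN : 0 < N) (hν : 1 ≤ ν)
    (A : DiffOp Ω ν E F) (hA : ∀ α, ∑ i, α i ≤ ν → ContDiff ℝ ∞ (A.coeff α))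
    (hAc : ∀ α, ∑ i, α i ≤ ν → HasCompactSupport (A.coeff α))
    {g : (𝔼 N) → E} (hg : Integrable g) {R : ℝ} (hR : 0 ≤ R)
    (hgs : ∀ x ∉ Metric.closedBall (0 : 𝔼 N) R, g x = 0)
    {h : (Fin N → ℕ) → (𝔼 N) → E} (hh : ∀ α ∈ multiIndices N (ν - 1), Integrable (h α))
    (hgh : ∀ α ∈ multiIndices N (ν - 1), ∀ ρ : (𝔼 N) → ℝ, ContDiff ℝ ∞ ρ →
      HasCompactSupport ρ → multiDeriv α (mollify ρ g) = mollify ρ (h α))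
    {M : ℝ} (hM : ∀ v : (𝔼 N) → ConjDual F, ContDiff ℝ ∞ v → HasCompactSupport v →
      (∀ x, ‖v x‖ ≤ 1) → ‖∫ x, conjPairing E (A.adjoint v x) (g x)‖ ≤ M)
    {C : ℝ} (hC : ∀ ε : ℝ, 0 < ε → ∃ ρ : (𝔼 N) → ℝ, IsMollifier ρ ε C) :
    ∀ᶠ ε in 𝓝[>] (0 : ℝ), ∀ ρ : (𝔼 N) → ℝ, IsMollifier ρ ε C →
      ∀ v : (𝔼 N) → ConjDual F, ContDiff ℝ ∞ v → HasCompactSupport v → (∀ x, ‖v x‖ ≤ 1) →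
        ‖∫ x, conjPairing F (v x) (A.apply (mollify ρ g) x)‖ ≤ M + 1 := by
  choose! σ hσ using fun m : ℕ => hC (1 / ((m : ℝ) + 1)) (by positivity)
  have hσ1 : ∀ m : ℕ, 1 / ((m : ℝ) + 1) ≤ 1 := fun m => by
    rw [div_le_one (by positivity)]; simp
  -- `g` is first smoothed at an auxiliary scale 1/(m + 1), so that `A` acts classically; then `m`
  -- tends to infinity while the scale of `ρ` stays fixed.
  let w : ℕ → (𝔼 N) → E := fun m => mollify (σ m) g
  have hw : ∀ m, ContDiff ℝ ∞ (w m) := fun m =>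
    contDiff_mollify (hσ m).smooth (hσ m).hasCompactSupport hg.locallyIntegrable
  have hws : ∀ m, tsupport (w m) ⊆ Metric.closedBall 0 (R + 1) := by
    intro m
    refine (tsupport_mollify_subset (hσ m) hgs).trans ?_
    refine (Metric.cthickening_mono (hσ1 m) _).trans ?_
    rw [cthickening_closedBall zero_le_one hR, add_comm]
  have hwc : ∀ m, HasCompactSupport (w m) := fun m =>
    (isCompact_closedBall 0 (R + 1)).of_isClosed_subset (isClosed_tsupport _) (hws m)
  have hconv : ∀ {f : (𝔼 N) → E}, Integrable f →
      Tendsto (fun m => ∫⁻ x, ‖mollify (σ m) f x - f x‖ₑ) atTop (𝓝 0) := by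
    intro f hf
    rw [ENNReal.tendsto_nhds_zero]
    intro η hη
    obtain ⟨ε₀, hε₀, hε₀'⟩ := lintegral_mollify_sub_le hf hη.ne'
    have := (tendsto_one_div_add_atTop_nhds_zero_nat (𝕜 := ℝ)).eventually (ge_mem_nhds hε₀)
    filter_upwards [this] with m hm
    exact hε₀' _ _ C hm (hσ m)
  have hder : ∀ m, ∀ L : List (Fin N), L.length = ν - 1 →
      listDeriv L (w m) = mollify (σ m) (h fun i => L.count i) := by
    intro m L hL
    rw [listDeriv_eq_multiDeriv (hw m)]
    exact hgh _ (hL ▸ count_mem_multiIndices L) _ (hσ m).smooth (hσ m).hasCompactSupport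
  have hLip : ∀ α, ∑ i, α i ≤ ν → ContDiff ℝ ∞ (A.realCoeff α) ∧
      ∃ L : ℝ≥0, LipschitzWith L (A.realCoeff α) := by
    intro α hα
    have h1 : ContDiff ℝ ∞ (A.realCoeff α) :=
      (ContinuousLinearMap.restrictScalarsL ℂ E F ℝ ℝ).contDiff.comp (hA α hα)
    refine ⟨h1, ContDiff.lipschitzWith_of_hasCompactSupport
      ((hAc α hα).comp_left (g := fun T : E →L[ℂ] F => T.restrictScalars ℝ) rfl) h1 (by simp)⟩
  have hcomm : ∀ η : ℝ≥0∞, η ≠ 0 → ∀ α, ∑ i, α i ≤ ν →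
      ∀ᶠ ε in 𝓝[>] (0 : ℝ), ∀ ρ : (𝔼 N) → ℝ, IsMollifier ρ ε C → ∀ᶠ m in atTop,
        ∫⁻ x, ‖mollifyComm ρ (A.realCoeff α) (multiDeriv α (w m)) x‖ₑ ≤ η := by
    intro η hη α hα
    obtain ⟨has, L, ha⟩ := hLip α hα
    simp only [multiDeriv_eq_listDeriv]
    have hlen := length_multiList α
    rcases Nat.lt_or_ge (∑ i, α i) ν with hlt | hge
    · let j : Fin N := ⟨0, hN⟩
      -- Below top order, pad `α` by `n` derivatives in direction `j` up to order ν - 1. Poincaré's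
      -- inequality then bounds ∂^α (w m) in L¹ uniformly in `m`.
      let n := ν - 1 - (multiList α).length
      let Λ := List.replicate n j ++ multiList α
      have hΛ : Λ.length = ν - 1 := by
        simp only [Λ, n, List.length_append, List.length_replicate]; omega
      have hΛm := count_mem_multiIndices Λ
      rw [hΛ] at hΛm
      refine eventually_lintegral_mollifyComm_le ha
        (fun m => (contDiff_listDeriv (hw m) _).continuous)
        (b := ENNReal.ofReal (2 * (R + 1) + 1) ^ n * ∫⁻ x, ‖h (fun i => Λ.count i) x‖ₑ)
        (ENNReal.mul_ne_top (ENNReal.pow_ne_top ENNReal.ofReal_ne_top)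
          (hh _ hΛm).hasFiniteIntegral.ne) (fun m => ?_) C hη
      refine (lintegral_enorm_listDeriv_le (by linarith) (hw m) (hws m) j (multiList α) n).trans ?_
      refine mul_le_mul' le_rfl ?_
      rw [hder m Λ hΛ]
      exact lintegral_enorm_mollify_le (hσ m) (hh _ hΛm).aestronglyMeasurable
    -- At order ν, split off one derivative; the remaining one of order ν - 1 converges in L¹, as
    -- Friedrichs' lemma requires.
    · obtain ⟨j, Λ, hjΛ⟩ : ∃ j Λ, multiList α = j :: Λ := by
        cases hm : multiList α with
        | nil => rw [hm] at hlen; simp at hlen; omega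
        | cons j Λ => exact ⟨j, Λ, rfl⟩
      have hΛ : Λ.length = ν - 1 := by
        rw [hjΛ, List.length_cons] at hlen; omega
      have hΛm := count_mem_multiIndices Λ
      rw [hΛ] at hΛm
      simp only [hjΛ, listDeriv_cons]
      refine eventually_lintegral_mollifyComm_partialDeriv_le ha has
        (fun m => contDiff_listDeriv (hw m) Λ) (fun m => HasCompactSupport.listDeriv (hwc m) Λ)
        (hh _ hΛm) ?_ j C hη
      simp only [hder _ Λ hΛ]
      exact hconv (hh _ hΛm)
  -- `T` counts the multi-indices. Each commutator is allowed (T + 1)⁻¹, so that together they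
  -- contribute at most 1.
  let T : ℝ≥0∞ := ∑ k ∈ Finset.range (ν + 1), ∑ α ∈ multiIndices N k, 1
  have hT : T ≠ ⊤ := by simp [T]
  have hT0 : (T + 1)⁻¹ ≠ 0 := by simp [hT]
  have hall : ∀ᶠ ε in 𝓝[>] (0 : ℝ), ∀ k ∈ Finset.range (ν + 1), ∀ α ∈ multiIndices N k,
      ∀ ρ : (𝔼 N) → ℝ, IsMollifier ρ ε C → ∀ᶠ m in atTop,
        ∫⁻ x, ‖mollifyComm ρ (A.realCoeff α) (multiDeriv α (w m)) x‖ₑ ≤ (T + 1)⁻¹ := by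
    rw [Filter.eventually_all_finset]
    intro k hk
    rw [Filter.eventually_all_finset]
    exact fun α hα => hcomm _ hT0 α (sum_le_of_mem hk hα)
  filter_upwards [hall] with ε hε ρ hρ v hv hvc hv1
  have hρw : ∀ m, ContDiff ℝ ∞ (mollify ρ (w m)) := fun m =>
    contDiff_mollify hρ.smooth hρ.hasCompactSupport (hw m).continuous.locallyIntegrable
  have hzero : ∀ {f : (𝔼 N) → E}, (∀ x ∉ Metric.closedBall (0 : 𝔼 N) (R + 1), f x = 0) →
      HasCompactSupport (mollify ρ f) := fun hf =>
    (isCompact_closedBall (0 : 𝔼 N) (R + 1)).cthickening.of_isClosed_subset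
      (isClosed_tsupport _) (tsupport_mollify_subset hρ hf)
  have hρwc : ∀ m, HasCompactSupport (mollify ρ (w m)) := fun m =>
    hzero fun x hx => image_eq_zero_of_notMem_tsupport fun h => hx (hws m h)
  have hρgc : HasCompactSupport (mollify ρ g) := hzero fun x hx => hgs x fun h =>
    hx (Metric.closedBall_subset_closedBall (by linarith) h)
  have hρg : ContDiff ℝ ∞ (mollify ρ g) :=
    contDiff_mollify hρ.smooth hρ.hasCompactSupport hg.locallyIntegrable
  have hρv : ContDiff ℝ ∞ (mollify ρ v) :=
    contDiff_mollify hρ.smooth hρ.hasCompactSupport hv.continuous.locallyIntegrable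
  have hρvc : HasCompactSupport (mollify ρ v) :=
    (hvc.isCompact.cthickening (r := ε)).of_isClosed_subset (isClosed_tsupport _)
      (tsupport_mollify_subset hρ fun x hx => image_eq_zero_of_notMem_tsupport hx)
  have hadj : ∀ {u : (𝔼 N) → ConjDual F}, ContDiff ℝ ∞ u → HasCompactSupport u →
      Continuous (A.adjoint u) ∧ HasCompactSupport (A.adjoint u) := fun hu huc =>
    ⟨(A.contDiff_adjoint fun α hα => contDiff_conjDualComp hu (hA α hα)).continuous,
      huc.mono' ((subset_tsupport _).trans (A.tsupport_adjoint_subset _))⟩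
  have hwi : ∀ m, Integrable (w m) := fun m =>
    (hw m).continuous.integrable_of_hasCompactSupport (hwc m)
  have lim1 : Tendsto (fun m => ∫ x, conjPairing F (v x) (A.apply (mollify ρ (w m)) x)) atTop
      (𝓝 (∫ x, conjPairing F (v x) (A.apply (mollify ρ g) x))) := by
    simp only [A.integral_conjPairing_apply hA hv hvc hρg hρgc,
      fun m => A.integral_conjPairing_apply hA hv hvc (hρw m) (hρwc m)]
    refine tendsto_integral_bilin _ (hadj hv hvc).1 (hadj hv hvc).2
      (fun m => integrable_mollify hρ (hwi m)) (integrable_mollify hρ hg) ?_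
    refine tendsto_of_tendsto_of_tendsto_of_le_of_le tendsto_const_nhds (hconv hg)
      (fun _ => zero_le) fun m => ?_
    have := lintegral_enorm_mollify_le hρ ((hwi m).sub hg).aestronglyMeasurable
    rwa [mollify_sub hρ.smooth hρ.hasCompactSupport (hwi m).locallyIntegrable
      hg.locallyIntegrable] at this
  -- Evenness of `ρ` moves the mollifier onto `v`. The mollified `v` is again an admissible test
  -- function, so the limit is at most `M`.
  have lim2 : Tendsto (fun m => ∫ x, conjPairing F (v x) (mollify ρ (A.apply (w m)) x)) atTop
      (𝓝 (∫ x, conjPairing E (A.adjoint (mollify ρ v) x) (g x))) := by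
    have hAi : ∀ m, Integrable (A.apply (w m)) := fun m =>
      (A.contDiff_apply hA (hw m)).continuous.integrable_of_hasCompactSupport
        ((hwc m).mono' ((subset_tsupport _).trans (A.tsupport_apply_subset _)))
    simp only [fun m => integral_bilin_mollify (conjPairing F) hρ hv.continuous hvc (hAi m),
      fun m => A.integral_conjPairing_apply hA hρv hρvc (hw m) (hwc m)]
    exact tendsto_integral_bilin _ (hadj hρv hρvc).1 (hadj hρv hρvc).2 hwi hg (hconv hg)
  have hbound : ∀ᶠ m in atTop, ‖∫ x, conjPairing F (v x) (A.apply (mollify ρ (w m)) x)‖ ≤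
      ‖∫ x, conjPairing F (v x) (mollify ρ (A.apply (w m)) x)‖ + 1 := by
    have : ∀ᶠ m in atTop, ∀ k ∈ Finset.range (ν + 1), ∀ α ∈ multiIndices N k,
        ∫⁻ x, ‖mollifyComm ρ (A.realCoeff α) (multiDeriv α (w m)) x‖ₑ ≤ (T + 1)⁻¹ := by
      rw [Filter.eventually_all_finset]
      intro k hk
      rw [Filter.eventually_all_finset]
      exact fun α hα => hε k hk α hα ρ hρ
    filter_upwards [this] with m hm
    have hc1 : Continuous (A.apply (mollify ρ (w m))) := (A.contDiff_apply hA (hρw m)).continuous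
    have hc2 : Continuous (mollify ρ (A.apply (w m))) :=
      (contDiff_mollify hρ.smooth hρ.hasCompactSupport
        (A.contDiff_apply hA (hw m)).continuous.locallyIntegrable).continuous
    have hi : ∀ {f : (𝔼 N) → F}, Continuous f → Integrable fun x => conjPairing F (v x) (f x) := by
      intro f hf
      refine Continuous.integrable_of_hasCompactSupport
        (((conjPairing F).continuous.comp hv.continuous).clm_apply hf) ?_
      exact hvc.mono fun x hx hvx => hx (by simp [hvx])
    have hdiff : ‖(∫ x, conjPairing F (v x) (A.apply (mollify ρ (w m)) x)) -
        ∫ x, conjPairing F (v x) (mollify ρ (A.apply (w m)) x)‖ₑ ≤ 1 := by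
      rw [← integral_sub (hi hc1) (hi hc2)]
      refine (enorm_integral_le_lintegral_enorm _).trans ?_
      calc ∫⁻ x, ‖conjPairing F (v x) (A.apply (mollify ρ (w m)) x) -
              conjPairing F (v x) (mollify ρ (A.apply (w m)) x)‖ₑ
          ≤ ∫⁻ x, ∑ k ∈ Finset.range (ν + 1), ∑ α ∈ multiIndices N k,
              ‖mollifyComm ρ (A.realCoeff α) (multiDeriv α (w m)) x‖ₑ := by
            refine lintegral_mono fun x => ?_
            rw [← map_sub, A.apply_mollify_sub hA hρ (hw m) (hwc m)]
            refine le_trans ?_ ((enorm_sum_le _ _).trans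
              (Finset.sum_le_sum fun k _ => enorm_sum_le _ _))
            rw [← ofReal_norm, ← ofReal_norm]
            refine ENNReal.ofReal_le_ofReal ((norm_conjPairing_le _ _).trans ?_)
            exact mul_le_of_le_one_left (norm_nonneg _) (hv1 x)
        _ = ∑ k ∈ Finset.range (ν + 1), ∑ α ∈ multiIndices N k,
              ∫⁻ x, ‖mollifyComm ρ (A.realCoeff α) (multiDeriv α (w m)) x‖ₑ := by
            have hcm : ∀ k ∈ Finset.range (ν + 1), ∀ α ∈ multiIndices N k, AEMeasurable fun x =>
                ‖mollifyComm ρ (A.realCoeff α) (multiDeriv α (w m)) x‖ₑ := by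
              intro k hk α hα
              have ha := (hLip α (sum_le_of_mem hk hα)).1.continuous
              have hd := (contDiff_multiDeriv (hw m) α).continuous
              refine Continuous.aemeasurable (Continuous.enorm (Continuous.sub
                (ha.clm_apply (contDiff_mollify hρ.smooth hρ.hasCompactSupport
                  hd.locallyIntegrable).continuous) ?_))
              exact (contDiff_mollify hρ.smooth hρ.hasCompactSupport
                (ha.clm_apply hd).locallyIntegrable).continuous
            rw [lintegral_finsetSum' _ fun k hk => Finset.aemeasurable_fun_sum _ (hcm k hk)]
            exact Finset.sum_congr rfl fun k hk => lintegral_finsetSum' _ (hcm k hk)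
        _ ≤ ∑ k ∈ Finset.range (ν + 1), ∑ α ∈ multiIndices N k, (T + 1)⁻¹ :=
            Finset.sum_le_sum fun k hk => Finset.sum_le_sum fun α hα => hm k hk α hα
        _ = T * (T + 1)⁻¹ := by
            simp only [T, Finset.sum_mul, one_mul]
        _ ≤ 1 := by
            rw [← div_eq_mul_inv]
            exact ENNReal.div_le_of_le_mul (by simp)
    have h1 : ‖(∫ x, conjPairing F (v x) (A.apply (mollify ρ (w m)) x)) -
        ∫ x, conjPairing F (v x) (mollify ρ (A.apply (w m)) x)‖ ≤ 1 := by
      rwa [← ofReal_norm, ENNReal.ofReal_le_one] at hdiff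
    have h2 := norm_sub_norm_le (∫ x, conjPairing F (v x) (A.apply (mollify ρ (w m)) x))
      (∫ x, conjPairing F (v x) (mollify ρ (A.apply (w m)) x))
    linarith
  have hle := le_of_tendsto_of_tendsto lim1.norm (lim2.norm.add_const 1) hbound
  exact hle.trans (by
    gcongr
    exact hM _ hρv hρvc (norm_mollify_le hρ hv1))

end Friedrichs

section Duality

variable {N : ℕ} {F : Type*} [NormedAddCommGroup F] [NormedSpace ℂ F]

/-! ### The `L¹` norm by duality with smooth functions -/

/-- t²/√(t² + δ²) is the pairing of t with a smooth substitute for its sign; the loss is at most δ.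
-/
theorem sub_le_sq_div_sqrt {t δ : ℝ} (ht : 0 ≤ t) (hδ : 0 < δ) :
    t - δ ≤ t ^ 2 / √(t ^ 2 + δ ^ 2) := by
  have hs : 0 < √(t ^ 2 + δ ^ 2) := Real.sqrt_pos.2 (by positivity)
  rw [le_div_iff₀ hs]
  rcases le_total t δ with h | h
  · nlinarith [mul_nonneg (sub_nonneg.2 h) hs.le, sq_nonneg t]
  · have h1 : √(t ^ 2 + δ ^ 2) ≤ t + δ := by
      rw [Real.sqrt_le_left (by positivity)]
      nlinarith [mul_nonneg ht hδ.le]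
    nlinarith [mul_le_mul_of_nonneg_left h1 (sub_nonneg.2 h), sq_nonneg δ]

/-- The conjugate of a linear functional. -/
def conjFunctional (e : F →L[ℂ] ℂ) : ConjDual F :=
  ((starL ℂ : ℂ ≃L⋆[ℂ] ℂ) : ℂ →L⋆[ℂ] ℂ).comp e

@[simp] theorem conjFunctional_apply (e : F →L[ℂ] ℂ) (z : F) : conjFunctional e z = conj (e z) :=
  rfl

/-- Test with a multiple of φ/√(|φ|² + δ²), where φ = e ∘ f, times the conjugate of `e`. This is
smooth and nearly norming for φ. -/
theorem integral_norm_functional_le (e : F →L[ℂ] ℂ) {f : (𝔼 N) → F} (hf : ContDiff ℝ ∞ f)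
    (hfc : HasCompactSupport f) {M : ℝ}
    (hM : ∀ v : (𝔼 N) → ConjDual F, ContDiff ℝ ∞ v → HasCompactSupport v → (∀ x, ‖v x‖ ≤ 1) →
      ‖∫ x, conjPairing F (v x) (f x)‖ ≤ M) :
    ∫ x, ‖e (f x)‖ ≤ (‖conjFunctional e‖ + 1) * M + 1 := by
  -- The added 1 keeps `c` positive when `e` is zero; division by `c` makes the test function have
  -- norm at most 1.
  set c : ℝ := ‖conjFunctional e‖ + 1 with hc
  have hc0 : 0 < c := by positivity
  set φ : (𝔼 N) → ℂ := fun x => e (f x) with hφ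
  have hφs : ContDiff ℝ ∞ φ := (e.restrictScalars ℝ).contDiff.comp hf
  have hφc : HasCompactSupport φ := hfc.comp_left (g := e) (map_zero e)
  set S := tsupport φ
  have hS : volume S ≠ ⊤ := hφc.isCompact.measure_lt_top.ne
  -- With this δ the regularisation error δ · vol(S) is at most 1.
  set δ : ℝ := (volume.real S + 1)⁻¹ with hδ
  have hδ0 : 0 < δ := by positivity
  have hpos : ∀ x, 0 < ‖φ x‖ ^ 2 + δ ^ 2 := fun x => by positivity
  set s : (𝔼 N) → ℝ := fun x => (√(‖φ x‖ ^ 2 + δ ^ 2))⁻¹ with hs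
  have hss : ContDiff ℝ ∞ s :=
    (((hφs.norm_sq ℝ).add contDiff_const).sqrt fun x => (hpos x).ne').inv
      fun x => (Real.sqrt_pos.2 (hpos x)).ne'
  have hs0 : ∀ x, 0 ≤ s x := fun x => by positivity
  have hθ1 : ∀ x, s x * ‖φ x‖ ≤ 1 := fun x => by
    rw [hs, inv_mul_le_one₀ (Real.sqrt_pos.2 (hpos x))]
    exact Real.le_sqrt_of_sq_le (by nlinarith)
  let T : ℂ →L[ℝ] ConjDual F :=
    (ContinuousLinearMap.toSpanSingleton ℂ (conjFunctional e)).restrictScalars ℝ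
  let v : (𝔼 N) → ConjDual F := fun x => T ((c⁻¹ * s x) • φ x)
  have hv : ContDiff ℝ ∞ v := T.contDiff.comp ((contDiff_const.mul hss).smul hφs)
  have hvc : HasCompactSupport v := hφc.mono fun x hx hφx => hx (by simp [v, hφx])
  have hv1 : ∀ x, ‖v x‖ ≤ 1 := by
    intro x
    have : v x = ((c⁻¹ * s x) • φ x) • conjFunctional e := rfl
    rw [this, norm_smul, norm_smul, Real.norm_of_nonneg (mul_nonneg (inv_nonneg.2 hc0.le) (hs0 x))]
    calc c⁻¹ * s x * ‖φ x‖ * ‖conjFunctional e‖ = c⁻¹ * (s x * ‖φ x‖) * ‖conjFunctional e‖ := by ring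
      _ ≤ c⁻¹ * 1 * c := by
        gcongr
        · exact hθ1 x
        · rw [hc]; linarith
      _ = 1 := by field_simp
  have hpair : ∀ x, conjPairing F (v x) (f x) = ((c⁻¹ * (s x * ‖φ x‖ ^ 2) : ℝ) : ℂ) := by
    intro x
    have : v x = ((c⁻¹ * s x) • φ x) • conjFunctional e := rfl
    rw [this, conjPairing_apply, smul_apply, conjFunctional_apply]
    simp only [smul_eq_mul, map_mul, Complex.conj_conj, Complex.real_smul, Complex.conj_ofReal]
    rw [mul_assoc, Complex.conj_mul']
    push_cast
    ring
  have hq : ∫ x, s x * ‖φ x‖ ^ 2 ≤ c * M := by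
    have h1 := hM v hv hvc hv1
    simp only [hpair] at h1
    rw [integral_complex_ofReal, integral_const_mul, Complex.norm_real, norm_mul, norm_inv,
      Real.norm_of_nonneg hc0.le, inv_mul_le_iff₀ hc0] at h1
    exact (le_abs_self _).trans h1
  have hqi : Integrable fun x => s x * ‖φ x‖ ^ 2 := by
    refine Continuous.integrable_of_hasCompactSupport
      (hss.continuous.mul (hφs.continuous.norm.pow 2)) ?_
    exact hφc.mono fun x hx hφx => hx (by simp [hφx])
  have hind : Integrable (S.indicator fun _ => δ) :=
    (integrable_indicator_iff (isClosed_tsupport _).measurableSet).2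
      (integrableOn_const hS)
  calc ∫ x, ‖φ x‖ ≤ ∫ x, (s x * ‖φ x‖ ^ 2 + S.indicator (fun _ => δ) x) := by
        refine integral_mono
          (hφs.continuous.norm.integrable_of_hasCompactSupport hφc.norm) (hqi.add hind) fun x => ?_
        by_cases hx : x ∈ S
        · have h1 := sub_le_sq_div_sqrt (norm_nonneg (φ x)) hδ0
          rw [div_eq_inv_mul] at h1
          simp only [Set.indicator_of_mem hx]
          linarith
        · simp [Set.indicator_of_notMem hx, image_eq_zero_of_notMem_tsupport hx]
    _ = (∫ x, s x * ‖φ x‖ ^ 2) + volume.real S * δ := by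
        rw [integral_add hqi hind, integral_indicator (isClosed_tsupport _).measurableSet,
          setIntegral_const, smul_eq_mul]
    _ ≤ c * M + 1 := by
        refine add_le_add hq ?_
        rw [hδ, mul_inv_le_iff₀ (by positivity)]
        linarith

/-- Sum the scalar estimate over the coordinates of a basis. `C` depends only on the basis; a sharp
duality is not needed, since the result serves only to bound a sequence. -/
theorem exists_lintegral_enorm_le_of_dual [FiniteDimensional ℂ F] (N : ℕ) :
    ∃ C : ℝ, 0 ≤ C ∧ ∀ f : (𝔼 N) → F, ContDiff ℝ ∞ f → HasCompactSupport f →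
      ∀ M : ℝ, 0 ≤ M → (∀ v : (𝔼 N) → ConjDual F, ContDiff ℝ ∞ v → HasCompactSupport v →
        (∀ x, ‖v x‖ ≤ 1) → ‖∫ x, conjPairing F (v x) (f x)‖ ≤ M) →
      ∫⁻ x, ‖f x‖ₑ ≤ ENNReal.ofReal (C * (M + 1)) := by
  let b := Module.finBasis ℂ F
  let e : Fin (Module.finrank ℂ F) → F →L[ℂ] ℂ := fun k => LinearMap.toContinuousLinearMap (b.coord k)
  refine ⟨∑ k, (‖conjFunctional (e k)‖ + 1) * ‖b k‖, by positivity, fun f hf hfc M hM0 hM => ?_⟩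
  have hi : Integrable f := hf.continuous.integrable_of_hasCompactSupport hfc
  rw [← ofReal_integral_norm_eq_lintegral_enorm hi]
  refine ENNReal.ofReal_le_ofReal ?_
  have hik : ∀ k, Integrable fun x => ‖e k (f x)‖ * ‖b k‖ := fun k =>
    ((e k).integrable_comp hi).norm.mul_const _
  calc ∫ x, ‖f x‖ ≤ ∫ x, ∑ k, ‖e k (f x)‖ * ‖b k‖ := by
        refine integral_mono hi.norm (integrable_finsetSum _ fun k _ => hik k) fun x => ?_
        simp only []
        conv_lhs => rw [← b.sum_repr (f x)]
        refine (norm_sum_le _ _).trans (Finset.sum_le_sum fun k _ => ?_)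
        rw [norm_smul]
        rfl
    _ = ∑ k, (∫ x, ‖e k (f x)‖) * ‖b k‖ := by
        rw [integral_finsetSum _ fun k _ => hik k]
        exact Finset.sum_congr rfl fun k _ => integral_mul_const _ _
    _ ≤ ∑ k, ((‖conjFunctional (e k)‖ + 1) * M + 1) * ‖b k‖ := by
        gcongr with k
        exact integral_norm_functional_le (e k) hf hfc hM
    _ ≤ _ := by
        rw [Finset.sum_mul]
        refine Finset.sum_le_sum fun k _ => ?_
        nlinarith [mul_nonneg (norm_nonneg (conjFunctional (e k))) (norm_nonneg (b k))]

end Duality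

section Localization

variable {N ν : ℕ} {Ω U : Opens (𝔼 N)}
  {E F : Type*} [NormedAddCommGroup E] [NormedSpace ℂ E]
  [NormedAddCommGroup F] [NormedSpace ℂ F]

/-! ### Localization -/

open scoped Manifold in
-- The cutoff is 1 in a neighbourhood of every point of `K`, so multiplying by it leaves all
-- derivatives on `K` unchanged.
theorem exists_cutoff {K : Set (𝔼 N)} (hK : IsCompact K) (hKU : K ⊆ U) :
    ∃ χ : (𝔼 N) → ℝ, ContDiff ℝ ∞ χ ∧ HasCompactSupport χ ∧ tsupport χ ⊆ U ∧
      (∀ x, 0 ≤ χ x ∧ χ x ≤ 1) ∧ ∀ x ∈ K, ∀ᶠ y in 𝓝 x, χ y = 1 := by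
  obtain ⟨δ, hδ, hδU⟩ := hK.exists_cthickening_subset_open U.isOpen hKU
  have hInt : K ⊆ interior (Metric.cthickening δ K) :=
    (Metric.self_subset_thickening hδ K).trans
      (interior_maximal (Metric.thickening_subset_cthickening δ K) Metric.isOpen_thickening)
  obtain ⟨f, h1, h0, h01⟩ := exists_contMDiffMap_one_nhds_of_subset_interior (n := ⊤)
    𝓘(ℝ, 𝔼 N) hK.isClosed hInt
  have hts : tsupport f ⊆ Metric.cthickening δ K :=
    closure_minimal (fun x hx => by_contra fun h => hx (h0 x h)) Metric.isClosed_cthickening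
  refine ⟨f, f.contMDiff.contDiff, hK.cthickening.of_isClosed_subset (isClosed_tsupport _) hts,
    hts.trans hδU, fun x => ⟨(h01 x).1, (h01 x).2⟩, fun x hx => ?_⟩
  exact eventually_nhdsSet_iff_forall.1 h1 x hx

/-- Coefficients are arbitrary outside Ω, so smoothness of products with cutoffs or test functions
is checked only on the support. -/
theorem contDiff_of_tsupport {G : Type*} [NormedAddCommGroup G] [NormedSpace ℝ G]
    {f : (𝔼 N) → G} (hf : ∀ x ∈ tsupport f, ContDiffAt ℝ ∞ f x) : ContDiff ℝ ∞ f := by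
  rw [contDiff_iff_contDiffAt]
  intro x
  by_cases hx : x ∈ tsupport f
  · exact hf x hx
  · exact contDiffAt_const.congr_of_eventuallyEq (notMem_tsupport_iff_eventuallyEq.1 hx)

theorem DiffOp.contDiffAt_coeff (A : DiffOp Ω ν E F) {α : Fin N → ℕ} (hα : ∑ i, α i ≤ ν)
    {x : 𝔼 N} (hx : x ∈ Ω) : ContDiffAt ℝ ∞ (A.coeff α) x :=
  (A.smooth α hα).contDiffAt (Ω.isOpen.mem_nhds hx)

theorem DiffOp.contDiff_comp_coeff (A : DiffOp Ω ν E F) {α : Fin N → ℕ} (hα : ∑ i, α i ≤ ν)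
    {v : (𝔼 N) → ConjDual F} (hv : ContDiff ℝ ∞ v) (hvs : tsupport v ⊆ Ω) :
    ContDiff ℝ ∞ fun y => (v y).comp (A.coeff α y) := by
  refine contDiff_of_tsupport fun x hx => ?_
  have hxv : x ∈ tsupport v :=
    closure_mono (fun y (hy : (v y).comp (A.coeff α y) ≠ 0) (hvy : v y = 0) =>
      hy (by simp [hvy])) hx
  exact (conjDualComp E F).isBoundedBilinearMap.contDiff.contDiffAt.comp x
    (hv.contDiffAt.prodMk (A.contDiffAt_coeff hα (hvs hxv)))

theorem DiffOp.continuous_adjoint (A : DiffOp Ω ν E F) {v : (𝔼 N) → ConjDual F}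
    (hv : ContDiff ℝ ∞ v) (hvs : tsupport v ⊆ Ω) : Continuous (A.adjoint v) :=
  (A.contDiff_adjoint fun _ hα => A.contDiff_comp_coeff hα hv hvs).continuous

/-- The operator `χ A`. -/
def DiffOp.cutoff (A : DiffOp Ω ν E F) (χ : (𝔼 N) → ℝ) (hχ : ContDiff ℝ ∞ χ) :
    DiffOp Ω ν E F where
  coeff α x := χ x • A.coeff α x
  smooth α hα := hχ.contDiffOn.smul (A.smooth α hα)

section

variable {χ : (𝔼 N) → ℝ} (hχ : ContDiff ℝ ∞ χ)

theorem DiffOp.contDiff_cutoff_coeff (A : DiffOp Ω ν E F) (hχs : tsupport χ ⊆ Ω)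
    (α : Fin N → ℕ) (hα : ∑ i, α i ≤ ν) : ContDiff ℝ ∞ ((A.cutoff χ hχ).coeff α) := by
  refine contDiff_of_tsupport fun x hx => ?_
  have hx' : x ∈ tsupport χ := tsupport_smul_subset_left χ (A.coeff α) hx
  exact hχ.contDiffAt.smul (A.contDiffAt_coeff hα (hχs hx'))

/-- Testing χ A with `v` is the same as testing `A` with χ v. The function `v` may therefore have
any support, provided that of χ lies in `U`. -/
theorem DiffOp.cutoff_adjoint (A : DiffOp Ω ν E F) (v : (𝔼 N) → ConjDual F) :
    (A.cutoff χ hχ).adjoint v = A.adjoint fun x => χ x • v x := by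
  have : ∀ α, (fun y => (v y).comp ((A.cutoff χ hχ).coeff α y)) =
      fun y => (χ y • v y).comp (A.coeff α y) := by
    intro α
    ext y z
    change v y (χ y • A.coeff α y z) = χ y • v y (A.coeff α y z)
    rw [← Complex.coe_smul, map_smulₛₗ]
    simp
  unfold DiffOp.adjoint
  simp only [this]

theorem DiffOp.cutoff_apply (A : DiffOp Ω ν E F) {u : (𝔼 N) → E}
    (hu : ∀ x ∈ tsupport u, χ x = 1) : (A.cutoff χ hχ).apply u = A.apply u := by
  ext1 x
  refine Finset.sum_congr rfl fun k _ => Finset.sum_congr rfl fun α _ => ?_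
  by_cases hx : x ∈ tsupport u
  · simp [DiffOp.cutoff, hu x hx]
  · simp [image_eq_zero_of_notMem_tsupport fun h => hx (tsupport_multiDeriv_subset u α h)]

end

/-- A compactly supported function satisfies the definition of weak derivatives with smooth
functions of arbitrary support. -/
theorem IsWeakDeriv.integral_eq {K : Set (𝔼 N)} {α : Fin N → ℕ} {g h : (𝔼 N) → E}
    (hw : IsWeakDeriv U α g h) (hg : SuppIn U K g) {χ : (𝔼 N) → ℝ} (hχ : ContDiff ℝ ∞ χ)
    (hχc : HasCompactSupport χ) (hχU : tsupport χ ⊆ U) (hχ1 : ∀ x ∈ K, ∀ᶠ y in 𝓝 x, χ y = 1)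
    {φ : (𝔼 N) → ℂ} (hφ : ContDiff ℝ ∞ φ) :
    ∫ x in (U : Set (𝔼 N)), multiDeriv α φ x • g x =
      (-1 : ℂ) ^ (∑ i, α i) • ∫ x in (U : Set (𝔼 N)), φ x • χ x • h x := by
  let θ : TestFunction U ℂ ⊤ :=
    ⟨fun x => χ x • φ x, hχ.smul hφ, hχc.smul_right,
      (tsupport_smul_subset_left χ φ).trans hχU⟩
  have h1 := hw.2.2 θ
  have h2 : ∫ x in (U : Set (𝔼 N)), multiDeriv α θ x • g x =
      ∫ x in (U : Set (𝔼 N)), multiDeriv α φ x • g x := by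
    refine integral_congr_ae ?_
    filter_upwards [hg] with x hx
    by_cases hxK : x ∈ K
    · have : (θ : (𝔼 N) → ℂ) =ᶠ[𝓝 x] φ := (hχ1 x hxK).mono fun y hy => by
        change χ y • φ y = φ y
        rw [hy, one_smul]
      have h3 := (listDeriv_congr this (multiList α)).self_of_nhds
      rw [multiDeriv_eq_listDeriv, multiDeriv_eq_listDeriv, h3]
    · rw [hx hxK, smul_zero, smul_zero]
  rw [← h2, h1]
  congr 2
  ext1 x
  change (χ x • φ x) • h x = φ x • χ x • h x
  rw [smul_assoc, smul_comm]

theorem integrable_of_suppIn {G : Type*} [NormedAddCommGroup G] {K : Set (𝔼 N)}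
    (hK : IsCompact K) (hKU : K ⊆ U) {g : (𝔼 N) → G}
    (hg : MemLp g 1 (volume.restrict (U : Set (𝔼 N)))) : Integrable (K.indicator g) := by
  rw [integrable_indicator_iff hK.measurableSet]
  exact IntegrableOn.mono_set (memLp_one_iff_integrable.1 hg) hKU

/-- The function χ v is a test function in `U` of norm at most 1, hence admissible in the variation
of `g`. Here `g'` is a representative of `g` extended by zero, which permits integrals over the
whole space. -/
theorem DiffOp.norm_integral_cutoff_adjoint_le (A : DiffOp Ω ν E F) {χ : (𝔼 N) → ℝ}
    (hχ : ContDiff ℝ ∞ χ) (hχc : HasCompactSupport χ) (hχU : tsupport χ ⊆ U)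
    (hχ01 : ∀ x, 0 ≤ χ x ∧ χ x ≤ 1) {g g' : (𝔼 N) → E} (hgA : A.variation U g < ⊤)
    (hg'U : ∀ x ∉ (U : Set (𝔼 N)), g' x = 0)
    (hgg' : ∀ᵐ x ∂(volume.restrict (U : Set (𝔼 N))), g' x = g x)
    {v : (𝔼 N) → ConjDual F} (hv : ContDiff ℝ ∞ v) (hv1 : ∀ x, ‖v x‖ ≤ 1) :
    ‖∫ x, conjPairing E ((A.cutoff χ hχ).adjoint v x) (g' x)‖ ≤ (A.variation U g).toReal := by
  have hθs : ContDiff ℝ ∞ fun x => χ x • v x := hχ.smul hv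
  have hsub : Function.support (fun x => χ x • v x) ⊆ Function.support χ := by
    intro x hx hχx
    refine hx ?_
    ext z
    simp [hχx]
  have hθc : HasCompactSupport fun x => χ x • v x := hχc.mono hsub
  have hθU : tsupport (fun x => χ x • v x) ⊆ U := (closure_mono hsub).trans hχU
  obtain ⟨θ, hθ⟩ : ∃ θ : TestFunction U (ConjDual F) ⊤, (θ : (𝔼 N) → ConjDual F) =
    fun x => χ x • v x := ⟨⟨_, hθs, hθc, hθU⟩, rfl⟩
  have hθ1 : ∀ x, ‖θ x‖ ≤ 1 := by
    intro x
    rw [hθ, norm_smul, Real.norm_of_nonneg (hχ01 x).1]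
    exact mul_le_one₀ (hχ01 x).2 (norm_nonneg _) (hv1 x)
  have h1 : ‖∫ x in (U : Set (𝔼 N)), conj (A.adjoint θ x (g x))‖ₑ ≤ A.variation U g :=
    le_iSup₂_of_le θ hθ1 le_rfl
  have h2 : ∫ x, conjPairing E ((A.cutoff χ hχ).adjoint v x) (g' x) =
      ∫ x in (U : Set (𝔼 N)), conj (A.adjoint θ x (g x)) := by
    rw [A.cutoff_adjoint hχ, ← setIntegral_eq_integral_of_forall_compl_eq_zero
      (s := (U : Set (𝔼 N))) fun y hy => by rw [hg'U y hy, map_zero]]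
    refine integral_congr_ae ?_
    filter_upwards [hgg'] with y hy
    rw [hy, conjPairing_apply, hθ]
  rw [h2, ← toReal_enorm]
  exact ENNReal.toReal_mono hgA.ne h1

/-- Functions of bounded `𝒜`-variation with support in a fixed compact set are approximated by
smooth functions. -/
theorem DiffOp.exists_smooth_approx [FiniteDimensional ℂ E] [FiniteDimensional ℂ F]
    (hN : 0 < N) (hν : 1 ≤ ν) (A : DiffOp Ω ν E F) (hU : U ≤ Ω) {K : Set (𝔼 N)}
    (hK : IsCompact K) (hKU : K ⊆ U) :
    ∃ K' : Set (𝔼 N), IsCompact K' ∧ K' ⊆ U ∧ ∃ C : ℝ, 0 ≤ C ∧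
      ∀ g : (𝔼 N) → E, MemSobolev (ν - 1) 1 U g → SuppIn U K g → A.variation U g < ⊤ →
        ∃ h : (Fin N → ℕ) → (𝔼 N) → E,
          (∀ α ∈ multiIndices N (ν - 1), IsWeakDeriv U α g (h α) ∧ Integrable (h α)) ∧
          ∀ η : ℝ≥0∞, η ≠ 0 → ∃ u : (𝔼 N) → E, ContDiff ℝ ∞ u ∧ tsupport u ⊆ K' ∧
            ∫⁻ x in (U : Set (𝔼 N)), ‖u x - g x‖ₑ ≤ η ∧
            (∀ α ∈ multiIndices N (ν - 1), ∫⁻ x, ‖multiDeriv α u x - h α x‖ₑ ≤ η) ∧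
            ∫⁻ x, ‖A.apply u x‖ₑ ≤ ENNReal.ofReal (C * ((A.variation U g).toReal + 2)) := by
  have : CompleteSpace E := FiniteDimensional.complete ℂ E
  have : CompleteSpace F := FiniteDimensional.complete ℂ F
  obtain ⟨d, hd, hdU⟩ := hK.exists_cthickening_subset_open U.isOpen hKU
  obtain ⟨C, hC0, hC⟩ := exists_lintegral_enorm_le_of_dual (F := F) N
  obtain ⟨Cm, -, hCm⟩ := exists_isMollifier N
  refine ⟨Metric.cthickening d K, hK.cthickening, hdU, C, hC0, fun g hg hgK hgA => ?_⟩
  -- χ is 1 near the whole thickening, not only near `K`: then χ A and `A` agree on mollifications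
  -- of `g`, which are supported there.
  obtain ⟨χ, hχ, hχc, hχU, hχ01, hχ1⟩ := exists_cutoff (U := U) hK.cthickening hdU
  have hχ1K : ∀ x ∈ K, ∀ᶠ y in 𝓝 x, χ y = 1 := fun x hx =>
    hχ1 x (Metric.self_subset_cthickening K hx)
  have hχΩ : tsupport χ ⊆ Ω := hχU.trans hU
  choose! h₀ hh₀ using hg.2
  -- Multiplying the weak derivative by χ keeps it a weak derivative, since `g` lives in `K`, and
  -- gives it compact support; extension by zero makes it integrable on the whole space.
  let h : (Fin N → ℕ) → (𝔼 N) → E := fun α =>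
    (U : Set (𝔼 N)).indicator fun x => χ x • h₀ α x
  have hUm : MeasurableSet (U : Set (𝔼 N)) := U.isOpen.measurableSet
  have hhi : ∀ α ∈ multiIndices N (ν - 1), Integrable (h α) := by
    intro α hα
    rw [integrable_indicator_iff hUm]
    have h1 : Integrable (h₀ α) (volume.restrict (U : Set (𝔼 N))) :=
      memLp_one_iff_integrable.1 (hh₀ α hα).2
    exact integrable_bilin (ContinuousLinearMap.lsmul ℝ ℝ) hχ.continuous hχc h1
  have hweak : ∀ α ∈ multiIndices N (ν - 1), ∀ φ : (𝔼 N) → ℂ, ContDiff ℝ ∞ φ →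
      ∫ x in (U : Set (𝔼 N)), multiDeriv α φ x • g x =
        (-1 : ℂ) ^ (∑ i, α i) • ∫ x in (U : Set (𝔼 N)), φ x • h α x := by
    intro α hα φ hφ
    rw [(hh₀ α hα).1.integral_eq hgK hχ hχc hχU hχ1K hφ]
    congr 1
    refine setIntegral_congr_fun hUm fun x hx => ?_
    simp only [h, Set.indicator_of_mem hx]
  refine ⟨h, fun α hα => ⟨⟨(hh₀ α hα).1.1, (hhi α hα).locallyIntegrable.locallyIntegrableOn _,
    fun φ => hweak α hα φ φ.contDiff⟩, hhi α hα⟩, fun η hη => ?_⟩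
  let gK : (𝔼 N) → E := K.indicator g
  have hgi : Integrable gK := integrable_of_suppIn hK hKU hg.1
  have hgae : ∀ᵐ x ∂(volume.restrict (U : Set (𝔼 N))), gK x = g x := by
    filter_upwards [hgK] with x hx
    by_cases hxK : x ∈ K
    · exact Set.indicator_of_mem hxK g
    · simp only [gK, Set.indicator_of_notMem hxK, hx hxK]
  have hgU : ∀ x ∉ (U : Set (𝔼 N)), gK x = 0 := fun x hx =>
    Set.indicator_of_notMem (fun h => hx (hKU h)) g
  obtain ⟨R, hR⟩ := hK.isBounded.subset_closedBall (0 : 𝔼 N)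
  have hgR : ∀ x ∉ Metric.closedBall (0 : 𝔼 N) (max R 0), gK x = 0 := fun x hx =>
    Set.indicator_of_notMem (fun h => hx (Metric.closedBall_subset_closedBall (le_max_left _ _)
      (hR h))) g
  -- The derivatives fall on the kernel, and y ↦ ρ(x - y) is the test function in the weak identity.
  -- Its support need not lie in `U`, which is why `hweak` allows all smooth φ. The reflection sign
  -- cancels the sign of the weak derivative.
  have hgh : ∀ α ∈ multiIndices N (ν - 1), ∀ ρ : (𝔼 N) → ℝ, ContDiff ℝ ∞ ρ →
      HasCompactSupport ρ → multiDeriv α (mollify ρ gK) = mollify ρ (h α) := by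
    intro α hα ρ hρ hρc
    ext1 x
    rw [multiDeriv_eq_listDeriv, listDeriv_mollify_left hρ hρc hgi.locallyIntegrable,
      mollify_eq_swap, mollify_eq_swap]
    have hρx : ContDiff ℝ ∞ fun y => ρ (x - y) := hρ.comp (contDiff_const.sub contDiff_id)
    have h1 := hweak α hα (fun y => ((ρ (x - y) : ℝ) : ℂ)) (Complex.ofRealCLM.contDiff.comp hρx)
    have h2 : ∀ y, multiDeriv α (fun y => ((ρ (x - y) : ℝ) : ℂ)) y =
        (-1 : ℂ) ^ (∑ i, α i) * ((listDeriv (multiList α) ρ (x - y) : ℝ) : ℂ) := by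
      intro y
      rw [multiDeriv_eq_listDeriv]
      have e1 := congrFun (listDeriv_clm_comp Complex.ofRealCLM hρx (multiList α)) y
      simp only [Complex.ofRealCLM_apply] at e1
      rw [e1, listDeriv_comp_sub_left hρ x, length_multiList]
      simp
    simp only [h2, mul_smul, Complex.coe_smul] at h1
    rw [integral_smul] at h1
    have h3 := smul_right_injective E (pow_ne_zero (∑ i, α i) (by norm_num : (-1 : ℂ) ≠ 0)) h1
    have h4 : ∫ y in (U : Set (𝔼 N)), ρ (x - y) • h α y = ∫ y, ρ (x - y) • h α y :=
      setIntegral_eq_integral_of_forall_compl_eq_zero fun y hy => by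
        simp only [h, Set.indicator_of_notMem hy, smul_zero]
    rw [← h4, ← setIntegral_eq_integral_of_forall_compl_eq_zero (s := (U : Set (𝔼 N)))
      fun y hy => by rw [hgU y hy, smul_zero], ← h3]
    refine integral_congr_ae ?_
    filter_upwards [hgae] with y hy
    rw [hy]
  let A' := A.cutoff χ hχ
  have hA' : ∀ α, ∑ i, α i ≤ ν → ContDiff ℝ ∞ (A'.coeff α) := A.contDiff_cutoff_coeff hχ hχΩ
  have hA'c : ∀ α, ∑ i, α i ≤ ν → HasCompactSupport (A'.coeff α) := fun α _ => hχc.smul_right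
  set M := (A.variation U g).toReal with hMdef
  have hM : ∀ v : (𝔼 N) → ConjDual F, ContDiff ℝ ∞ v → HasCompactSupport v →
      (∀ x, ‖v x‖ ≤ 1) → ‖∫ x, conjPairing E (A'.adjoint v x) (gK x)‖ ≤ M := by
    intro v hv _ hv1
    exact A.norm_integral_cutoff_adjoint_le hχ hχc hχU hχ01 hgA hgU hgae hv hv1
  have hev := A'.eventually_norm_integral_apply_mollify_le hN hν hA' hA'c hgi (le_max_right R 0)
    hgR hhi hgh hM hCm
  obtain ⟨ε₁, hε₁, hε₁'⟩ := lintegral_mollify_sub_le hgi hη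
  choose! ε₂ hε₂ hε₂' using fun α (hα : α ∈ multiIndices N (ν - 1)) =>
    lintegral_mollify_sub_le (hhi α hα) hη
  have hsmall : ∀ᶠ ε in 𝓝[>] (0 : ℝ), ε ≤ d ∧ ε ≤ ε₁ ∧ ∀ α ∈ multiIndices N (ν - 1), ε ≤ ε₂ α := by
    refine nhdsWithin_le_nhds ((ge_mem_nhds hd).and ((ge_mem_nhds hε₁).and ?_))
    exact (Filter.eventually_all_finset _).2 fun α hα => ge_mem_nhds (hε₂ α hα)
  obtain ⟨ε, ⟨hb, hεd, hεε₁, hεε₂⟩, hε0⟩ := ((hev.and hsmall).and self_mem_nhdsWithin).exists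
  obtain ⟨ρ, hρ⟩ := hCm ε hε0
  have hus : tsupport (mollify ρ gK) ⊆ Metric.cthickening d K :=
    (tsupport_mollify_subset hρ fun x hx => Set.indicator_of_notMem hx g).trans
      (Metric.cthickening_mono hεd K)
  have hu : ContDiff ℝ ∞ (mollify ρ gK) :=
    contDiff_mollify hρ.smooth hρ.hasCompactSupport hgi.locallyIntegrable
  have huc : HasCompactSupport (mollify ρ gK) :=
    hK.cthickening.of_isClosed_subset (isClosed_tsupport _) hus
  refine ⟨mollify ρ gK, hu, hus, ?_, fun α hα => ?_, ?_⟩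
  · calc ∫⁻ x in (U : Set (𝔼 N)), ‖mollify ρ gK x - g x‖ₑ
        = ∫⁻ x in (U : Set (𝔼 N)), ‖mollify ρ gK x - gK x‖ₑ := by
          refine lintegral_congr_ae ?_
          filter_upwards [hgae] with x hx
          rw [hx]
      _ ≤ ∫⁻ x, ‖mollify ρ gK x - gK x‖ₑ := setLIntegral_le_lintegral _ _
      _ ≤ η := hε₁' ρ ε Cm hεε₁ hρ
  · rw [hgh α hα ρ hρ.smooth hρ.hasCompactSupport]
    exact hε₂' α hα ρ ε Cm (hεε₂ α hα) hρ
  · have happ : A'.apply (mollify ρ gK) = A.apply (mollify ρ gK) :=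
      A.cutoff_apply hχ fun x hx => (hχ1 x (hus hx)).self_of_nhds
    rw [← happ]
    have hM0 : 0 ≤ M := ENNReal.toReal_nonneg
    -- One of the two units in M + 2 comes from the commutators, the other from the regularised sign
    -- in the duality estimate.
    have := hC (A'.apply (mollify ρ gK)) (A'.contDiff_apply hA' hu)
      (huc.mono' ((subset_tsupport _).trans (A'.tsupport_apply_subset _))) (M + 1)
      (by linarith) (hb ρ hρ)
    rwa [show M + 1 + 1 = M + 2 by ring] at this

end Localization

section Heat

variable {N : ℕ} {E : Type*} [NormedAddCommGroup E] [NormedSpace ℂ E]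

/-! ### The damped heat kernel -/

/-- The symbol of `1 - Δ`. -/
def besselSymbol (ξ : 𝔼 N) : ℝ := 1 + 4 * Real.pi ^ 2 * ‖ξ‖ ^ 2

theorem one_le_besselSymbol (ξ : 𝔼 N) : 1 ≤ besselSymbol ξ := by
  unfold besselSymbol
  have : 0 ≤ 4 * Real.pi ^ 2 * ‖ξ‖ ^ 2 := by positivity
  linarith

theorem besselSymbol_pos (ξ : 𝔼 N) : 0 < besselSymbol ξ :=
  zero_lt_one.trans_le (one_le_besselSymbol ξ)

theorem continuous_besselSymbol : Continuous (besselSymbol : (𝔼 N) → ℝ) := by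
  unfold besselSymbol
  fun_prop

/-- The Gaussian probability density with variance `2 t`. -/
def gaussKernel (t : ℝ) (z : 𝔼 N) : ℝ :=
  ((4 * Real.pi * t)⁻¹) ^ ((N : ℝ) / 2) * Real.exp (-(‖z‖ ^ 2 / (4 * t)))

/-- The kernel of `exp (-t (1 - Δ))`. -/
def heatKernel (t : ℝ) (z : 𝔼 N) : ℝ := Real.exp (-t) * gaussKernel t z

theorem gaussKernel_nonneg {t : ℝ} (ht : 0 < t) (z : 𝔼 N) : 0 ≤ gaussKernel t z := by
  unfold gaussKernel
  positivity

theorem heatKernel_nonneg {t : ℝ} (ht : 0 < t) (z : 𝔼 N) : 0 ≤ heatKernel t z :=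
  mul_nonneg (Real.exp_pos _).le (gaussKernel_nonneg ht z)

theorem continuous_gaussKernel (t : ℝ) : Continuous (gaussKernel t : (𝔼 N) → ℝ) := by
  unfold gaussKernel
  fun_prop

theorem continuous_heatKernel (t : ℝ) : Continuous (heatKernel t : (𝔼 N) → ℝ) :=
  continuous_const.mul (continuous_gaussKernel t)

theorem measurable_heatKernel : Measurable fun p : ℝ × (𝔼 N) => heatKernel p.1 p.2 := by
  unfold heatKernel gaussKernel
  fun_prop

theorem integrable_gaussKernel {t : ℝ} (ht : 0 < t) : Integrable (gaussKernel t : (𝔼 N) → ℝ) := by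
  have h := GaussianFourier.integrable_cexp_neg_mul_sq_norm_add (V := 𝔼 N)
    (b := (((4 * t)⁻¹ : ℝ) : ℂ)) (by rw [Complex.ofReal_re]; positivity) 0 0
  have h2 := h.norm.const_mul (((4 * Real.pi * t)⁻¹) ^ ((N : ℝ) / 2))
  refine h2.congr (.of_forall fun z => ?_)
  simp only [gaussKernel, Complex.norm_exp]
  congr 2
  rw [zero_mul, add_zero, ← Complex.ofReal_neg, ← Complex.ofReal_pow, ← Complex.ofReal_mul,
    Complex.ofReal_re]
  ring

theorem integral_gaussKernel {t : ℝ} (ht : 0 < t) : ∫ z : 𝔼 N, gaussKernel t z = 1 := by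
  unfold gaussKernel
  rw [integral_const_mul]
  have h := GaussianFourier.integral_rexp_neg_mul_sq_norm (V := 𝔼 N) (b := (4 * t)⁻¹)
    (by positivity)
  have h2 : ∫ z : 𝔼 N, Real.exp (-(‖z‖ ^ 2 / (4 * t))) =
      (Real.pi / (4 * t)⁻¹) ^ ((N : ℝ) / 2) := by
    rw [finrank_euclideanSpace, Fintype.card_fin] at h
    rw [← h]
    congr 1
    ext1 z
    congr 1
    ring
  rw [h2, ← Real.mul_rpow (by positivity) (by positivity)]
  rw [show (4 * Real.pi * t)⁻¹ * (Real.pi / (4 * t)⁻¹) = 1 by field_simp, Real.one_rpow]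

theorem lintegral_gaussKernel {t : ℝ} (ht : 0 < t) :
    ∫⁻ z : 𝔼 N, ENNReal.ofReal (gaussKernel t z) = 1 := by
  rw [← ofReal_integral_eq_lintegral_ofReal (integrable_gaussKernel ht)
    (.of_forall (gaussKernel_nonneg ht)), integral_gaussKernel ht, ENNReal.ofReal_one]

theorem lintegral_heatKernel {t : ℝ} (ht : 0 < t) :
    ∫⁻ z : 𝔼 N, ENNReal.ofReal (heatKernel t z) = ENNReal.ofReal (Real.exp (-t)) := by
  unfold heatKernel
  simp only [ENNReal.ofReal_mul (Real.exp_pos _).le]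
  rw [lintegral_const_mul' _ _ ENNReal.ofReal_ne_top, lintegral_gaussKernel ht, mul_one]

/-- The heat kernel away from the origin. -/
theorem lintegral_heatKernel_compl_ball {t d : ℝ} (ht : 0 < t) (hd : 0 < d) :
    ∫⁻ z : 𝔼 N in {z | d ≤ ‖z‖}, ENNReal.ofReal (heatKernel t z) ≤
      ENNReal.ofReal (2 ^ ((N : ℝ) / 2) * (8 / d ^ 2) * (t * Real.exp (-t))) := by
  -- Split the Gaussian exponent in two halves. One half is at most 8t/d² for |z| ≥ d, because e^q ≥
  -- q; the other is a Gaussian at time 2t, whose normalisation differs by 2^(N/2). The gained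
  -- factor t later compensates the singularity t^(-s-1).
  have hpt : ∀ z ∈ {z : 𝔼 N | d ≤ ‖z‖}, heatKernel t z ≤
      (2 ^ ((N : ℝ) / 2) * (8 / d ^ 2) * (t * Real.exp (-t))) * gaussKernel (2 * t) z := by
    intro z hz
    have h1 : ((4 * Real.pi * t)⁻¹) ^ ((N : ℝ) / 2) =
        2 ^ ((N : ℝ) / 2) * ((4 * Real.pi * (2 * t))⁻¹) ^ ((N : ℝ) / 2) := by
      rw [← Real.mul_rpow (by positivity) (by positivity)]
      congr 1
      field_simp
    have h2 : Real.exp (-(‖z‖ ^ 2 / (4 * t))) =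
        Real.exp (-(‖z‖ ^ 2 / (8 * t))) * Real.exp (-(‖z‖ ^ 2 / (4 * (2 * t)))) := by
      rw [← Real.exp_add]
      congr 1
      field_simp
      ring
    have h3 : Real.exp (-(‖z‖ ^ 2 / (8 * t))) ≤ 8 / d ^ 2 * t := by
      have hq : 0 < d ^ 2 / (8 * t) := by positivity
      have hzd : d ^ 2 ≤ ‖z‖ ^ 2 := by
        have : d ≤ ‖z‖ := hz
        gcongr
      calc Real.exp (-(‖z‖ ^ 2 / (8 * t))) ≤ Real.exp (-(d ^ 2 / (8 * t))) := by gcongr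
        _ = (Real.exp (d ^ 2 / (8 * t)))⁻¹ := Real.exp_neg _
        _ ≤ (d ^ 2 / (8 * t))⁻¹ := by
          gcongr
          linarith [Real.add_one_le_exp (d ^ 2 / (8 * t))]
        _ = 8 / d ^ 2 * t := by field_simp
    unfold heatKernel gaussKernel
    rw [h1, h2]
    calc Real.exp (-t) * (2 ^ ((N : ℝ) / 2) * ((4 * Real.pi * (2 * t))⁻¹) ^ ((N : ℝ) / 2) *
          (Real.exp (-(‖z‖ ^ 2 / (8 * t))) * Real.exp (-(‖z‖ ^ 2 / (4 * (2 * t))))))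
        ≤ Real.exp (-t) * (2 ^ ((N : ℝ) / 2) * ((4 * Real.pi * (2 * t))⁻¹) ^ ((N : ℝ) / 2) *
          (8 / d ^ 2 * t * Real.exp (-(‖z‖ ^ 2 / (4 * (2 * t)))))) := by gcongr
      _ = _ := by ring
  have hms : MeasurableSet {z : 𝔼 N | d ≤ ‖z‖} := measurableSet_le measurable_const measurable_norm
  calc ∫⁻ z : 𝔼 N in {z | d ≤ ‖z‖}, ENNReal.ofReal (heatKernel t z)
      ≤ ∫⁻ z : 𝔼 N in {z | d ≤ ‖z‖}, ENNReal.ofReal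
          (2 ^ ((N : ℝ) / 2) * (8 / d ^ 2) * (t * Real.exp (-t))) *
          ENNReal.ofReal (gaussKernel (2 * t) z) := by
        refine setLIntegral_mono' hms fun z hz => ?_
        rw [← ENNReal.ofReal_mul (by positivity)]
        exact ENNReal.ofReal_le_ofReal (hpt z hz)
    _ ≤ ∫⁻ z : 𝔼 N, ENNReal.ofReal
          (2 ^ ((N : ℝ) / 2) * (8 / d ^ 2) * (t * Real.exp (-t))) *
          ENNReal.ofReal (gaussKernel (2 * t) z) := setLIntegral_le_lintegral _ _
    _ = _ := by
        rw [lintegral_const_mul' _ _ ENNReal.ofReal_ne_top, lintegral_gaussKernel (by positivity),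
          mul_one]

/-- The derivative is bounded by 1, since 2|u| ≤ 1 + u² ≤ e^{u²}. -/
theorem abs_exp_neg_sq_sub_le (a b : ℝ) : |Real.exp (-a ^ 2) - Real.exp (-b ^ 2)| ≤ |a - b| := by
  have hd : ∀ u : ℝ, HasDerivAt (fun u => Real.exp (-u ^ 2)) (Real.exp (-u ^ 2) * -(2 * u)) u := by
    intro u
    have h1 : HasDerivAt (fun u : ℝ => -u ^ 2) (-(2 * u)) u := by
      simpa using (hasDerivAt_pow 2 u).fun_neg
    exact h1.exp
  have h := Convex.norm_image_sub_le_of_norm_hasDerivWithin_le (C := 1) (s := Set.univ)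
    (f := fun u => Real.exp (-u ^ 2)) (x := b) (y := a) (fun u _ => (hd u).hasDerivWithinAt)
    (fun u _ => ?_) convex_univ (Set.mem_univ _) (Set.mem_univ _)
  · simpa using h
  · rw [norm_mul, norm_neg, Real.norm_of_nonneg (Real.exp_pos _).le, Real.exp_neg,
      inv_mul_le_one₀ (Real.exp_pos _), Real.norm_eq_abs]
    have h1 := Real.add_one_le_exp (u ^ 2)
    refine (abs_le.2 ⟨?_, ?_⟩).trans h1 <;> nlinarith [sq_nonneg (u - 1), sq_nonneg (u + 1)]

theorem heatKernel_le {t δ : ℝ} (hδ : 0 < δ) (ht : δ ≤ t) (z : 𝔼 N) :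
    heatKernel t z ≤ Real.exp (-t) * ((4 * Real.pi * δ)⁻¹) ^ ((N : ℝ) / 2) := by
  have ht0 : 0 < t := hδ.trans_le ht
  unfold heatKernel gaussKernel
  have h1 : Real.exp (-(‖z‖ ^ 2 / (4 * t))) ≤ 1 := by
    rw [Real.exp_le_one_iff]
    have : 0 ≤ ‖z‖ ^ 2 / (4 * t) := by positivity
    linarith
  calc Real.exp (-t) * (((4 * Real.pi * t)⁻¹) ^ ((N : ℝ) / 2) * Real.exp (-(‖z‖ ^ 2 / (4 * t))))
      ≤ Real.exp (-t) * (((4 * Real.pi * δ)⁻¹) ^ ((N : ℝ) / 2) * 1) := by gcongr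
    _ = _ := by rw [mul_one]

/-- The Gaussian factor is e^{-u²} with u = |z|/(2√t), a 1-Lipschitz function of u. The factor
e^{-t} is retained for integrability against t^(s-1) at infinity. -/
theorem abs_heatKernel_sub_le {t δ : ℝ} (hδ : 0 < δ) (ht : δ ≤ t) (z z' : 𝔼 N) :
    |heatKernel t z - heatKernel t z'| ≤
      Real.exp (-t) * (((4 * Real.pi * δ)⁻¹) ^ ((N : ℝ) / 2) / √δ) * ‖z - z'‖ := by
  have ht0 : 0 < t := hδ.trans_le ht
  have hsq : ∀ z : 𝔼 N, -(‖z‖ ^ 2 / (4 * t)) = -(‖z‖ / (2 * √t)) ^ 2 := by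
    intro z
    rw [div_pow, mul_pow, Real.sq_sqrt ht0.le]
    norm_num
  unfold heatKernel gaussKernel
  rw [hsq, hsq, ← mul_sub, ← mul_sub, abs_mul, abs_mul, abs_of_pos (Real.exp_pos _),
    abs_of_nonneg (by positivity : (0 : ℝ) ≤ ((4 * Real.pi * t)⁻¹) ^ ((N : ℝ) / 2))]
  have h1 : |Real.exp (-(‖z‖ / (2 * √t)) ^ 2) - Real.exp (-(‖z'‖ / (2 * √t)) ^ 2)| ≤
      ‖z - z'‖ / √δ := by
    refine (abs_exp_neg_sq_sub_le _ _).trans ?_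
    rw [← sub_div, abs_div, abs_of_pos (by positivity : 0 < 2 * √t)]
    refine div_le_div₀ (norm_nonneg _) (abs_norm_sub_norm_le _ _) (by positivity) ?_
    have := Real.sqrt_le_sqrt ht
    linarith [Real.sqrt_nonneg t]
  calc Real.exp (-t) * (((4 * Real.pi * t)⁻¹) ^ ((N : ℝ) / 2) *
        |Real.exp (-(‖z‖ / (2 * √t)) ^ 2) - Real.exp (-(‖z'‖ / (2 * √t)) ^ 2)|)
      ≤ Real.exp (-t) * (((4 * Real.pi * δ)⁻¹) ^ ((N : ℝ) / 2) * (‖z - z'‖ / √δ)) := by gcongr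
    _ = _ := by ring

/-- The operator `exp (-t (1 - Δ))`. -/
def heatOp (t : ℝ) (f : (𝔼 N) → E) (x : 𝔼 N) : E := ∫ y, heatKernel t y • f (x - y)

theorem heatOp_eq_swap (t : ℝ) (f : (𝔼 N) → E) (x : 𝔼 N) :
    heatOp t f x = ∫ y, heatKernel t (x - y) • f y :=
  mollify_eq_swap (heatKernel t) f x

/-- Move the Fourier transform from `f` onto the modulated Gaussian `m`, whose transform is the
Gaussian density centred at `x`. The factor e^{-t} accounts for the 1 in the symbol. -/
theorem heatOp_eq_fourierInv [CompleteSpace E] {t : ℝ} (ht : 0 < t) {f : (𝔼 N) → E}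
    (hf : Integrable f) (x : 𝔼 N) :
    heatOp t f x = 𝓕⁻ (fun ξ => Real.exp (-(t * besselSymbol ξ)) • 𝓕 f ξ) x := by
  set b : ℂ := ((4 * Real.pi ^ 2 * t : ℝ) : ℂ) with hb
  have hbre : 0 < b.re := by rw [hb, Complex.ofReal_re]; positivity
  let m : (𝔼 N) → ℂ := fun ξ =>
    Complex.exp (-b * ‖ξ‖ ^ 2 + 2 * Real.pi * Complex.I * (inner ℝ x ξ : ℝ))
  have hm : Integrable m := GaussianFourier.integrable_cexp_neg_mul_sq_norm_add hbre _ x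
  have hflip := VectorFourier.integral_fourierIntegral_smul_eq_flip (L := innerₗ (𝔼 N))
    (μ := volume) (ν := volume) Real.continuous_fourierChar
    (by exact continuous_inner) hm hf
  rw [flip_innerₗ] at hflip
  have hm_hat : ∀ y, 𝓕 m y = ((gaussKernel t (x - y) : ℝ) : ℂ) := by
    intro y
    rw [fourier_gaussian_innerProductSpace' hbre x y]
    unfold gaussKernel
    rw [Complex.ofReal_mul, Complex.ofReal_exp, Complex.ofReal_cpow (by positivity)]
    congr 1
    · rw [hb, finrank_euclideanSpace, Fintype.card_fin]
      congr 1
      · push_cast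
        have : (Real.pi : ℂ) ≠ 0 := by exact_mod_cast Real.pi_ne_zero
        have : (t : ℂ) ≠ 0 := by exact_mod_cast ht.ne'
        field_simp
      · push_cast; ring
    · congr 1
      rw [hb]
      push_cast
      have : (Real.pi : ℂ) ≠ 0 := by exact_mod_cast Real.pi_ne_zero
      have : (t : ℂ) ≠ 0 := by exact_mod_cast ht.ne'
      field_simp
  have e1 : ∫ y, (𝓕 m y) • f y = ∫ ξ, m ξ • 𝓕 f ξ := hflip
  simp only [hm_hat, Complex.coe_smul] at e1
  rw [heatOp_eq_swap, Real.fourierInv_eq']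
  unfold heatKernel
  simp only [mul_smul]
  rw [integral_smul, e1, ← integral_smul]
  congr 1
  ext1 ξ
  rw [← Complex.coe_smul, ← Complex.coe_smul, ← mul_smul, ← mul_smul, Complex.ofReal_exp,
    Complex.ofReal_exp, ← Complex.exp_add, ← Complex.exp_add]
  congr 2
  rw [hb, besselSymbol, real_inner_comm]
  push_cast
  ring

end Heat

section Bessel

variable {N : ℕ} {E : Type*} [NormedAddCommGroup E] [NormedSpace ℂ E]

/-! ### Fractional powers of `1 - Δ` -/

/-- The operator `(1 - Δ) ^ s`. -/
def besselPow (s : ℝ) (f : (𝔼 N) → E) : (𝔼 N) → E :=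
  𝓕⁻ fun ξ => besselSymbol ξ ^ s • 𝓕 f ξ

theorem continuous_fourierInv {f : (𝔼 N) → E} (hf : Integrable f) : Continuous (𝓕⁻ f) := by
  have h1 : Continuous (𝓕 f) :=
    VectorFourier.fourierIntegral_continuous Real.continuous_fourierChar
      (by exact continuous_inner) hf
  have h2 : 𝓕⁻ f = fun x => 𝓕 f (-x) := funext fun x => Real.fourierInv_eq_fourier_neg f x
  rw [h2]
  exact h1.comp continuous_neg

theorem continuous_fourier_of_smooth {f : (𝔼 N) → E} (hf : ContDiff ℝ ∞ f)
    (hfc : HasCompactSupport f) : Continuous (𝓕 f) := by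
  have h : 𝓕 f = 𝓕 (hfc.toSchwartzMap hf) :=
    (SchwartzMap.fourier_coe (hfc.toSchwartzMap hf)).symm
  rw [h]
  exact (𝓕 (hfc.toSchwartzMap hf)).continuous

theorem continuous_rpow_smul_fourier {f : (𝔼 N) → E} (hf : ContDiff ℝ ∞ f)
    (hfc : HasCompactSupport f) {s : ℝ} :
    Continuous fun ξ => besselSymbol ξ ^ s • 𝓕 f ξ :=
  (continuous_besselSymbol.rpow_const fun ξ => Or.inl (besselSymbol_pos ξ).ne').smul
    (continuous_fourier_of_smooth hf hfc)

/-- For s ≤ 1 the symbol grows at most quadratically, so the moments of order 0 and 2 of a Schwartz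
function suffice. -/
theorem integrable_rpow_smul_fourier {f : (𝔼 N) → E} (hf : ContDiff ℝ ∞ f)
    (hfc : HasCompactSupport f) {s : ℝ} (hs1 : s ≤ 1) :
    Integrable fun ξ => besselSymbol ξ ^ s • 𝓕 f ξ := by
  have h : 𝓕 f = 𝓕 (hfc.toSchwartzMap hf) :=
    (SchwartzMap.fourier_coe (hfc.toSchwartzMap hf)).symm
  have h0 := SchwartzMap.integrable_pow_mul volume (𝓕 (hfc.toSchwartzMap hf)) 0
  have h2 := SchwartzMap.integrable_pow_mul volume (𝓕 (hfc.toSchwartzMap hf)) 2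
  refine (h0.add (h2.const_mul (4 * Real.pi ^ 2))).mono'
    (continuous_rpow_smul_fourier hf hfc).aestronglyMeasurable (.of_forall fun ξ => ?_)
  rw [norm_smul, Real.norm_of_nonneg (Real.rpow_nonneg (besselSymbol_pos ξ).le _), ← h]
  calc besselSymbol ξ ^ s * ‖𝓕 f ξ‖ ≤ besselSymbol ξ ^ (1 : ℝ) * ‖𝓕 f ξ‖ := by
        gcongr
        exact one_le_besselSymbol ξ
    _ = _ := by
        rw [Real.rpow_one, besselSymbol, Pi.add_apply]
        ring

theorem integrable_fourier_of_smooth {f : (𝔼 N) → E} (hf : ContDiff ℝ ∞ f)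
    (hfc : HasCompactSupport f) : Integrable (𝓕 f) := by
  simpa using integrable_rpow_smul_fourier hf hfc (s := 0) zero_le_one

theorem fourierInv_fourier_of_smooth [CompleteSpace E] {f : (𝔼 N) → E} (hf : ContDiff ℝ ∞ f)
    (hfc : HasCompactSupport f) : 𝓕⁻ (𝓕 f) = f :=
  hf.continuous.fourierInv_fourier_eq (hf.continuous.integrable_of_hasCompactSupport hfc)
    (integrable_fourier_of_smooth hf hfc)

theorem continuous_besselPow {f : (𝔼 N) → E} (hf : ContDiff ℝ ∞ f)
    (hfc : HasCompactSupport f) {s : ℝ} (hs1 : s ≤ 1) : Continuous (besselPow s f) :=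
  continuous_fourierInv (integrable_rpow_smul_fourier hf hfc hs1)

theorem fourier_besselPow [CompleteSpace E] {f : (𝔼 N) → E} (hf : ContDiff ℝ ∞ f)
    (hfc : HasCompactSupport f) {s : ℝ} (hs1 : s ≤ 1) (hF : Integrable (besselPow s f)) :
    𝓕 (besselPow s f) = fun ξ => besselSymbol ξ ^ s • 𝓕 f ξ := by
  refine (continuous_rpow_smul_fourier hf hfc).fourier_fourierInv_eq
    (integrable_rpow_smul_fourier hf hfc hs1) ?_
  have h : 𝓕 (fun ξ => besselSymbol ξ ^ s • 𝓕 f ξ) = fun x => besselPow s f (-x) := by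
    ext1 x
    rw [besselPow, Real.fourierInv_eq_fourier_neg, neg_neg]
  rw [h]
  exact hF.comp_neg

/-- Integration of a family of Fourier multipliers with respect to a parameter. -/
theorem integral_fourierInv_smul [CompleteSpace E] {k : ℝ → (𝔼 N) → ℝ} {m : (𝔼 N) → ℝ}
    {G : (𝔼 N) → E}
    (hk : Measurable fun p : ℝ × (𝔼 N) => k p.1 p.2) (hk0 : ∀ t, 0 < t → ∀ ξ, 0 ≤ k t ξ)
    (hki : ∀ ξ, IntegrableOn (fun t => k t ξ) (Set.Ioi 0))
    (hkm : ∀ ξ, ∫ t in Set.Ioi 0, k t ξ = m ξ)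
    (hG : AEStronglyMeasurable G) (hmG : Integrable fun ξ => m ξ • G ξ) (x : 𝔼 N) :
    IntegrableOn (fun t => 𝓕⁻ (fun ξ => k t ξ • G ξ) x) (Set.Ioi 0) ∧
      ∫ t in Set.Ioi 0, 𝓕⁻ (fun ξ => k t ξ • G ξ) x = 𝓕⁻ (fun ξ => m ξ • G ξ) x := by
  let Φ : ℝ → (𝔼 N) → E := fun t ξ => Real.fourierChar (inner ℝ ξ x) • k t ξ • G ξ
  have hΦm : AEStronglyMeasurable (Function.uncurry Φ)
      ((volume.restrict (Set.Ioi 0)).prod volume) := by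
    have h1 : Continuous fun p : ℝ × (𝔼 N) =>
        ((Real.fourierChar (inner ℝ p.2 x) : Circle) : ℂ) :=
      continuous_subtype_val.comp (Real.continuous_fourierChar.comp
        (continuous_snd.inner continuous_const))
    have h2 : AEStronglyMeasurable (fun p : ℝ × (𝔼 N) =>
        ((Real.fourierChar (inner ℝ p.2 x) : Circle) : ℂ) • k p.1 p.2 • G p.2)
        ((volume.restrict (Set.Ioi 0)).prod volume) := by
      exact h1.aestronglyMeasurable.smul (hk.aestronglyMeasurable.smul hG.comp_snd)
    exact h2
  have hnorm : ∀ ξ, ∀ t ∈ Set.Ioi (0 : ℝ), ‖Φ t ξ‖ = k t ξ * ‖G ξ‖ := by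
    intro ξ t ht
    simp only [Φ]
    rw [Circle.norm_smul, norm_smul, Real.norm_of_nonneg (hk0 t ht ξ)]
  have hm0 : ∀ ξ, 0 ≤ m ξ := fun ξ => by
    rw [← hkm]
    exact setIntegral_nonneg measurableSet_Ioi fun t ht => hk0 t ht ξ
  have hΦi : Integrable (Function.uncurry Φ) ((volume.restrict (Set.Ioi 0)).prod volume) := by
    rw [integrable_prod_iff' hΦm]
    refine ⟨.of_forall fun ξ => ?_, ?_⟩
    · have : Integrable (fun t => Real.fourierChar (inner ℝ ξ x) • k t ξ • G ξ)
          (volume.restrict (Set.Ioi 0)) := by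
        exact ((hki ξ).smul_const (G ξ)).smul
          ((Real.fourierChar (inner ℝ ξ x) : Circle) : ℂ)
      exact this
    · refine hmG.norm.congr (.of_forall fun ξ => ?_)
      have : ∫ t in Set.Ioi 0, ‖Φ t ξ‖ = m ξ * ‖G ξ‖ := by
        rw [setIntegral_congr_fun measurableSet_Ioi (hnorm ξ), integral_mul_const, hkm]
      simp only [Function.uncurry_apply_pair]
      rw [this, norm_smul, Real.norm_of_nonneg (hm0 ξ)]
  have hinv : ∀ t, 𝓕⁻ (fun ξ => k t ξ • G ξ) x = ∫ ξ, Φ t ξ := fun t => Real.fourierInv_eq _ _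
  simp only [hinv]
  refine ⟨hΦi.integral_prod_left, ?_⟩
  rw [integral_integral_swap hΦi, Real.fourierInv_eq]
  congr 1
  ext1 ξ
  simp only [Φ]
  rw [← hkm ξ, ← integral_smul_const]
  exact integral_smul ((Real.fourierChar (inner ℝ ξ x) : Circle) : ℂ) _

/-! ### Two integral representations of powers -/

/-- Near 0 the inequality 1 - e^{-t} ≤ t leaves t^(-s), integrable as s < 1; at infinity t^(-s-1) is
integrable as s > 0. -/
theorem integrableOn_rpow_mul_one_sub_exp {s : ℝ} (hs : 0 < s) (hs1 : s < 1) :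
    IntegrableOn (fun t : ℝ => t ^ (-s - 1) * (1 - Real.exp (-t))) (Set.Ioi 0) := by
  rw [← Set.Ioc_union_Ioi_eq_Ioi (zero_le_one' ℝ)]
  have hm : Measurable fun t : ℝ => t ^ (-s - 1) * (1 - Real.exp (-t)) := by fun_prop
  refine IntegrableOn.union ?_ ?_
  · have h : IntegrableOn (fun t : ℝ => t ^ (-s)) (Set.Ioc 0 1) :=
      (intervalIntegrable_iff_integrableOn_Ioc_of_le zero_le_one).1
        (intervalIntegral.intervalIntegrable_rpow' (by linarith))
    refine Integrable.mono' h hm.aestronglyMeasurable ?_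
    filter_upwards [self_mem_ae_restrict measurableSet_Ioc] with t ht
    have h1 : 1 - Real.exp (-t) ≤ t := by linarith [Real.add_one_le_exp (-t)]
    have h2 : 0 ≤ 1 - Real.exp (-t) := by
      rw [sub_nonneg, Real.exp_le_one_iff]; linarith [ht.1]
    rw [Real.norm_of_nonneg (mul_nonneg (Real.rpow_nonneg ht.1.le _) h2)]
    calc t ^ (-s - 1) * (1 - Real.exp (-t)) ≤ t ^ (-s - 1) * t := by
          gcongr
          exact Real.rpow_nonneg ht.1.le _
      _ = t ^ (-s) := by
          rw [← Real.rpow_add_one ht.1.ne']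
          congr 1
          ring
  · have h : IntegrableOn (fun t : ℝ => t ^ (-s - 1)) (Set.Ioi 1) :=
      integrableOn_Ioi_rpow_of_lt (by linarith) zero_lt_one
    refine Integrable.mono' h hm.aestronglyMeasurable ?_
    filter_upwards [self_mem_ae_restrict measurableSet_Ioi] with t ht
    have ht0 : 0 < t := zero_lt_one.trans ht
    have h1 : 1 - Real.exp (-t) ≤ 1 := by linarith [Real.exp_pos (-t)]
    have h2 : 0 ≤ 1 - Real.exp (-t) := by
      rw [sub_nonneg, Real.exp_le_one_iff]; linarith
    rw [Real.norm_of_nonneg (mul_nonneg (Real.rpow_nonneg ht0.le _) h2)]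
    exact mul_le_of_le_one_right (Real.rpow_nonneg ht0.le _) h1

theorem integral_rpow_mul_one_sub_exp_pos {s : ℝ} (hs : 0 < s) (hs1 : s < 1) :
    0 < ∫ t in Set.Ioi (0 : ℝ), t ^ (-s - 1) * (1 - Real.exp (-t)) := by
  have hpos : ∀ t ∈ Set.Ioi (0 : ℝ), 0 < t ^ (-s - 1) * (1 - Real.exp (-t)) := fun t ht => by
    refine mul_pos (Real.rpow_pos_of_pos ht _) ?_
    rw [sub_pos, Real.exp_lt_one_iff]
    simpa using ht
  rw [setIntegral_pos_iff_support_of_nonneg_ae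
    (by filter_upwards [self_mem_ae_restrict measurableSet_Ioi] with t ht using (hpos t ht).le)
    (integrableOn_rpow_mul_one_sub_exp hs hs1)]
  have : Set.Ioi (0 : ℝ) ⊆ Function.support (fun t => t ^ (-s - 1) * (1 - Real.exp (-t))) ∩
      Set.Ioi 0 := fun t ht => ⟨(hpos t ht).ne', ht⟩
  exact lt_of_lt_of_le (by simp) (measure_mono this)

theorem rpow_mul_one_sub_exp_scale {s l : ℝ} (hl : 0 < l) {t : ℝ} (ht : 0 < t) :
    t ^ (-s - 1) * (1 - Real.exp (-(t * l))) =
      l ^ (s + 1) * ((l * t) ^ (-s - 1) * (1 - Real.exp (-(l * t)))) := by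
  rw [Real.mul_rpow hl.le ht.le, mul_comm t l]
  have : l ^ (s + 1) * l ^ (-s - 1) = 1 := by
    rw [← Real.rpow_add hl]
    simp
  linear_combination (-(t ^ (-s - 1) * (1 - Real.exp (-(l * t))))) * this

theorem integrableOn_rpow_mul_one_sub_exp_mul {s l : ℝ} (hs : 0 < s) (hs1 : s < 1) (hl : 0 < l) :
    IntegrableOn (fun t : ℝ => t ^ (-s - 1) * (1 - Real.exp (-(t * l)))) (Set.Ioi 0) := by
  have h := (integrableOn_Ioi_comp_mul_left_iff
    (fun t : ℝ => t ^ (-s - 1) * (1 - Real.exp (-t))) 0 hl).2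
    (by rw [mul_zero]; exact integrableOn_rpow_mul_one_sub_exp hs hs1)
  exact IntegrableOn.congr_fun (Integrable.const_mul h (l ^ (s + 1)))
    (fun t ht => (rpow_mul_one_sub_exp_scale hl ht).symm) measurableSet_Ioi

/-- Scaling represents l^s, a positive power, through the heat multipliers e^{-tl}. The constant is
left as an integral, since only its positivity is used. -/
theorem integral_rpow_mul_one_sub_exp_mul {s l : ℝ} (hl : 0 < l) :
    ∫ t in Set.Ioi (0 : ℝ), t ^ (-s - 1) * (1 - Real.exp (-(t * l))) =
      (∫ t in Set.Ioi (0 : ℝ), t ^ (-s - 1) * (1 - Real.exp (-t))) * l ^ s := by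
  rw [setIntegral_congr_fun measurableSet_Ioi fun t ht => rpow_mul_one_sub_exp_scale hl ht,
    integral_const_mul,
    integral_comp_mul_left_Ioi (fun t : ℝ => t ^ (-s - 1) * (1 - Real.exp (-t))) 0 hl, mul_zero,
    smul_eq_mul, Real.rpow_add_one hl.ne']
  field_simp

theorem integrableOn_rpow_mul_exp_neg_mul {s l : ℝ} (hs : 0 < s) (hl : 0 < l) :
    IntegrableOn (fun t : ℝ => t ^ (s - 1) * Real.exp (-(t * l))) (Set.Ioi 0) := by
  have h := integrableOn_rpow_mul_exp_neg_mul_rpow (p := 1) (s := s - 1) (b := l) (by linarith)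
    zero_lt_one hl
  refine h.congr_fun (fun t _ => ?_) measurableSet_Ioi
  simp only [Real.rpow_one]
  congr 2
  ring

theorem integral_rpow_mul_exp_neg_mul {s l : ℝ} (hs : 0 < s) (hl : 0 < l) :
    ∫ t in Set.Ioi (0 : ℝ), t ^ (s - 1) * Real.exp (-(t * l)) = Real.Gamma s * l ^ (-s) := by
  have h := Real.integral_rpow_mul_exp_neg_mul_Ioi hs hl
  rw [Real.rpow_neg hl.le, ← Real.inv_rpow hl.le, inv_eq_one_div, mul_comm (Real.Gamma s), ← h]
  simp only [mul_comm]

end Bessel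

/-! ### Decay of (1 - Δ)^s f off the support and recovery of f by heat flow -/

section BesselEstimates

variable {N : ℕ} {E : Type*} [NormedAddCommGroup E] [NormedSpace ℂ E]

theorem fourierInv_const_smul (G : (𝔼 N) → E) (a : ℝ) (x : 𝔼 N) :
    𝓕⁻ (fun ξ => a • G ξ) x = a • 𝓕⁻ G x := by
  simp only [Real.fourierInv_eq]
  rw [← integral_smul]
  congr 1
  ext1 ξ
  simp only [Circle.smul_def]
  rw [smul_comm]

theorem fourierInv_const_smul_sub {G H : (𝔼 N) → E} (hG : Integrable G) (hH : Integrable H)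
    (a : ℝ) (x : 𝔼 N) :
    𝓕⁻ (fun ξ => a • (G ξ - H ξ)) x = a • (𝓕⁻ G x - 𝓕⁻ H x) := by
  have h : ∀ {G : (𝔼 N) → E}, Integrable G →
      Integrable fun ξ => Real.fourierChar (inner ℝ ξ x) • G ξ := fun {G} hG => by
    simpa using (Real.fourierIntegral_convergent_iff (-x)).2 hG
  simp only [Real.fourierInv_eq]
  rw [← integral_sub (h hG) (h hH), ← integral_smul]
  congr 1
  ext1 ξ
  simp only [Circle.smul_def, smul_sub]
  rw [smul_comm, smul_comm _ _ (H ξ)]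

theorem enorm_heatOp_le {t : ℝ} (ht : 0 < t) (f : (𝔼 N) → E) (x : 𝔼 N) :
    ‖heatOp t f x‖ₑ ≤ ∫⁻ y, ENNReal.ofReal (heatKernel t y) * ‖f (x - y)‖ₑ := by
  refine (enorm_integral_le_lintegral_enorm _).trans (le_of_eq ?_)
  congr 1
  ext1 y
  rw [enorm_smul, Real.enorm_of_nonneg (heatKernel_nonneg ht y)]

/-- Tonelli's theorem for a family of convolutions. -/
theorem lintegral_lintegral_lintegral_mul_enorm_sub {E : Type*} [NormedAddCommGroup E]
    {k : ℝ → (𝔼 N) → ℝ≥0∞}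
    (hk : Measurable fun p : ℝ × (𝔼 N) => k p.1 p.2) {f : (𝔼 N) → E} (hf : Continuous f)
    (S : Set ℝ) :
    ∫⁻ x, ∫⁻ t in S, ∫⁻ y, k t y * ‖f (x - y)‖ₑ =
      (∫⁻ t in S, ∫⁻ y, k t y) * ∫⁻ x, ‖f x‖ₑ := by
  have hm : Measurable fun q : ((𝔼 N) × ℝ) × (𝔼 N) => k q.1.2 q.2 * ‖f (q.1.1 - q.2)‖ₑ := by
    have h1 : Measurable fun q : ((𝔼 N) × ℝ) × (𝔼 N) => k q.1.2 q.2 :=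
      hk.comp ((measurable_snd.comp measurable_fst).prodMk measurable_snd)
    have h2 : Continuous fun q : ((𝔼 N) × ℝ) × (𝔼 N) => ‖f (q.1.1 - q.2)‖ₑ :=
      (hf.comp (by fun_prop)).enorm
    exact h1.mul h2.measurable
  have hm1 : Measurable fun p : (𝔼 N) × ℝ => ∫⁻ y, k p.2 y * ‖f (p.1 - y)‖ₑ :=
    hm.lintegral_prod_right'
  rw [lintegral_lintegral_swap hm1.aemeasurable]
  have hkt : ∀ t, Measurable (k t) := fun t => hk.comp (measurable_const.prodMk measurable_id)
  simp only [lintegral_lintegral_mul_enorm_sub (hkt _).aemeasurable hf.aestronglyMeasurable]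
  exact lintegral_mul_const _ hk.lintegral_prod_right'

variable [CompleteSpace E]

/-- Off the support of `f`, the function `(1 - Δ) ^ s f` is an integral of heat extensions. -/
theorem besselPow_eq_of_eq_zero {s : ℝ} (hs : 0 < s) (hs1 : s < 1) {f : (𝔼 N) → E}
    (hf : ContDiff ℝ ∞ f) (hfc : HasCompactSupport f) {x : 𝔼 N} (hx : f x = 0) :
    (∫ t in Set.Ioi (0 : ℝ), t ^ (-s - 1) * (1 - Real.exp (-t))) • besselPow s f x =
      -∫ t in Set.Ioi (0 : ℝ), t ^ (-s - 1) • heatOp t f x := by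
  set c := ∫ t in Set.Ioi (0 : ℝ), t ^ (-s - 1) * (1 - Real.exp (-t)) with hc
  have hfi : Integrable f := hf.continuous.integrable_of_hasCompactSupport hfc
  have hG := integrable_fourier_of_smooth hf hfc
  have hGs := integrable_rpow_smul_fourier hf hfc hs1.le
  obtain ⟨-, h⟩ := integral_fourierInv_smul (G := 𝓕 f)
    (k := fun t ξ => t ^ (-s - 1) * (1 - Real.exp (-(t * besselSymbol ξ))))
    (m := fun ξ => c * besselSymbol ξ ^ s)
    (by
      have := (continuous_besselSymbol (N := N)).measurable
      fun_prop)
    (fun t ht ξ => by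
      refine mul_nonneg (Real.rpow_nonneg ht.le _) ?_
      rw [sub_nonneg, Real.exp_le_one_iff]
      have := mul_pos ht (besselSymbol_pos ξ)
      linarith)
    (fun ξ => integrableOn_rpow_mul_one_sub_exp_mul hs hs1 (besselSymbol_pos ξ))
    (fun ξ => integral_rpow_mul_one_sub_exp_mul (besselSymbol_pos ξ))
    hG.aestronglyMeasurable
    (by simpa only [mul_smul, Pi.smul_def] using hGs.smul c) x
  have hr : 𝓕⁻ (fun ξ => (c * besselSymbol ξ ^ s) • 𝓕 f ξ) x = c • besselPow s f x := by
    simp only [mul_smul]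
    rw [fourierInv_const_smul, besselPow]
  rw [hr] at h
  rw [← h, ← integral_neg]
  refine setIntegral_congr_fun measurableSet_Ioi fun t ht => ?_
  have ht : 0 < t := ht
  have he : Integrable fun ξ => Real.exp (-(t * besselSymbol ξ)) • 𝓕 f ξ := by
    refine hG.norm.mono' ?_ (.of_forall fun ξ => ?_)
    · have := (continuous_besselSymbol (N := N))
      exact (by fun_prop : Continuous fun ξ : 𝔼 N =>
        Real.exp (-(t * besselSymbol ξ))).aestronglyMeasurable.smul hG.aestronglyMeasurable
    · rw [norm_smul, Real.norm_of_nonneg (Real.exp_pos _).le]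
      refine mul_le_of_le_one_left (norm_nonneg _) ?_
      rw [Real.exp_le_one_iff]
      have := mul_pos ht (besselSymbol_pos ξ)
      linarith
  -- The identity term in 1 - e^{-t(1-Δ)} returns f(x) = 0, so only the heat term survives.
  have h1 := fourierInv_const_smul_sub hG he (t ^ (-s - 1)) x
  rw [fourierInv_fourier_of_smooth hf hfc, ← heatOp_eq_fourierInv ht hfi, hx, zero_sub,
    smul_neg] at h1
  rw [← h1]
  refine congrFun (congrArg _ (funext fun ξ => ?_)) x
  rw [mul_smul, sub_smul, one_smul]

/-- At distance d from the support only the heat kernel on |y| ≥ d enters, and its mass is O(t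
e^{-t}). Against t^(-s-1) this integrates to a multiple of Γ(1 - s). The fractional hypothesis gives
information only where ψ is known, that is in `U`; this bound covers the complement. -/
theorem lintegral_compl_enorm_besselPow_le {s d : ℝ} (hs : 0 < s) (hs1 : s < 1) (hd : 0 < d) :
    ∃ C : ℝ≥0, ∀ {f : (𝔼 N) → E}, ContDiff ℝ ∞ f → HasCompactSupport f → ∀ {V : Set (𝔼 N)},
      MeasurableSet V → (∀ x ∈ V, ∀ y ∈ tsupport f, d ≤ ‖x - y‖) →
      ∫⁻ x in V, ‖besselPow s f x‖ₑ ≤ C * ∫⁻ x, ‖f x‖ₑ := by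
  set c := ∫ t in Set.Ioi (0 : ℝ), t ^ (-s - 1) * (1 - Real.exp (-t)) with hc
  have hc0 : 0 < c := integral_rpow_mul_one_sub_exp_pos hs hs1
  set D : ℝ := 2 ^ ((N : ℝ) / 2) * (8 / d ^ 2) with hD
  have hD0 : 0 ≤ D := by positivity
  refine ⟨(c⁻¹ * (D * Real.Gamma (1 - s))).toNNReal, ?_⟩
  intro f hf hfc V hV hdist
  let k : ℝ → (𝔼 N) → ℝ≥0∞ := fun t y => ENNReal.ofReal (t ^ (-s - 1)) *
    Set.indicator {z : 𝔼 N | d ≤ ‖z‖} (fun y => ENNReal.ofReal (heatKernel t y)) y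
  have hms : MeasurableSet {z : 𝔼 N | d ≤ ‖z‖} := measurableSet_le measurable_const measurable_norm
  have hk : Measurable fun p : ℝ × (𝔼 N) => k p.1 p.2 := by
    refine Measurable.mul (by fun_prop) ?_
    exact (measurable_heatKernel.ennreal_ofReal).indicator (measurable_snd hms)
  have hpt : ∀ x ∈ V, ‖besselPow s f x‖ₑ ≤
      ENNReal.ofReal c⁻¹ * ∫⁻ t in Set.Ioi (0 : ℝ), ∫⁻ y, k t y * ‖f (x - y)‖ₑ := by
    intro x hx
    have hfx : f x = 0 := by
      by_contra hne
      have := hdist x hx x (subset_tsupport f hne)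
      rw [sub_self, norm_zero] at this
      linarith
    have h := besselPow_eq_of_eq_zero hs hs1 hf hfc hfx
    rw [← hc] at h
    have h2 : besselPow s f x = c⁻¹ • -∫ t in Set.Ioi (0 : ℝ), t ^ (-s - 1) • heatOp t f x := by
      rw [← h, smul_smul, inv_mul_cancel₀ hc0.ne', one_smul]
    rw [h2, enorm_smul, Real.enorm_of_nonneg (inv_pos.2 hc0).le, enorm_neg]
    gcongr
    refine (enorm_integral_le_lintegral_enorm _).trans
      (setLIntegral_mono' measurableSet_Ioi fun t ht => ?_)
    have ht : 0 < t := ht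
    rw [enorm_smul, Real.enorm_of_nonneg (Real.rpow_nonneg ht.le _)]
    simp only [k, mul_assoc]
    rw [lintegral_const_mul' _ _ ENNReal.ofReal_ne_top]
    gcongr
    refine (enorm_heatOp_le ht f x).trans (lintegral_mono fun y => ?_)
    by_cases hy : d ≤ ‖y‖
    · rw [Set.indicator_of_mem (show y ∈ {z : 𝔼 N | d ≤ ‖z‖} from hy)]
    · have : f (x - y) = 0 := by
        by_contra hne
        have := hdist x hx (x - y) (subset_tsupport f hne)
        rw [sub_sub_cancel] at this
        exact hy this
      rw [this]
      simp
  have hΓ : ∫⁻ t in Set.Ioi (0 : ℝ), ∫⁻ y, k t y ≤ ENNReal.ofReal (D * Real.Gamma (1 - s)) := by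
    rw [Real.Gamma_eq_integral (by linarith), ENNReal.ofReal_mul hD0,
      ofReal_integral_eq_lintegral_ofReal (Real.GammaIntegral_convergent (by linarith))
        (by
          filter_upwards [self_mem_ae_restrict measurableSet_Ioi] with t ht
          exact mul_nonneg (Real.exp_pos _).le (Real.rpow_nonneg (le_of_lt ht) _)),
      ← lintegral_const_mul' _ _ ENNReal.ofReal_ne_top]
    refine setLIntegral_mono' measurableSet_Ioi fun t ht => ?_
    have ht : 0 < t := ht
    simp only [k]
    rw [lintegral_const_mul' _ _ ENNReal.ofReal_ne_top, lintegral_indicator hms]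
    calc _ ≤ ENNReal.ofReal (t ^ (-s - 1)) * ENNReal.ofReal (D * (t * Real.exp (-t))) := by
          gcongr
          exact lintegral_heatKernel_compl_ball ht hd
      _ = _ := by
          rw [← ENNReal.ofReal_mul (Real.rpow_nonneg ht.le _), ← ENNReal.ofReal_mul hD0]
          congr 1
          have : t ^ (-s - 1) * t = t ^ (1 - s - 1) := by
            rw [← Real.rpow_add_one ht.ne']
            congr 1
            ring
          rw [← this]
          ring
  calc ∫⁻ x in V, ‖besselPow s f x‖ₑ
      ≤ ∫⁻ x in V, ENNReal.ofReal c⁻¹ * ∫⁻ t in Set.Ioi (0 : ℝ), ∫⁻ y, k t y * ‖f (x - y)‖ₑ :=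
        setLIntegral_mono' hV hpt
    _ ≤ ∫⁻ x, ENNReal.ofReal c⁻¹ * ∫⁻ t in Set.Ioi (0 : ℝ), ∫⁻ y, k t y * ‖f (x - y)‖ₑ :=
        setLIntegral_le_lintegral _ _
    _ = ENNReal.ofReal c⁻¹ * ((∫⁻ t in Set.Ioi (0 : ℝ), ∫⁻ y, k t y) * ∫⁻ x, ‖f x‖ₑ) := by
        rw [lintegral_const_mul' _ _ ENNReal.ofReal_ne_top,
          lintegral_lintegral_lintegral_mul_enorm_sub hk hf.continuous]
    _ ≤ ENNReal.ofReal c⁻¹ * (ENNReal.ofReal (D * Real.Gamma (1 - s)) * ∫⁻ x, ‖f x‖ₑ) := by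
        gcongr
    _ = _ := by
        rw [← mul_assoc, ← ENNReal.ofReal_mul (inv_pos.2 hc0).le]
        rfl

/-- Apply Γ(s) λ^(-s) = ∫ t^(s-1) e^{-tλ} dt to (1 - Δ)^s f: the inverse power recovers `f` as a
superposition of heat flows of an L¹ function. -/
theorem smul_eq_integral_heatOp_besselPow {s : ℝ} (hs : 0 < s) (hs1 : s < 1) {f : (𝔼 N) → E}
    (hf : ContDiff ℝ ∞ f) (hfc : HasCompactSupport f) (hF : Integrable (besselPow s f))
    (x : 𝔼 N) :
    IntegrableOn (fun t : ℝ => t ^ (s - 1) • heatOp t (besselPow s f) x) (Set.Ioi 0) ∧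
      ∫ t in Set.Ioi (0 : ℝ), t ^ (s - 1) • heatOp t (besselPow s f) x = Real.Gamma s • f x := by
  have hG := integrable_fourier_of_smooth hf hfc
  have hGs := integrable_rpow_smul_fourier hf hfc hs1.le
  have hcancel : (fun ξ => (Real.Gamma s * besselSymbol ξ ^ (-s)) •
      besselSymbol ξ ^ s • 𝓕 f ξ) = fun ξ => Real.Gamma s • 𝓕 f ξ := by
    ext1 ξ
    rw [smul_smul, mul_assoc, ← Real.rpow_add (besselSymbol_pos ξ), neg_add_cancel,
      Real.rpow_zero, mul_one]
  obtain ⟨hi, h⟩ := integral_fourierInv_smul (G := fun ξ => besselSymbol ξ ^ s • 𝓕 f ξ)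
    (k := fun t ξ => t ^ (s - 1) * Real.exp (-(t * besselSymbol ξ)))
    (m := fun ξ => Real.Gamma s * besselSymbol ξ ^ (-s))
    (by
      have := (continuous_besselSymbol (N := N)).measurable
      fun_prop)
    (fun t ht ξ => mul_nonneg (Real.rpow_nonneg ht.le _) (Real.exp_pos _).le)
    (fun ξ => integrableOn_rpow_mul_exp_neg_mul hs (besselSymbol_pos ξ))
    (fun ξ => integral_rpow_mul_exp_neg_mul hs (besselSymbol_pos ξ))
    hGs.aestronglyMeasurable
    (by
      rw [hcancel]
      exact hG.smul _) x
  have key : ∀ t ∈ Set.Ioi (0 : ℝ), 𝓕⁻ (fun ξ => (t ^ (s - 1) *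
      Real.exp (-(t * besselSymbol ξ))) • besselSymbol ξ ^ s • 𝓕 f ξ) x =
      t ^ (s - 1) • heatOp t (besselPow s f) x := by
    intro t ht
    have ht : 0 < t := ht
    rw [heatOp_eq_fourierInv ht hF, fourier_besselPow hf hfc hs1.le hF]
    simp only [mul_smul]
    rw [fourierInv_const_smul]
  refine ⟨hi.congr_fun key measurableSet_Ioi, ?_⟩
  rw [← setIntegral_congr_fun measurableSet_Ioi key, h, hcancel,
    fourierInv_const_smul, fourierInv_fourier_of_smooth hf hfc]

end BesselEstimates

/-! ### L¹-compactness from a bound on (1 - Δ)^s f -/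

section BesselCompactness

variable {N : ℕ} {E : Type*} [NormedAddCommGroup E] [NormedSpace ℂ E]

theorem integrable_heatKernel_smul {t δ : ℝ} (hδ : 0 < δ) (ht : δ ≤ t) {F : (𝔼 N) → E}
    (hF : Integrable F) (x : 𝔼 N) : Integrable fun y => heatKernel t (x - y) • F y := by
  refine (hF.norm.const_mul (Real.exp (-t) * ((4 * Real.pi * δ)⁻¹) ^ ((N : ℝ) / 2))).mono' ?_
    (.of_forall fun y => ?_)
  · exact ((continuous_heatKernel t).comp (by fun_prop)).aestronglyMeasurable.smul
      hF.aestronglyMeasurable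
  · rw [norm_smul, Real.norm_of_nonneg (heatKernel_nonneg (hδ.trans_le ht) _)]
    gcongr
    exact heatKernel_le hδ ht _

theorem norm_heatOp_le {t δ : ℝ} (hδ : 0 < δ) (ht : δ ≤ t) {F : (𝔼 N) → E} (hF : Integrable F)
    (x : 𝔼 N) : ‖heatOp t F x‖ ≤
      Real.exp (-t) * (((4 * Real.pi * δ)⁻¹) ^ ((N : ℝ) / 2) * ∫ y, ‖F y‖) := by
  rw [heatOp_eq_swap, ← mul_assoc, ← integral_const_mul]
  refine norm_integral_le_of_norm_le (hF.norm.const_mul _) (.of_forall fun y => ?_)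
  rw [norm_smul, Real.norm_of_nonneg (heatKernel_nonneg (hδ.trans_le ht) _)]
  gcongr
  exact heatKernel_le hδ ht _

theorem norm_heatOp_sub_le {t δ : ℝ} (hδ : 0 < δ) (ht : δ ≤ t) {F : (𝔼 N) → E}
    (hF : Integrable F) (x x' : 𝔼 N) : ‖heatOp t F x - heatOp t F x'‖ ≤
      Real.exp (-t) * (((4 * Real.pi * δ)⁻¹) ^ ((N : ℝ) / 2) / √δ * (∫ y, ‖F y‖) * ‖x - x'‖) := by
  rw [heatOp_eq_swap, heatOp_eq_swap, ← integral_sub (integrable_heatKernel_smul hδ ht hF x)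
    (integrable_heatKernel_smul hδ ht hF x')]
  have : Real.exp (-t) * (((4 * Real.pi * δ)⁻¹) ^ ((N : ℝ) / 2) / √δ * (∫ y, ‖F y‖) * ‖x - x'‖) =
      ∫ y, (Real.exp (-t) * (((4 * Real.pi * δ)⁻¹) ^ ((N : ℝ) / 2) / √δ) * ‖x - x'‖) * ‖F y‖ := by
    rw [integral_const_mul]
    ring
  rw [this]
  refine norm_integral_le_of_norm_le (hF.norm.const_mul _) (.of_forall fun y => ?_)
  rw [← sub_smul, norm_smul]
  gcongr
  have := abs_heatKernel_sub_le hδ ht (x - y) (x' - y)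
  rwa [sub_sub_sub_cancel_right] at this

/-- The integral of t^(s-1) e^{-t} over (δ, ∞) is at most Γ(s), which the normalisation cancels. -/
theorem norm_integral_rpow_smul_le {s δ M : ℝ} (hs : 0 < s) (hδ : 0 < δ) (hM : 0 ≤ M)
    {w : ℝ → E} (hw : ∀ t, δ ≤ t → ‖w t‖ ≤ Real.exp (-t) * M) :
    ‖(Real.Gamma s)⁻¹ • ∫ t in Set.Ioi δ, t ^ (s - 1) • w t‖ ≤ M := by
  have hΓ := Real.Gamma_pos_of_pos hs
  have hi := Real.GammaIntegral_convergent hs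
  have hsub : Set.Ioi δ ⊆ Set.Ioi (0 : ℝ) := Set.Ioi_subset_Ioi hδ.le
  rw [norm_smul, Real.norm_of_nonneg (inv_pos.2 hΓ).le, inv_mul_le_iff₀ hΓ]
  calc ‖∫ t in Set.Ioi δ, t ^ (s - 1) • w t‖
      ≤ ∫ t in Set.Ioi δ, Real.exp (-t) * t ^ (s - 1) * M := by
        refine norm_integral_le_of_norm_le ((hi.mono_set hsub).mul_const M) ?_
        filter_upwards [self_mem_ae_restrict measurableSet_Ioi] with t ht
        have ht0 : 0 < t := hsub ht
        rw [norm_smul, Real.norm_of_nonneg (Real.rpow_nonneg ht0.le _)]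
        calc t ^ (s - 1) * ‖w t‖ ≤ t ^ (s - 1) * (Real.exp (-t) * M) := by
              gcongr
              exact hw t (le_of_lt ht)
          _ = _ := by ring
    _ ≤ ∫ t in Set.Ioi (0 : ℝ), Real.exp (-t) * t ^ (s - 1) * M := by
        refine setIntegral_mono_set (hi.mul_const M) ?_ (LE.le.eventuallyLE hsub)
        filter_upwards [self_mem_ae_restrict measurableSet_Ioi] with t ht
        exact mul_nonneg (mul_nonneg (Real.exp_pos _).le (Real.rpow_nonneg (le_of_lt ht) _)) hM
    _ = Real.Gamma s * M := by rw [integral_mul_const, ← Real.Gamma_eq_integral hs]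

theorem lintegral_Ioc_rpow {s δ : ℝ} (hs : 0 < s) (hδ : 0 < δ) :
    ∫⁻ t in Set.Ioc 0 δ, ENNReal.ofReal (t ^ (s - 1)) = ENNReal.ofReal (δ ^ s / s) := by
  have hi : IntegrableOn (fun t : ℝ => t ^ (s - 1)) (Set.Ioc 0 δ) :=
    (intervalIntegrable_iff_integrableOn_Ioc_of_le hδ.le).1
      (intervalIntegral.intervalIntegrable_rpow' (by linarith))
  rw [← ofReal_integral_eq_lintegral_ofReal hi
    (by filter_upwards [self_mem_ae_restrict measurableSet_Ioc] with t ht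
        exact Real.rpow_nonneg ht.1.le _),
    ← intervalIntegral.integral_of_le hδ.le, integral_rpow (Or.inl (by linarith))]
  congr 1
  rw [sub_add_cancel, Real.zero_rpow hs.ne', sub_zero]

/-- Functions with `(1 - Δ) ^ s f` in `L¹` are close in `L¹` to bounded Lipschitz functions. -/
theorem exists_lipschitz_approx [CompleteSpace E] {s δ : ℝ} (hs : 0 < s) (hs1 : s < 1)
    (hδ : 0 < δ) :
    ∃ M : ℝ, 0 ≤ M ∧ ∀ {f : (𝔼 N) → E}, ContDiff ℝ ∞ f → HasCompactSupport f →
      Integrable (besselPow s f) → ∃ h : (𝔼 N) → E,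
        (∀ x, ‖h x‖ ≤ M * ∫ y, ‖besselPow s f y‖) ∧
        (∀ x x', ‖h x - h x'‖ ≤ M * (∫ y, ‖besselPow s f y‖) * ‖x - x'‖) ∧
        ∫⁻ x, ‖f x - h x‖ₑ ≤ ENNReal.ofReal ((Real.Gamma s)⁻¹ * (δ ^ s / s)) *
          ∫⁻ x, ‖besselPow s f x‖ₑ := by
  have hΓ := Real.Gamma_pos_of_pos hs
  set c : ℝ := ((4 * Real.pi * δ)⁻¹) ^ ((N : ℝ) / 2) with hc
  have hc0 : 0 ≤ c := by positivity
  refine ⟨max c (c / √δ), le_max_of_le_left hc0, ?_⟩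
  intro f hf hfc hF
  set F := besselPow s f with hFdef
  have hF0 : 0 ≤ ∫ y, ‖F y‖ := integral_nonneg fun _ => norm_nonneg _
  have hrep := fun x => smul_eq_integral_heatOp_besselPow hs hs1 hf hfc hF x
  have hsub : Set.Ioi δ ⊆ Set.Ioi (0 : ℝ) := Set.Ioi_subset_Ioi hδ.le
  -- Keep only the times t > δ, for which the heat flow has already smoothed F over a definite time.
  refine ⟨fun x => (Real.Gamma s)⁻¹ • ∫ t in Set.Ioi δ, t ^ (s - 1) • heatOp t F x, ?_, ?_, ?_⟩
  · intro x
    refine (norm_integral_rpow_smul_le hs hδ (mul_nonneg hc0 hF0)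
      fun t ht => norm_heatOp_le hδ ht hF x).trans ?_
    gcongr
    exact le_max_left _ _
  · intro x x'
    rw [← smul_sub, ← integral_sub ((hrep x).1.mono_set hsub) ((hrep x').1.mono_set hsub)]
    simp only [← smul_sub]
    refine (norm_integral_rpow_smul_le hs hδ (by positivity)
      fun t ht => norm_heatOp_sub_le hδ ht hF x x').trans ?_
    gcongr
    exact le_max_right _ _
  -- The discarded times contribute at most Γ(s)⁻¹ ∫₀^δ t^(s-1) dt times the L¹ norm of F, because
  -- the heat flow contracts L¹.
  · have hpt : ∀ x, ‖f x - (Real.Gamma s)⁻¹ • ∫ t in Set.Ioi δ, t ^ (s - 1) • heatOp t F x‖ₑ ≤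
        ENNReal.ofReal (Real.Gamma s)⁻¹ * ∫⁻ t in Set.Ioc 0 δ,
          ∫⁻ y, (ENNReal.ofReal (t ^ (s - 1)) * ENNReal.ofReal (heatKernel t y)) *
            ‖F (x - y)‖ₑ := by
      intro x
      obtain ⟨hi, he⟩ := hrep x
      have hfx : f x = (Real.Gamma s)⁻¹ • ∫ t in Set.Ioi (0 : ℝ), t ^ (s - 1) • heatOp t F x := by
        rw [he, smul_smul, inv_mul_cancel₀ hΓ.ne', one_smul]
      rw [hfx, ← smul_sub, ← Set.Ioc_union_Ioi_eq_Ioi hδ.le,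
        setIntegral_union Set.Ioc_disjoint_Ioi_same measurableSet_Ioi
          (hi.mono_set Set.Ioc_subset_Ioi_self) (hi.mono_set hsub), add_sub_cancel_right,
        enorm_smul, Real.enorm_of_nonneg (inv_pos.2 hΓ).le]
      gcongr
      refine (enorm_integral_le_lintegral_enorm _).trans
        (setLIntegral_mono' measurableSet_Ioc fun t ht => ?_)
      rw [enorm_smul, Real.enorm_of_nonneg (Real.rpow_nonneg ht.1.le _)]
      simp only [mul_assoc]
      rw [lintegral_const_mul' _ _ ENNReal.ofReal_ne_top]
      gcongr
      exact enorm_heatOp_le ht.1 F x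
    have hk : Measurable fun p : ℝ × (𝔼 N) =>
        ENNReal.ofReal (p.1 ^ (s - 1)) * ENNReal.ofReal (heatKernel p.1 p.2) :=
      Measurable.mul (by fun_prop) measurable_heatKernel.ennreal_ofReal
    refine (lintegral_mono hpt).trans ?_
    rw [lintegral_const_mul' _ _ ENNReal.ofReal_ne_top,
      lintegral_lintegral_lintegral_mul_enorm_sub
        (k := fun t y => ENNReal.ofReal (t ^ (s - 1)) * ENNReal.ofReal (heatKernel t y)) hk
        (continuous_besselPow hf hfc hs1.le),
      ENNReal.ofReal_mul (inv_pos.2 hΓ).le, mul_assoc, ← lintegral_Ioc_rpow hs hδ]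
    gcongr _ * (?_ * _)
    refine setLIntegral_mono' measurableSet_Ioc fun t ht => ?_
    rw [lintegral_const_mul' _ _ ENNReal.ofReal_ne_top, lintegral_heatKernel ht.1]
    refine mul_le_of_le_one_right' ?_
    rw [ENNReal.ofReal_le_one, Real.exp_le_one_iff]
    linarith [ht.1]

/-- A family supported in a compact set that is uniformly approximable in `L¹` by uniformly
bounded, equi-Lipschitz functions has finite `L¹`-nets. -/
theorem exists_finite_net_of_lipschitz_approx [FiniteDimensional ℂ E] {ι : Type*}
    {K : Set (𝔼 N)} (hK : IsCompact K) {f : ι → (𝔼 N) → E} (hf : ∀ i, Continuous (f i))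
    (hfK : ∀ i, ∀ x ∉ K, f i x = 0)
    (happ : ∀ η : ℝ≥0∞, η ≠ 0 → ∃ M : ℝ, ∀ i, ∃ h : (𝔼 N) → E, (∀ x, ‖h x‖ ≤ M) ∧
      (∀ x x', ‖h x - h x'‖ ≤ M * ‖x - x'‖) ∧ ∫⁻ x, ‖f i x - h x‖ₑ ≤ η)
    {η : ℝ≥0∞} (hη : η ≠ 0) :
    ∃ t : Set ι, t.Finite ∧ ∀ i, ∃ j ∈ t, ∫⁻ x, ‖f i x - f j x‖ₑ ≤ η := by
  have : ProperSpace E := FiniteDimensional.proper ℂ E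
  have : CompactSpace K := isCompact_iff_compactSpace.1 hK
  rcases isEmpty_or_nonempty ι with hι | hι
  · exact ⟨∅, Set.finite_empty, fun i => hι.elim i⟩
  have hη3 : η / 3 ≠ 0 := (ENNReal.div_pos hη (by norm_num)).ne'
  obtain ⟨M, hM⟩ := happ (η / 3) hη3
  choose h hb hl happ' using hM
  have hM0 : 0 ≤ M := (norm_nonneg _).trans (hb hι.some 0)
  have hlip : ∀ i, LipschitzWith M.toNNReal (h i) := fun i =>
    LipschitzWith.of_dist_le_mul fun x x' => by
      rw [dist_eq_norm, dist_eq_norm, Real.coe_toNNReal M hM0]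
      exact hl i x x'
  let H : ι → BoundedContinuousFunction K E := fun i =>
    BoundedContinuousFunction.mkOfCompact ⟨fun x => h i x, (hlip i).continuous.comp
      continuous_subtype_val⟩
  -- Arzelà–Ascoli on `K`: the values lie in a compact ball of the finite-dimensional `E`, and the
  -- Lipschitz constant is common.
  have hcomp : IsCompact (closure (Set.range H)) := by
    refine BoundedContinuousFunction.arzela_ascoli (Metric.closedBall 0 M)
      (isCompact_closedBall 0 M) _ ?_ ?_
    · rintro _ x ⟨i, rfl⟩
      rw [mem_closedBall_zero_iff]
      exact hb i x
    · refine LipschitzWith.uniformEquicontinuous _ M.toNNReal ?_ |>.equicontinuous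
      rintro ⟨_, i, rfl⟩
      exact (hlip i).comp (LipschitzWith.subtype_val K) |>.weaken (by simp)
  have hvol : volume K < ⊤ := hK.measure_lt_top
  obtain ⟨ε, hε0, hε⟩ : ∃ ε : ℝ≥0, 0 < ε ∧ (ε : ℝ≥0∞) * volume K ≤ η / 3 := by
    rcases eq_or_ne (η / 3) ⊤ with h3 | h3
    · exact ⟨1, one_pos, by rw [h3]; exact le_top⟩
    obtain ⟨ε, hε0, hε⟩ := ENNReal.exists_nnreal_pos_mul_lt hvol.ne hη3
    exact ⟨ε, hε0, hε.le⟩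
  obtain ⟨t, htH, htf, ht⟩ := totallyBounded_iff_subset.1
    (hcomp.totallyBounded.subset subset_closure) _ (Metric.dist_mem_uniformity
      (show (0 : ℝ) < ε from hε0))
  have htH' : ∀ b ∈ t, ∃ j, H j = b := htH
  choose! j hj using htH'
  refine ⟨j '' t, htf.image _, fun i => ?_⟩
  obtain ⟨b, hbt, hib⟩ := Set.mem_iUnion₂.1 (ht (Set.mem_range_self i))
  refine ⟨j b, Set.mem_image_of_mem _ hbt, ?_⟩
  have hHj : H (j b) = b := hj b hbt
  have hdist : ∀ x ∈ K, ‖h i x - h (j b) x‖ₑ ≤ ε := by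
    intro x hx
    have h1 : dist (H i) (H (j b)) < ε := by rw [hHj]; exact hib
    have h2 := (BoundedContinuousFunction.dist_coe_le_dist (f := H i) (g := H (j b)) ⟨x, hx⟩).trans
      h1.le
    rw [dist_eq_norm] at h2
    rw [← ofReal_norm, ← ENNReal.ofReal_coe_nnreal]
    exact ENNReal.ofReal_le_ofReal h2
  have hmi : ∀ i, AEMeasurable (fun x => ‖f i x - h i x‖ₑ) := fun i =>
    ((hf i).sub (hlip i).continuous).enorm.aemeasurable
  calc ∫⁻ x, ‖f i x - f (j b) x‖ₑ = ∫⁻ x in K, ‖f i x - f (j b) x‖ₑ := by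
        refine (setLIntegral_eq_of_support_subset fun x hx => ?_).symm
        by_contra hxK
        simp [hfK _ x hxK] at hx
    _ ≤ ∫⁻ x in K, (‖f i x - h i x‖ₑ + ‖f (j b) x - h (j b) x‖ₑ + ε) := by
        refine setLIntegral_mono' hK.measurableSet fun x hx => ?_
        calc ‖f i x - f (j b) x‖ₑ = ‖(f i x - h i x) + -(f (j b) x - h (j b) x) +
              (h i x - h (j b) x)‖ₑ := by congr 1; abel
          _ ≤ ‖f i x - h i x‖ₑ + ‖-(f (j b) x - h (j b) x)‖ₑ + ‖h i x - h (j b) x‖ₑ :=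
              (enorm_add_le _ _).trans (by gcongr; exact enorm_add_le _ _)
          _ ≤ _ := by
              rw [enorm_neg]
              gcongr
              exact hdist x hx
    _ ≤ η / 3 + η / 3 + η / 3 := by
        rw [lintegral_add_right _ measurable_const, lintegral_add_left' (hmi i).restrict,
          setLIntegral_const]
        gcongr
        · exact (setLIntegral_le_lintegral _ _).trans (happ' i)
        · exact (setLIntegral_le_lintegral _ _).trans (happ' (j b))
    _ = η := ENNReal.add_thirds η

/-- The compactness theorem: a family of smooth functions supported in a compact set `K`
with `f` and `(1 - Δ) ^ s f` bounded in `L¹`, the latter only near `K`, is totally bounded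
in `L¹`. -/
theorem exists_finite_net_of_besselPow_bound [FiniteDimensional ℂ E] {ι : Type*} {s : ℝ}
    (hs : 0 < s) (hs1 : s < 1) {U : Opens (𝔼 N)} {K : Set (𝔼 N)} (hK : IsCompact K)
    (hKU : K ⊆ U) {f : ι → (𝔼 N) → E} (hf : ∀ i, ContDiff ℝ ∞ (f i))
    (hfK : ∀ i, tsupport (f i) ⊆ K) {B : ℝ≥0∞} (hB : B ≠ ⊤) (hfB : ∀ i, ∫⁻ x, ‖f i x‖ₑ ≤ B)
    (hFB : ∀ i, ∫⁻ x in U, ‖besselPow s (f i) x‖ₑ ≤ B) {η : ℝ≥0∞} (hη : η ≠ 0) :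
    ∃ t : Set ι, t.Finite ∧ ∀ i, ∃ j ∈ t, ∫⁻ x, ‖f i x - f j x‖ₑ ≤ η := by
  have : CompleteSpace E := FiniteDimensional.complete ℂ E
  have hfc : ∀ i, HasCompactSupport (f i) := fun i =>
    hK.of_isClosed_subset (isClosed_tsupport _) (hfK i)
  obtain ⟨d, hd, hdU⟩ := hK.exists_thickening_subset_open U.isOpen hKU
  obtain ⟨C, hC⟩ := lintegral_compl_enorm_besselPow_le (N := N) (E := E) hs hs1 hd
  -- Split at `U`: inside, the hypothesis applies; outside, every point has distance at least d from
  -- `K`.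
  have hbound : ∀ i, ∫⁻ x, ‖besselPow s (f i) x‖ₑ ≤ B + C * B := by
    intro i
    rw [← lintegral_add_compl _ U.isOpen.measurableSet]
    refine add_le_add (hFB i) ((hC (hf i) (hfc i) U.isOpen.measurableSet.compl ?_).trans
      (by gcongr; exact hfB i))
    intro x hx y hy
    by_contra hlt
    refine hx (hdU (Metric.mem_thickening_iff.2 ⟨y, hfK i hy, ?_⟩))
    rw [dist_eq_norm]
    exact not_le.1 hlt
  set B' : ℝ≥0∞ := B + C * B with hB'def
  have hB' : B' ≠ ⊤ := ENNReal.add_ne_top.2 ⟨hB, ENNReal.mul_ne_top ENNReal.coe_ne_top hB⟩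
  have hFi : ∀ i, Integrable (besselPow s (f i)) := fun i =>
    ⟨(continuous_besselPow (hf i) (hfc i) hs1.le).aestronglyMeasurable,
      (hbound i).trans_lt hB'.lt_top⟩
  have hFn : ∀ i, ∫ x, ‖besselPow s (f i) x‖ ≤ B'.toReal := fun i => by
    rw [integral_norm_eq_lintegral_enorm (hFi i).aestronglyMeasurable]
    exact ENNReal.toReal_mono hB' (hbound i)
  refine exists_finite_net_of_lipschitz_approx hK (fun i => (hf i).continuous)
    (fun i x hx => image_eq_zero_of_notMem_tsupport fun h => hx (hfK i h)) ?_ hη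
  intro η hη
  have hΓ := Real.Gamma_pos_of_pos hs
  have hlim : Tendsto (fun δ : ℝ => ENNReal.ofReal ((Real.Gamma s)⁻¹ * (δ ^ s / s)) * B')
      (𝓝[>] 0) (𝓝 0) := by
    have h1 : Tendsto (fun δ : ℝ => (Real.Gamma s)⁻¹ * (δ ^ s / s)) (𝓝[>] 0) (𝓝 0) := by
      have h2 := (Real.continuousAt_rpow_const 0 s (Or.inr hs.le)).tendsto
      rw [Real.zero_rpow hs.ne'] at h2
      simpa using ((h2.div_const s).const_mul (Real.Gamma s)⁻¹).mono_left nhdsWithin_le_nhds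
    have h3 := ENNReal.Tendsto.mul_const (ENNReal.tendsto_ofReal h1) (Or.inr hB')
    simpa using h3
  obtain ⟨δ, hδη, hδ⟩ := ((hlim.eventually_le_const (pos_iff_ne_zero.2 hη)).and
    self_mem_nhdsWithin).exists
  obtain ⟨M, hM0, hM⟩ := exists_lipschitz_approx (N := N) (E := E) hs hs1 hδ
  refine ⟨M * B'.toReal, fun i => ?_⟩
  obtain ⟨h, hb, hl, ha⟩ := hM (hf i) (hfc i) (hFi i)
  refine ⟨h, fun x => (hb x).trans (by gcongr; exact hFn i), fun x x' =>
    (hl x x').trans (by gcongr; exact hFn i), ha.trans (le_trans ?_ hδη)⟩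
  gcongr
  exact hbound i

end BesselCompactness

section Limits

variable {N ν : ℕ} {Ω U : Opens (𝔼 N)} {E F : Type*} [NormedAddCommGroup E] [NormedSpace ℂ E]
  [NormedAddCommGroup F] [NormedSpace ℂ F]

/-! ### Compactness of sequences -/

/-- Finitely many sequences with finite `L¹`-nets have a common convergent subsequence. -/
theorem exists_subseq_tendsto_of_finite_nets {X G ι : Type*} [MeasurableSpace X] {μ : Measure X}
    [NormedAddCommGroup G] [CompleteSpace G] [Finite ι] {f : ι → ℕ → X → G}
    (hf : ∀ a i, Integrable (f a i) μ)
    (hnet : ∀ a, ∀ η : ℝ≥0∞, η ≠ 0 → ∃ t : Set ℕ, t.Finite ∧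
      ∀ i, ∃ j ∈ t, ∫⁻ x, ‖f a i x - f a j x‖ₑ ∂μ ≤ η) :
    ∃ s : ℕ → ℕ, StrictMono s ∧ ∃ h : ι → X → G, ∀ a, Integrable (h a) μ ∧
      Tendsto (fun k => ∫⁻ x, ‖f a (s k) x - h a x‖ₑ ∂μ) atTop (𝓝 0) := by
  have := Fintype.ofFinite ι
  let T : ℕ → ι → Lp G 1 μ := fun i a => (hf a i).toL1 (f a i)
  have hc : ∀ a, IsCompact (closure (Set.range fun i => T i a)) := by
    intro a
    refine TotallyBounded.isCompact_of_isClosed (TotallyBounded.closure ?_) isClosed_closure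
    rw [EMetric.totallyBounded_iff]
    intro ε hε
    obtain ⟨t, htf, ht⟩ := hnet a (ε / 2) (ENNReal.half_pos hε.ne').ne'
    -- Half of ⊤ is not below ⊤, but at infinite radius one point is already a net.
    rcases eq_or_ne ε ⊤ with rfl | hε'
    · exact ⟨{0}, Set.finite_singleton _, fun x _ => by simp⟩
    refine ⟨(fun i => T i a) '' t, htf.image _, ?_⟩
    rintro _ ⟨i, rfl⟩
    obtain ⟨j, hj, hij⟩ := ht i
    refine Set.mem_iUnion₂.2 ⟨_, Set.mem_image_of_mem _ hj, ?_⟩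
    rw [Metric.mem_eball]
    simp only [T]
    rw [Integrable.edist_toL1_toL1]
    simp only [edist_eq_enorm_sub]
    exact hij.trans_lt (ENNReal.half_lt_self hε.ne' hε')
  -- Compactness of the finite product yields one subsequence for all indices.
  obtain ⟨H, -, s, hs, hT⟩ := (isCompact_univ_pi hc).tendsto_subseq
    (x := T) fun i a _ => subset_closure (Set.mem_range_self i)
  refine ⟨s, hs, fun a => H a, fun a => ⟨L1.integrable_coeFn _, ?_⟩⟩
  have h1 := (tendsto_iff_edist_tendsto_0.1 ((tendsto_pi_nhds.1 hT) a))
  refine h1.congr fun k => ?_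
  have h2 : H a = (L1.integrable_coeFn (H a)).toL1 (H a) := (Integrable.toL1_coeFn _ _).symm
  simp only [Function.comp_apply, T]
  rw [h2, Integrable.edist_toL1_toL1]
  simp only [edist_eq_enorm_sub, ← h2]

/-- Hölder on `K`; it turns the Sobolev bound in L^{N/(N-1)} into an L¹ bound. -/
theorem lintegral_enorm_le_eLpNorm_mul {G : Type*} [NormedAddCommGroup G] {K : Set (𝔼 N)}
    {p : ℝ≥0∞} (hp : 1 ≤ p) {w : (𝔼 N) → G} (hw : Continuous w)
    (hwK : tsupport w ⊆ K) :
    ∫⁻ x, ‖w x‖ₑ ≤ eLpNorm w p volume * volume K ^ (1 - 1 / p.toReal) := by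
  have hsub : Function.support (fun x => ‖w x‖ₑ) ⊆ K := fun x hx =>
    hwK (subset_tsupport w fun h => hx (by simp [h]))
  have h := eLpNorm_le_eLpNorm_mul_rpow_measure_univ hp
    (hw.aestronglyMeasurable (μ := volume.restrict K))
  rw [eLpNorm_one_eq_lintegral_enorm, setLIntegral_eq_of_support_subset hsub,
    Measure.restrict_apply_univ, ENNReal.toReal_one, div_one] at h
  refine h.trans ?_
  gcongr
  exact Measure.restrict_le_self

/-! ### Weak derivatives and variation of limits -/

theorem IsWeakDeriv.sub {α : Fin N → ℕ} {g g' h h' : (𝔼 N) → E} (hg : IsWeakDeriv U α g h)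
    (hg' : IsWeakDeriv U α g' h') :
    IsWeakDeriv U α (fun x => g x - g' x) (fun x => h x - h' x) := by
  refine ⟨hg.1.sub hg'.1, hg.2.1.sub hg'.2.1, fun φ => ?_⟩
  have hi : ∀ {φ : (𝔼 N) → ℂ} {g : (𝔼 N) → E}, Continuous φ → HasCompactSupport φ →
      tsupport φ ⊆ U → LocallyIntegrableOn g U → IntegrableOn (fun x => φ x • g x) U := by
    intro φ g hφ hφc hφU hg
    have h1 : IntegrableOn g (tsupport φ) := hg.integrableOn_compact_subset hφU hφc
    have h2 := integrable_bilin (ContinuousLinearMap.lsmul ℝ ℂ : ℂ →L[ℝ] E →L[ℝ] E) hφ hφc h1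
    refine IntegrableOn.mono_set ?_ (Set.subset_univ _)
    rw [integrableOn_univ]
    refine (integrableOn_iff_integrable_of_support_subset (s := tsupport φ) ?_).1 h2
    intro x hx
    refine subset_tsupport φ fun h => hx ?_
    simp [h]
  have hφ' := contDiff_multiDeriv φ.contDiff α
  have hts := tsupport_multiDeriv_subset (φ : (𝔼 N) → ℂ) α
  have hφc' : HasCompactSupport (multiDeriv α φ) :=
    φ.hasCompactSupport.of_isClosed_subset (isClosed_tsupport _) hts
  have hφU' := hts.trans φ.tsupport_subset
  simp only [smul_sub]
  rw [integral_sub (hi hφ'.continuous hφc' hφU' hg.1) (hi hφ'.continuous hφc' hφU' hg'.1),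
    integral_sub (hi φ.continuous φ.hasCompactSupport φ.tsupport_subset hg.2.1)
      (hi φ.continuous φ.hasCompactSupport φ.tsupport_subset hg'.2.1), hg.2.2, hg'.2.2, smul_sub]

theorem tendsto_setLIntegral_of_tendsto {G : Type*} [NormedAddCommGroup G] {S : Set (𝔼 N)}
    {f : ℕ → (𝔼 N) → G} {g : (𝔼 N) → G}
    (h : Tendsto (fun m => ∫⁻ x, ‖f m x - g x‖ₑ) atTop (𝓝 0)) :
    Tendsto (fun m => ∫⁻ x in S, ‖f m x - g x‖ₑ) atTop (𝓝 0) :=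
  tendsto_of_tendsto_of_tendsto_of_le_of_le tendsto_const_nhds h (fun _ => zero_le)
    fun _ => setLIntegral_le_lintegral _ _

/-- `L¹`-limits of the derivatives of smooth functions are weak derivatives of the limit. -/
theorem isWeakDeriv_of_tendsto [CompleteSpace E] {α : Fin N → ℕ} {u : ℕ → (𝔼 N) → E}
    {g h : (𝔼 N) → E} (hu : ∀ m, ContDiff ℝ ∞ (u m)) (huc : ∀ m, HasCompactSupport (u m))
    (hg : Integrable g) (hh : Integrable h)
    (hug : Tendsto (fun m => ∫⁻ x, ‖u m x - g x‖ₑ) atTop (𝓝 0))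
    (huh : Tendsto (fun m => ∫⁻ x, ‖multiDeriv α (u m) x - h x‖ₑ) atTop (𝓝 0)) :
    IsWeakDeriv U α g h := by
  refine ⟨hg.locallyIntegrable.locallyIntegrableOn _, hh.locallyIntegrable.locallyIntegrableOn _,
    fun φ => ?_⟩
  let B : ℂ →L[ℝ] E →L[ℝ] E := ContinuousLinearMap.lsmul ℝ ℂ
  have hφ' := contDiff_multiDeriv φ.contDiff α
  have hts := tsupport_multiDeriv_subset (φ : (𝔼 N) → ℂ) α
  have hφc' : HasCompactSupport (multiDeriv α φ) :=
    φ.hasCompactSupport.of_isClosed_subset (isClosed_tsupport _) hts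
  have hui : ∀ m, Integrable (u m) := fun m =>
    (hu m).continuous.integrable_of_hasCompactSupport (huc m)
  have hdi : ∀ m, Integrable (multiDeriv α (u m)) := fun m =>
    (contDiff_multiDeriv (hu m) α).continuous.integrable_of_hasCompactSupport
      ((huc m).of_isClosed_subset (isClosed_tsupport _) (tsupport_multiDeriv_subset _ α))
  have l1 := tendsto_integral_bilin B hφ'.continuous hφc'
    (μ := volume.restrict (U : Set (𝔼 N))) (fun m => (hui m).restrict) hg.restrict
    (tendsto_setLIntegral_of_tendsto hug)
  have l2 := (tendsto_integral_bilin B φ.continuous φ.hasCompactSupport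
    (μ := volume.restrict (U : Set (𝔼 N))) (fun m => (hdi m).restrict) hh.restrict
    (tendsto_setLIntegral_of_tendsto huh)).const_smul ((-1 : ℂ) ^ (∑ i, α i))
  refine tendsto_nhds_unique l1 (l2.congr fun m => ?_)
  have e0 := integral_bilin_multiDeriv B φ.contDiff (hu m) (huc m) α
  rw [setIntegral_eq_integral_of_forall_compl_eq_zero fun x hx => ?_,
    setIntegral_eq_integral_of_forall_compl_eq_zero fun x hx => ?_, e0, ← Complex.coe_smul,
    smul_smul]
  · push_cast
    rw [← mul_pow]
    simp
  · rw [image_eq_zero_of_notMem_tsupport fun h => hx (φ.tsupport_subset (hts h))]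
    simp
  · rw [image_eq_zero_of_notMem_tsupport fun h => hx (φ.tsupport_subset h)]
    simp

/-- Lower semicontinuity of the variation. -/
theorem DiffOp.variation_le_of_tendsto (A : DiffOp Ω ν E F) (hU : U ≤ Ω) {g : ℕ → (𝔼 N) → E}
    {g₀ : (𝔼 N) → E} (hg : ∀ m, IntegrableOn (g m) U) (hg₀ : IntegrableOn g₀ U)
    (h : Tendsto (fun m => ∫⁻ x in U, ‖g m x - g₀ x‖ₑ) atTop (𝓝 0)) {M : ℝ≥0∞}
    (hM : ∀ m, A.variation U (g m) ≤ M) : A.variation U g₀ ≤ M := by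
  refine iSup₂_le fun v hv => ?_
  have hc : Continuous (A.adjoint v) := A.continuous_adjoint v.contDiff
    (v.tsupport_subset.trans hU)
  have hcs : HasCompactSupport (A.adjoint v) := v.hasCompactSupport.of_isClosed_subset
    (isClosed_tsupport _) (A.tsupport_adjoint_subset v)
  have hl := (tendsto_integral_bilin (conjPairing E) hc hcs hg hg₀ h).enorm
  refine le_of_tendsto hl (.of_forall fun m => le_trans ?_ (hM m))
  exact le_iSup₂_of_le (f := fun (v : TestFunction U (ConjDual F) ⊤) (_ : ∀ x, ‖v x‖ ≤ 1) =>
    ‖∫ x in (U : Set (𝔼 N)), conj (A.adjoint v x (g m x))‖ₑ) v hv le_rfl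

theorem ae_eq_zero_of_tendsto {G : Type*} [NormedAddCommGroup G] {K : Set (𝔼 N)}
    (hK : MeasurableSet K) {u : ℕ → (𝔼 N) → G} {g : (𝔼 N) → G} (hg : Integrable g)
    (huK : ∀ m, ∀ x ∉ K, u m x = 0)
    (h : Tendsto (fun m => ∫⁻ x, ‖u m x - g x‖ₑ) atTop (𝓝 0)) : ∀ᵐ x, x ∉ K → g x = 0 := by
  have h1 : ∫⁻ x in Kᶜ, ‖g x‖ₑ = 0 := by
    refine le_antisymm (ge_of_tendsto' h fun m => ?_) zero_le
    refine le_trans (le_of_eq (setLIntegral_congr_fun hK.compl fun x hx => ?_))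
      (setLIntegral_le_lintegral Kᶜ _)
    rw [huK m x hx, zero_sub, enorm_neg]
  rw [lintegral_eq_zero_iff' hg.aestronglyMeasurable.enorm.restrict,
    Filter.EventuallyEq, ae_restrict_iff' hK.compl] at h1
  filter_upwards [h1] with x hx hxK
  simpa using hx hxK

/-- Rellich's theorem for smooth functions with bounded `A u`. -/
theorem DiffOp.exists_subseq_tendsto [FiniteDimensional ℂ E] (hN : 2 ≤ N)
    (A : DiffOp Ω ν E F) (hSGN : A.SupportsSGN U) {β : ℝ} (hβ0 : 0 < β) (hβ1 : β < 1)
    (hfrac : A.SupportsFractional U β) {K : Set (𝔼 N)} (hK : IsCompact K) (hKU : K ⊆ U)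
    {u : ℕ → (𝔼 N) → E} (hu : ∀ i, ContDiff ℝ ∞ (u i)) (huK : ∀ i, tsupport (u i) ⊆ K)
    {B : ℝ≥0∞} (hB : B ≠ ⊤) (huB : ∀ i, ∫⁻ x, ‖A.apply (u i) x‖ₑ ≤ B) :
    ∃ s : ℕ → ℕ, StrictMono s ∧ ∃ (g : (𝔼 N) → E) (h : (Fin N → ℕ) → (𝔼 N) → E),
      Integrable g ∧ Tendsto (fun k => ∫⁻ x, ‖u (s k) x - g x‖ₑ) atTop (𝓝 0) ∧
      ∀ α ∈ multiIndices N (ν - 1), Integrable (h α) ∧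
        Tendsto (fun k => ∫⁻ x, ‖multiDeriv α (u (s k)) x - h α x‖ₑ) atTop (𝓝 0) := by
  have : CompleteSpace E := FiniteDimensional.complete ℂ E
  have huc : ∀ i, HasCompactSupport (u i) := fun i =>
    hK.of_isClosed_subset (isClosed_tsupport _) (huK i)
  have hdK : ∀ α i, tsupport (multiDeriv α (u i)) ⊆ K := fun α i =>
    (tsupport_multiDeriv_subset _ α).trans (huK i)
  have hdc : ∀ α i, HasCompactSupport (multiDeriv α (u i)) := fun α i =>
    hK.of_isClosed_subset (isClosed_tsupport _) (hdK α i)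
  have hd : ∀ α i, ContDiff ℝ ∞ (multiDeriv α (u i)) := fun α i => contDiff_multiDeriv (hu i) α
  obtain ⟨C₁, hC₁⟩ := hSGN
  obtain ⟨ψ, -, hψ, C₂, hC₂⟩ := hfrac
  have happ : ∀ i, eLpNorm (A.apply (u i)) 1 volume ≤ B := fun i => by
    rw [eLpNorm_one_eq_lintegral_enorm]
    exact huB i
  obtain ⟨w, hw⟩ : ∃ w : ℕ → TestFunction U E ⊤, ∀ i, (w i : (𝔼 N) → E) = u i :=
    ⟨fun i => ⟨u i, hu i, huc i, (huK i).trans hKU⟩, fun i => rfl⟩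
  set p : ℝ≥0∞ := ENNReal.ofReal ((N : ℝ) / ((N : ℝ) - 1)) with hpdef
  have hp : 1 ≤ p := by
    have h2 : (2 : ℝ) ≤ N := by exact_mod_cast hN
    rw [hpdef, ENNReal.one_le_ofReal, one_le_div (by linarith)]
    linarith
  have hvol : volume K ^ (1 - 1 / p.toReal) ≠ ⊤ := by
    refine ENNReal.rpow_ne_top_of_nonneg ?_ hK.measure_lt_top.ne
    have : 1 ≤ p.toReal := by
      rw [← ENNReal.toReal_one]
      exact ENNReal.toReal_mono ENNReal.ofReal_ne_top hp
    rw [sub_nonneg, div_le_one (by linarith)]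
    exact this
  set B₁ : ℝ≥0∞ := C₁ * B * volume K ^ (1 - 1 / p.toReal) with hB₁
  set B₂ : ℝ≥0∞ := C₂ * B with hB₂
  have hL1 : ∀ α ∈ multiIndices N (ν - 1), ∀ i, ∫⁻ x, ‖multiDeriv α (u i) x‖ₑ ≤ B₁ := by
    intro α hα i
    refine (lintegral_enorm_le_eLpNorm_mul hp (hd α i).continuous (hdK α i)).trans ?_
    have h := hC₁ (w i)
    rw [hw] at h
    rw [hB₁]
    gcongr
    calc eLpNorm (multiDeriv α (u i)) p volume
        ≤ ∑ α ∈ multiIndices N (ν - 1), eLpNorm (multiDeriv α (u i)) p volume :=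
          Finset.single_le_sum (f := fun α => eLpNorm (multiDeriv α (u i)) p volume)
            (fun _ _ => zero_le) hα
      _ ≤ C₁ * B := h.trans (by gcongr; exact happ i)
  -- The order γ = 1 - β enters the symbol as the exponent γ/2, whence s = (1 - β)/2. On `U` the
  -- factor ψ is 1.
  have hbes : ∀ α ∈ multiIndices N (ν - 1), ∀ i,
      ∫⁻ x in U, ‖besselPow ((1 - β) / 2) (multiDeriv α (u i)) x‖ₑ ≤ B₂ := by
    intro α hα i
    have h := hC₂ (w i)
    rw [hw] at h
    calc ∫⁻ x in U, ‖besselPow ((1 - β) / 2) (multiDeriv α (u i)) x‖ₑ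
        = ∫⁻ x in U, ‖besselOp ψ (1 - β) (multiDeriv α (u i)) x‖ₑ := by
          refine setLIntegral_congr_fun U.isOpen.measurableSet fun x hx => ?_
          rw [besselOp, hψ x hx, one_smul]
          rfl
      _ ≤ ∫⁻ x, ‖besselOp ψ (1 - β) (multiDeriv α (u i)) x‖ₑ := setLIntegral_le_lintegral _ _
      _ = eLpNorm (besselOp ψ (1 - β) (multiDeriv α (u i))) 1 volume :=
          eLpNorm_one_eq_lintegral_enorm.symm
      _ ≤ _ := Finset.single_le_sum
            (f := fun α => eLpNorm (besselOp ψ (1 - β) (multiDeriv α (u i))) 1 volume)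
            (fun _ _ => zero_le) hα
      _ ≤ C₂ * B := h.trans (by gcongr; exact happ i)
  have hnet : ∀ α ∈ multiIndices N (ν - 1), ∀ η : ℝ≥0∞, η ≠ 0 → ∃ t : Set ℕ, t.Finite ∧
      ∀ i, ∃ j ∈ t, ∫⁻ x, ‖multiDeriv α (u i) x - multiDeriv α (u j) x‖ₑ ≤ η := by
    intro α hα η hη
    refine exists_finite_net_of_besselPow_bound (s := (1 - β) / 2) (by linarith) (by linarith) hK
      hKU (hd α) (hdK α) (B := max B₁ B₂) ?_ (fun i => (hL1 α hα i).trans (le_max_left _ _))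
      (fun i => (hbes α hα i).trans (le_max_right _ _)) hη
    refine (max_lt ?_ ?_).ne
    · exact (ENNReal.mul_ne_top (ENNReal.mul_ne_top ENNReal.coe_ne_top hB) hvol).lt_top
    · exact (ENNReal.mul_ne_top ENNReal.coe_ne_top hB).lt_top
  -- A net for the derivative of order ν - 1 in the first direction is one for `u` itself: by
  -- Poincaré's inequality applied to differences, the radius grows at most by the factor `D`.
  have hnet0 : ∀ η : ℝ≥0∞, η ≠ 0 → ∃ t : Set ℕ, t.Finite ∧
      ∀ i, ∃ j ∈ t, ∫⁻ x, ‖u i x - u j x‖ₑ ≤ η := by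
    intro η hη
    obtain ⟨R, hR⟩ := hK.isBounded.subset_closedBall 0
    have hR' : K ⊆ Metric.closedBall 0 (max R 0) :=
      hR.trans (Metric.closedBall_subset_closedBall (le_max_left _ _))
    set j₀ : Fin N := ⟨0, by omega⟩
    set L := List.replicate (ν - 1) j₀ with hL
    have hαm : (fun i => L.count i) ∈ multiIndices N (ν - 1) := by
      have := count_mem_multiIndices L
      rwa [hL, List.length_replicate] at this
    set D : ℝ≥0∞ := ENNReal.ofReal (2 * max R 0 + 1) ^ (ν - 1) with hD
    have hDt : D ≠ ⊤ := ENNReal.pow_ne_top ENNReal.ofReal_ne_top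
    obtain ⟨t, htf, ht⟩ := hnet _ hαm (η / D) (ENNReal.div_ne_zero.2 ⟨hη, hDt⟩)
    refine ⟨t, htf, fun i => ?_⟩
    obtain ⟨j, hj, hij⟩ := ht i
    refine ⟨j, hj, ?_⟩
    have hs : tsupport (u i - u j) ⊆ Metric.closedBall 0 (max R 0) :=
      (tsupport_sub _ _).trans ((Set.union_subset (huK i) (huK j)).trans hR')
    have h := lintegral_enorm_listDeriv_le (f := u i - u j) (le_max_right R 0)
      ((hu i).sub (hu j)) hs j₀ [] (ν - 1)
    rw [List.append_nil, ← hL, listDeriv_sub (hu i) (hu j) L,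
      listDeriv_eq_multiDeriv (hu i) L, listDeriv_eq_multiDeriv (hu j) L] at h
    refine h.trans (le_trans ?_ (ENNReal.mul_div_le (a := D) (b := η)))
    exact mul_le_mul_right hij D
  have : Finite (Option {α // α ∈ multiIndices N (ν - 1)}) := Finite.of_fintype _
  -- The index `none` stands for `u` itself, `some α` for its derivative ∂^α.
  obtain ⟨s, hs, H, hH⟩ := exists_subseq_tendsto_of_finite_nets (μ := volume)
    (ι := Option {α // α ∈ multiIndices N (ν - 1)})
    (f := fun a i => a.elim (u i) fun α => multiDeriv α.1 (u i))
    (fun a i => by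
      cases a with
      | none => exact (hu i).continuous.integrable_of_hasCompactSupport (huc i)
      | some α => exact (hd α i).continuous.integrable_of_hasCompactSupport (hdc α i))
    (fun a η hη => by
      cases a with
      | none => exact hnet0 η hη
      | some α => exact hnet α.1 α.2 η hη)
  refine ⟨s, hs, H none, fun α => if hα : α ∈ multiIndices N (ν - 1) then H (some ⟨α, hα⟩) else 0,
    (hH none).1, (hH none).2, fun α hα => ?_⟩
  simp only [hα, dif_pos]
  exact hH (some ⟨α, hα⟩)

end Limits

end DiffOpBV

end

/-! ### Passage from the smooth approximations to the given sequence -/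

theorem mainTheorem6 {N : ℕ} (hN : 2 ≤ N) {ν : ℕ} (hν : 1 ≤ ν)
    {E F : Type*} [NormedAddCommGroup E] [NormedSpace ℂ E] [FiniteDimensional ℂ E]
    [NormedAddCommGroup F] [NormedSpace ℂ F] [FiniteDimensional ℂ F]
    (Ω : Opens (EuclideanSpace ℝ (Fin N))) (A : DiffOpBV.DiffOp Ω ν E F)
    (U : Opens (EuclideanSpace ℝ (Fin N))) (hU : U ≤ Ω)
    (hSGN : A.SupportsSGN U)
    (hfrac : ∃ β : ℝ, 0 < β ∧ β < 1 ∧ A.SupportsFractional U β)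
    (g : ℕ → EuclideanSpace ℝ (Fin N) → E)
    (hg : ∀ i, A.MemBVc U (g i))
    (hsupp : ∃ K : Set (EuclideanSpace ℝ (Fin N)), IsCompact K ∧ K ⊆ U ∧
      ∀ i, DiffOpBV.SuppIn U K (g i))
    (hvar : (⨆ i, A.variation U (g i)) < ⊤) :
    ∃ g₀ : EuclideanSpace ℝ (Fin N) → E, A.MemBVc U g₀ ∧
      ∃ s : ℕ → ℕ, StrictMono s ∧
        Tendsto (fun k => DiffOpBV.sobolevSeminorm (ν - 1) 1 U (fun x => g (s k) x - g₀ x))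
          atTop (𝓝 0) := by
  have : CompleteSpace E := FiniteDimensional.complete ℂ E
  obtain ⟨K, hK, hKU, hgK⟩ := hsupp
  obtain ⟨β, hβ0, hβ1, hβ⟩ := hfrac
  obtain ⟨K', hK', hK'U, C, hC, happ⟩ :=
    A.exists_smooth_approx (by omega) hν hU hK hKU
  set M := ⨆ i, A.variation U (g i) with hM
  have hgM : ∀ i, A.variation U (g i) ≤ M := fun i => le_iSup (fun i => A.variation U (g i)) i
  choose h hh hη using fun i =>
    happ (g i) (hg i).memSobolev (hgK i) (hg i).variation_lt_top
  -- The accuracy (i + 1)⁻¹ tends to zero, so any L¹ limit along a subsequence of `u` is also one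
  -- for `g`, and likewise for the derivatives.
  choose u hu huK hug hud huA using fun i => hη i ((i : ℝ≥0∞) + 1)⁻¹
    (ENNReal.inv_ne_zero.2 (ENNReal.add_ne_top.2 ⟨ENNReal.natCast_ne_top i, ENNReal.one_ne_top⟩))
  have huc : ∀ i, HasCompactSupport (u i) := fun i =>
    hK'.of_isClosed_subset (isClosed_tsupport _) (huK i)
  have hB : ∀ i, ∫⁻ x, ‖A.apply (u i) x‖ₑ ≤ ENNReal.ofReal (C * (M.toReal + 2)) := fun i =>
    (huA i).trans (ENNReal.ofReal_le_ofReal (by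
      gcongr
      · exact hvar.ne
      · exact hgM i))
  obtain ⟨s, hs, g₀, H, hg₀, hug₀, hH⟩ := A.exists_subseq_tendsto hN hSGN hβ0 hβ1 hβ hK' hK'U hu
    huK ENNReal.ofReal_ne_top hB
  have hε : Tendsto (fun k => ((s k : ℝ≥0∞) + 1)⁻¹) atTop (𝓝 0) := by
    have h1 : Tendsto (fun n : ℕ => ((n : ℝ≥0∞) + 1)⁻¹) atTop (𝓝 0) := by
      have := (tendsto_add_atTop_iff_nat 1).2 ENNReal.tendsto_inv_nat_nhds_zero
      simpa using this
    exact h1.comp hs.tendsto_atTop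
  have hgi : ∀ i, IntegrableOn (g i) U := fun i => memLp_one_iff_integrable.1 (hg i).memSobolev.1
  have htri : ∀ {μ : Measure (EuclideanSpace ℝ (Fin N))}
      {a b c : EuclideanSpace ℝ (Fin N) → E}, Integrable a μ → Integrable b μ →
      ∫⁻ x, ‖b x - c x‖ₑ ∂μ ≤ (∫⁻ x, ‖a x - b x‖ₑ ∂μ) + ∫⁻ x, ‖a x - c x‖ₑ ∂μ := by
    intro μ a b c ha hb
    have hm : AEMeasurable (fun x => ‖a x - b x‖ₑ) μ := (ha.sub hb).aestronglyMeasurable.enorm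
    rw [← lintegral_add_left' hm]
    refine lintegral_mono fun x => ?_
    calc ‖b x - c x‖ₑ = ‖-(a x - b x) + (a x - c x)‖ₑ := by congr 1; abel
      _ ≤ ‖a x - b x‖ₑ + ‖a x - c x‖ₑ := (enorm_add_le _ _).trans (by rw [enorm_neg])
  have hui : ∀ i, Integrable (u i) := fun i =>
    (hu i).continuous.integrable_of_hasCompactSupport (huc i)
  have hgg₀ : Tendsto (fun k => ∫⁻ x in U, ‖g (s k) x - g₀ x‖ₑ) atTop (𝓝 0) := by
    refine tendsto_of_tendsto_of_tendsto_of_le_of_le tendsto_const_nhds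
      (by simpa using hε.add (DiffOpBV.tendsto_setLIntegral_of_tendsto (S := U) hug₀))
      (fun _ => zero_le) fun k => ?_
    exact (htri (hui _).restrict (hgi _)).trans (by gcongr; exact hug (s k))
  have hw : ∀ α ∈ DiffOpBV.multiIndices N (ν - 1), DiffOpBV.IsWeakDeriv U α g₀ (H α) :=
    fun α hα => DiffOpBV.isWeakDeriv_of_tendsto (fun k => hu (s k)) (fun k => huc (s k)) hg₀
      (hH α hα).1 hug₀ (hH α hα).2
  refine ⟨g₀, ⟨⟨memLp_one_iff_integrable.2 hg₀.restrict, fun α hα =>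
    ⟨H α, hw α hα, memLp_one_iff_integrable.2 (hH α hα).1.restrict⟩⟩, ⟨K', hK', hK'U, ?_⟩, ?_⟩,
    s, hs, ?_⟩
  · refine ae_restrict_of_ae (DiffOpBV.ae_eq_zero_of_tendsto hK'.measurableSet hg₀ ?_ hug₀)
    exact fun k x hx => image_eq_zero_of_notMem_tsupport fun hx' => hx (huK _ hx')
  · exact (A.variation_le_of_tendsto hU (fun k => hgi (s k)) hg₀.restrict hgg₀
      fun k => hgM (s k)).trans_lt hvar
  · have hsum : Tendsto (fun k => ∑ α ∈ DiffOpBV.multiIndices N (ν - 1),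
        (((s k : ℝ≥0∞) + 1)⁻¹ + ∫⁻ x, ‖DiffOpBV.multiDeriv α (u (s k)) x - H α x‖ₑ))
        atTop (𝓝 0) := by
      have := tendsto_finsetSum (DiffOpBV.multiIndices N (ν - 1)) fun α hα =>
        hε.add (hH α hα).2
      simpa using this
    refine tendsto_of_tendsto_of_tendsto_of_le_of_le tendsto_const_nhds hsum
      (fun _ => zero_le) fun k => ?_
    refine Finset.sum_le_sum fun α hα => ?_
    -- The difference of the two weak derivatives is one candidate in the infimum, which gives an
    -- upper bound without uniqueness of weak derivatives.
    refine (iInf₂_le _ ((hh (s k) α hα).1.sub (hw α hα))).trans ?_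
    rw [eLpNorm_one_eq_lintegral_enorm]
    refine (setLIntegral_le_lintegral _ _).trans ((htri (a := DiffOpBV.multiDeriv α (u (s k)))
      ?_ (hh (s k) α hα).2).trans (by gcongr; exact hud (s k) α hα))
    exact (DiffOpBV.contDiff_multiDeriv (hu _) α).continuous.integrable_of_hasCompactSupport
      ((huc _).of_isClosed_subset (isClosed_tsupport _)
        (DiffOpBV.tsupport_multiDeriv_subset _ α))
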